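/- Let $k$ be an algebraically closed field, $N\ge 0$ an integer, $R=k[[X_1,\dots,X_N]]$, $M=(X_1,\dots,X_N)$, $R_n=R/M^n$. A *curve singularity* of $(k^N,0)=\operatorname{Spec}R$ is a closed subscheme $C=\operatorname{Spec}(R/I)$ with $R/I$ one-dimensional and Cohen–Macaulay; its Hilbert polynomial is the polynomial $h$ with $h(t)=\dim_k R/(I+M^{t+1})$ for $t\gg0$. Fix $p(T)=e_0(T+1)-e_1$ (with $e_0\in\mathbb N$, $e_1\in\mathbb Z$) which is the Hilbert polynomial of some curve singularity of $(k^N,0)$. **Families.** For a $k$-algebra $A$ of finite type and $S=\operatorname{Spec}A$, let $\underline{\mathbf H}_{N,p}(S)$ be the set of closed subschemes $Z=\operatorname{Spec}(A[[X]]/J)$ of $\operatorname{Spec}A[[X_1,\dots,X_N]]$, flat over $S$, such that, with $Z_n$ defined by $J+(X)^n$: (i) for all $n\ge e_0+1$ the morphism $Z_n\to S$ is flat with fibres of length $p(n-1)$; (ii) for every closed point $s\in S$ the fibre $Z_s\subset\operatorname{Spec}\kappa(s)[[X]]$ is a curve singularity with Hilbert polynomial $p$. For a $k$-algebra map $A\to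 A'$ the pull-back of $Z$ is defined by the ideal $J\,A'[[X]]$. **The schemes $\Xi_n$.** There exist linear forms $L_1,\dots,L_s$ in $X_1,\dots,X_N$ over $k$, $s=e_0(N-1)+1$, any $N$ of which are linearly independent; fix any such forms. For $n\ge e_0+1$ consider the functor that sends a $k$-algebra $A$ to the set of ideals $J\supseteq(X)^n$ of $A[[X]]$ (equivalently, ideals of $A\otimes_kR_n$) such that * for $t=e_0+1,\dots,n$ the $A$-module $A[[X]]/(J+(X)^t)$ is locally free of rank $p(t-1)$; * for every point of $\operatorname{Spec}A$, with residue field $K$ and $I=J\,K[[X]]$, there are an index $q$, a set $i$ of $p(e_0-1)$ monomials of degree $<e_0$ and a set $j$ of $e_0$ monomials of degree $e_0$ such that the $K$-span of the $m\in i$ and of the $L_q^r m$, $m\in j$, $0\le r\le n-e_0-1$, maps isomorphically onto $K[[X]]/I$, and $\dim_K K[[X]]/(I+(L_q)+(X)^{e_0+1})\le e_0$. **Theorem.** For every such choice of $L_1,\dots,L_s$: 1. For each $n\ge e_0+1$ this functor on $k$-algebras is represented by a $k$-scheme $\Xi_n$ of finite type. The rule $J\mapsto J+(X)^{n-1}$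 defines morphisms of $k$-schemes $a_n:\Xi_n\to\Xi_{n-1}$ ($n\ge e_0+2$), and $a_n$ is affine for all $n\ge e_0+4$. 2. The inverse system $(\Xi_n,a_n)_{n\ge e_0+1}$ has a limit $\mathbf H_{N,p}$ in the category of $k$-schemes, with projections $\pi_n:\mathbf H_{N,p}\to\Xi_n$. 3. $\mathbf H_{N,p}$ pro-represents $\underline{\mathbf H}_{N,p}$: there is a bijection $\operatorname{Hom}_k(S,\mathbf H_{N,p})\cong\underline{\mathbf H}_{N,p}(S)$, natural in the affine $k$-schemes $S$ of finite type, under which $g:S\to\mathbf H_{N,p}$ corresponds to the family $Z$ such that, for every $n\ge e_0+1$, the morphism $\pi_n g:S\to\Xi_n$ is the classifying morphism of $Z_n$. -/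

import Mathlib

open CategoryTheory CategoryTheory.Limits AlgebraicGeometry Opposite
open scoped TensorProduct

universe u

namespace CurveSing

noncomputable section

/-! ### Power series rings, truncations, curve singularities -/

/-- The polynomial `p(T) = e₀ (T + 1) - e₁`, as a function. -/
def hilbPoly (e₀ : ℕ) (e₁ : ℤ) (t : ℤ) : ℤ := e₀ * (t + 1) - e₁

/-- The ideal `(X₁, …, X_N)` of `A[[X₁, …, X_N]]`. -/
def varIdeal (N : ℕ) (A : Type u) [CommRing A] : Ideal (MvPowerSeries (Fin N) A) :=
  Ideal.span (Set.range MvPowerSeries.X)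

/-- The linear form `c₁ X₁ + ⋯ + c_N X_N` of `A[[X₁, …, X_N]]`. -/
def linForm {N : ℕ} {A : Type u} [CommRing A] (c : Fin N → A) : MvPowerSeries (Fin N) A :=
  ∑ i, MvPowerSeries.C (c i) * MvPowerSeries.X i

/-- Extension of ideals along `A[[X]] → B[[X]]`. For a closed subscheme of `Spec A[[X]]` this is
its base change along `Spec B → Spec A`, as a closed subscheme of `Spec B[[X]]`. -/
def extendIdeal {N : ℕ} {A B : Type u} [CommRing A] [CommRing B] (f : A →+* B)
    (J : Ideal (MvPowerSeries (Fin N) A)) : Ideal (MvPowerSeries (Fin N) B) :=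
  J.map (MvPowerSeries.map f)

/-- Cohen–Macaulayness of a (noetherian) local ring: there is a regular sequence whose length is
the Krull dimension. (Members of an `IsRegular` sequence of a local ring are non-units.) -/
def IsCohenMacaulayLocal (O : Type u) [CommRing O] : Prop :=
  IsLocalRing O ∧
    ∃ rs : List O, RingTheory.Sequence.IsRegular O rs ∧
      ((rs.length : ℕ∞) : WithBot ℕ∞) = ringKrullDim O

/-- The closed subscheme of `(K^N, 0) = Spec K[[X]]` defined by `I` is a curve singularity:
one-dimensional and Cohen–Macaulay. -/
def IsCurveSingularity {N : ℕ} (K : Type u) [Field K] (I : Ideal (MvPowerSeries (Fin N) K)) :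
    Prop :=
  ringKrullDim (MvPowerSeries (Fin N) K ⧸ I) = 1 ∧
    IsCohenMacaulayLocal (MvPowerSeries (Fin N) K ⧸ I)

/-- The Hilbert polynomial of `K[[X]] / I` is `e₀ (T + 1) - e₁`: for all large `t`, the length of
`K[[X]] / (I + (X)^(t+1))` is `e₀ (t + 1) - e₁`. -/
def HasHilbertPolynomial {N : ℕ} (K : Type u) [Field K] (I : Ideal (MvPowerSeries (Fin N) K))
    (e₀ : ℕ) (e₁ : ℤ) : Prop :=
  ∀ᶠ t : ℕ in Filter.atTop,
    (Module.finrank K (MvPowerSeries (Fin N) K ⧸ (I ⊔ varIdeal N K ^ (t + 1))) : ℤ) =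
      hilbPoly e₀ e₁ t

/-! ### The functor of families -/

/-- The closed subscheme `Z ⊆ Spec A[[X]]` defined by `J` is a family over `Spec A` of curve
singularities with Hilbert polynomial `e₀ (T + 1) - e₁`. -/
structure IsFamily (N e₀ : ℕ) (e₁ : ℤ) (A : Type u) [CommRing A]
    (J : Ideal (MvPowerSeries (Fin N) A)) : Prop where
  flat : Module.Flat A (MvPowerSeries (Fin N) A ⧸ J)
  flat_trunc : ∀ n : ℕ, e₀ + 1 ≤ n →
    Module.Flat A (MvPowerSeries (Fin N) A ⧸ (J ⊔ varIdeal N A ^ n))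
  length_trunc : ∀ n : ℕ, e₀ + 1 ≤ n → ∀ P : PrimeSpectrum A,
    (Module.finrank P.asIdeal.ResidueField
      (P.asIdeal.ResidueField ⊗[A] (MvPowerSeries (Fin N) A ⧸ (J ⊔ varIdeal N A ^ n))) : ℤ) =
        hilbPoly e₀ e₁ (n - 1)
  closed_fibre : ∀ (m : Ideal A) [m.IsMaximal],
    letI : Field (A ⧸ m) := Ideal.Quotient.field m
    IsCurveSingularity (A ⧸ m) (extendIdeal (Ideal.Quotient.mk m) J) ∧
      HasHilbertPolynomial (A ⧸ m) (extendIdeal (Ideal.Quotient.mk m) J) e₀ e₁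

/-! ### The functors of points of the schemes `Ξ_n`

A closed subscheme of `Spec (A ⊗ R_n)`, where `R_n = k[[X]] / (X)^n`, is given by an ideal of
`A[[X]]` containing `(X)^n`, because `A ⊗ R_n = A[[X]] / (X)^n`. -/

/-- `Q` is a locally free `A`-module of (constant) finite rank `r`. -/
def IsLocallyFreeOfRank (A : Type u) [CommRing A] (Q : Type u) [AddCommGroup Q] [Module A Q]
    (r : ℤ) : Prop :=
  Module.Finite A Q ∧ Module.Projective A Q ∧
    ∀ P : PrimeSpectrum A, (Module.rankAtStalk (R := A) Q P : ℤ) = r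

/-- The `A`-points of `W'(n) = W(n) ∩ Hilb_n`: ideals `J` of `A ⊗ R_n` such that for every
`t = e₀ + 1, …, n` the quotient of `A ⊗ R_t` by the image of `J` is locally free of rank
`p(t - 1)`. -/
def IsPointW (N e₀ : ℕ) (e₁ : ℤ) (n : ℕ) (A : Type u) [CommRing A]
    (J : Ideal (MvPowerSeries (Fin N) A)) : Prop :=
  varIdeal N A ^ n ≤ J ∧
    ∀ t : ℕ, e₀ + 1 ≤ t → t ≤ n →
      IsLocallyFreeOfRank A (MvPowerSeries (Fin N) A ⧸ (J ⊔ varIdeal N A ^ t))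
        (hilbPoly e₀ e₁ (t - 1))

/-- The subspace `D_n(i, j, ℓ)` of `K[[X]]` spanned by the monomials `X^μ`, `μ ∈ i`, and the
elements `ℓ^r X^μ`, `μ ∈ j`, `0 ≤ r ≤ n - e₀ - 1`. (It maps injectively to `K[[X]] / (X)^n` for
the index sets used below.) -/
def cellSpace {N : ℕ} (e₀ n : ℕ) {K : Type u} [Field K] (i j : Finset (Fin N →₀ ℕ))
    (ℓ : MvPowerSeries (Fin N) K) : Submodule K (MvPowerSeries (Fin N) K) :=
  Submodule.span K
    ({f | ∃ μ ∈ i, f = MvPowerSeries.monomial μ 1} ∪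
      {f | ∃ μ ∈ j, ∃ r < n - e₀, f = ℓ ^ r * MvPowerSeries.monomial μ 1})

/-- Admissible multi-indices: `i` consists of `p(e₀ - 1)` monomials of degree `< e₀`, and `j` of
`e₀` monomials of degree `e₀`. -/
def IsCellIndex {N : ℕ} (e₀ : ℕ) (e₁ : ℤ) (i j : Finset (Fin N →₀ ℕ)) : Prop :=
  (∀ μ ∈ i, μ.degree < e₀) ∧ (i.card : ℤ) = hilbPoly e₀ e₁ ((e₀ : ℤ) - 1) ∧
    (∀ μ ∈ j, μ.degree = e₀) ∧ j.card = e₀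

/-- The `K`-point `K[[X]] / I` lies in the cell `B_n(i, j, ℓ)`: the projection
`D_n(i, j, ℓ) → K[[X]] / I` is an isomorphism. -/
def InCell {N : ℕ} (e₀ n : ℕ) (K : Type u) [Field K] (i j : Finset (Fin N →₀ ℕ))
    (ℓ : MvPowerSeries (Fin N) K) (I : Ideal (MvPowerSeries (Fin N) K)) : Prop :=
  Function.Bijective
    (fun x : cellSpace e₀ n i j ℓ => Ideal.Quotient.mk I (x : MvPowerSeries (Fin N) K))

/-- The `K`-point `K[[X]] / I` lies in `U(ℓ)`: the dimension of
`K[[X]] / (I + (ℓ) + (X)^(e₀+1))` is at most `e₀`. -/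
def InU {N : ℕ} (e₀ : ℕ) (K : Type u) [Field K] (ℓ : MvPowerSeries (Fin N) K)
    (I : Ideal (MvPowerSeries (Fin N) K)) : Prop :=
  Module.finrank K
    (MvPowerSeries (Fin N) K ⧸ (I ⊔ Ideal.span {ℓ} ⊔ varIdeal N K ^ (e₀ + 1))) ≤ e₀

/-- Any `N` of the `e₀ (N - 1) + 1` linear forms `L_q = ∑ L_q i • X_i` are linearly independent. -/
def InGeneralPosition {N e₀ : ℕ} {k : Type u} [Field k]
    (L : Fin (e₀ * (N - 1) + 1) → Fin N → k) : Prop :=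
  ∀ s : Finset (Fin (e₀ * (N - 1) + 1)), s.card = N → LinearIndepOn k L (s : Set _)

/-- The `A`-points of `Ξ_n = W'(n) ∩ B'_n`, where `B'_n` is the union of the open sets
`B_n(i, j, L_q) ∩ U(L_q)`: an `A`-point of `W'(n)` belongs to this open subscheme when all its
fibres over points of `Spec A` do. -/
def IsPointXi {N e₀ : ℕ} (e₁ : ℤ) {k : Type u} [Field k]
    (L : Fin (e₀ * (N - 1) + 1) → Fin N → k) (n : ℕ) (A : Type u) [CommRing A] [Algebra k A]
    (J : Ideal (MvPowerSeries (Fin N) A)) : Prop :=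
  IsPointW N e₀ e₁ n A J ∧
    ∀ P : PrimeSpectrum A, ∃ (i j : Finset (Fin N →₀ ℕ)) (q : Fin (e₀ * (N - 1) + 1)),
      IsCellIndex e₀ e₁ i j ∧
        let K := P.asIdeal.ResidueField
        let ℓ : MvPowerSeries (Fin N) K :=
          linForm fun c => algebraMap A K (algebraMap k A (L q c))
        InCell e₀ n K i j ℓ (extendIdeal (algebraMap A K) J) ∧
          InU e₀ K ℓ (extendIdeal (algebraMap A K) J)

/-! ### Schemes over `k` and functors of ideals -/

/-- `Spec A` as a `k`-scheme. -/
def specOver (k A : Type u) [Field k] [CommRing A] [Algebra k A] :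
    Over (Spec (CommRingCat.of k)) :=
  Over.mk (Spec.map (CommRingCat.ofHom (algebraMap k A)))

/-- The morphism of `k`-schemes `Spec B → Spec A` induced by a `k`-algebra map `A → B`. -/
def specOverMap {k A B : Type u} [Field k] [CommRing A] [Algebra k A] [CommRing B] [Algebra k B]
    (φ : A →ₐ[k] B) : specOver k B ⟶ specOver k A :=
  Over.homMk (Spec.map (CommRingCat.ofHom φ.toRingHom)) (by
    simp only [specOver, Over.mk_left, Over.mk_hom]
    rw [← Spec.map_comp, ← CommRingCat.ofHom_comp]
    congr 2
    exact φ.comp_algebraMap)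

/-- A rule assigning to every `A`-point of the `k`-scheme `X` a closed subscheme of
`Spec A[[X₁, …, X_N]]`. -/
abbrev PointIdeals (N : ℕ) (k : Type u) [Field k] (X : Over (Spec (CommRingCat.of k))) :=
  ∀ (A : Type u) [CommRing A] [Algebra k A],
    (specOver k A ⟶ X) → Ideal (MvPowerSeries (Fin N) A)

/-- The rule `τ` is an isomorphism, natural in `A`, between the functor `A ↦ X(A)` and the functor
`A ↦ {J ⊆ A[[X]] | F A J}` (with extension of ideals as transition maps), both restricted to the
`k`-algebras `A` in the class `T`. -/
structure Represents {N : ℕ} {k : Type u} [Field k] {X : Over (Spec (CommRingCat.of k))}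
    (τ : PointIdeals N k X)
    (T : ∀ (A : Type u) [CommRing A] [Algebra k A], Prop)
    (F : ∀ (A : Type u) [CommRing A] [Algebra k A], Ideal (MvPowerSeries (Fin N) A) → Prop) :
    Prop where
  bijective : ∀ (A : Type u) [CommRing A] [Algebra k A], T A →
    Set.BijOn (τ A) Set.univ {J | F A J}
  natural : ∀ (A B : Type u) [CommRing A] [Algebra k A] [CommRing B] [Algebra k B],
    T A → T B → ∀ (φ : A →ₐ[k] B) (g : specOver k A ⟶ X),
      τ B (specOverMap φ ≫ g) = extendIdeal φ.toRingHom (τ A g)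

end

end CurveSing

/-! A point of Ξ_n is Zariski-locally a point of one of finitely many charts. A chart fixes
monomials X^μ of degree < e₀, monomials X^ν of degree e₀ and a form ℓ = L_q, and asks that the X^μ
together with the ℓ^r X^ν, r < t - e₀, form a basis of A[[X]]/(J + (X)^t) for e₀ < t ≤ n; the
condition U(ℓ) becomes one more basis condition, at order e₀ + 1 (`Chart.Mem`, `isPointXi_iff`). The
coordinates of the monomials of degree < n in this basis satisfy finitely many polynomial equations
that characterise J, so a chart is represented by a k-algebra of finite type
(`Chart.exists_universal`). Inside one chart the others are cut out by the invertibility of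
determinants. The charts thus form an atlas of a Zariski sheaf and glue to a scheme with the
prescribed points (`Atlas.exists_represents`).

The transition maps are controlled by multiplication by ℓ. From the truncation at t to the one at t
+ 1 the dimension grows by e₀, while the quotient modulo ℓ has dimension at most e₀; counting
dimensions, ℓ is injective from K[[X]]/(I + (X)^t) to K[[X]]/(I + (X)^(t+1)) (`mem_of_mul_mem`).
Hence a point of Ξ_{n+1} lies in a chart as soon as its truncation does
(`Chart.mem_succ_of_mem_trunc`). The preimage of a chart is the chart with the same data, every
transition map is affine, and the limit is glued from spectra of colimits of chart algebras
(`nonempty_rep_limFunctor`).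

It remains to compare compatible sequences of truncations with families over A of finite type. A
sequence gives the intersection of its ideals; completeness of A[[X]] and Krull's theorem make this
lossless, and flatness passes to the limit (`flat_of_flat_trunc`). On closed fibres ℓ is a
nonzerodivisor with artinian quotient, so the fibre is a curve singularity.

Conversely, a curve singularity over an algebraically closed field has to lie in a chart. A form
that is not a parameter of the tangent cone vanishes at a nonzero point of it. More than e₀ tangent
lines would make the graded pieces of large degree too big, and each line lies on at most N - 1 of
the hyperplanes, so one of e₀(N - 1) + 1 forms in general position is a parameter (`exists_inU`).
For such a form the Hilbert function is bounded by e₀, and a growth bound for standard monomials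
shows that it cannot increase after degree e₀; being e₀ in large degrees, it is e₀ from degree e₀ on
(`finrank_gradePiece_eq`). This yields the monomials of a chart on the fibre, and Nakayama's lemma
spreads the chart to a neighbourhood (`exists_away_mem`). -/

namespace CurveSing

noncomputable section

/-! ### Affine points of schemes over a field -/

section Points

variable {k : Type u} [Field k]

/-- The morphism of schemes underlying an affine point. -/
def ptHom {T : Over (Spec (CommRingCat.of k))} {A : Type u} [CommRing A] [Algebra k A]
    (x : specOver k A ⟶ T) : Spec (CommRingCat.of A) ⟶ T.left := x.left

theorem ptHom_injective {T : Over (Spec (CommRingCat.of k))} {A : Type u} [CommRing A]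
    [Algebra k A] {x y : specOver k A ⟶ T} (h : ptHom x = ptHom y) : x = y :=
  Over.OverMorphism.ext h

theorem ptHom_w {T : Over (Spec (CommRingCat.of k))} {A : Type u} [CommRing A]
    [Algebra k A] (x : specOver k A ⟶ T) :
    ptHom x ≫ T.hom = Spec.map (CommRingCat.ofHom (algebraMap k A)) := Over.w x

theorem ptHom_comp {T Y : Over (Spec (CommRingCat.of k))} {A : Type u} [CommRing A]
    [Algebra k A] (x : specOver k A ⟶ T) (f : T ⟶ Y) : ptHom (x ≫ f) = ptHom x ≫ f.left := rfl

theorem ptHom_specOverMap_comp {T : Over (Spec (CommRingCat.of k))} {A B : Type u} [CommRing A]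
    [Algebra k A] [CommRing B] [Algebra k B] (φ : A →ₐ[k] B) (x : specOver k A ⟶ T) :
    ptHom (specOverMap φ ≫ x) = Spec.map (CommRingCat.ofHom φ.toRingHom) ≫ ptHom x := rfl

theorem exists_ptHom_eq_of_w {T : Over (Spec (CommRingCat.of k))} {A : Type u} [CommRing A]
    [Algebra k A] (f : Spec (CommRingCat.of A) ⟶ T.left)
    (h : f ≫ T.hom = Spec.map (CommRingCat.ofHom (algebraMap k A))) :
    ∃ x : specOver k A ⟶ T, ptHom x = f :=
  ⟨Over.homMk f h, rfl⟩

theorem exists_ptHom_eq {T : Over (Spec (CommRingCat.of k))} {R : Type u} [CommRing R]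
    (f : Spec (CommRingCat.of R) ⟶ T.left) :
    ∃ (_ : Algebra k R) (x : specOver k R ⟶ T), ptHom x = f := by
  let _ : Algebra k R := (Spec.preimage (f ≫ T.hom)).hom.toAlgebra
  refine ⟨inferInstance, exists_ptHom_eq_of_w f ?_⟩
  have : CommRingCat.ofHom (algebraMap k R) = Spec.preimage (f ≫ T.hom) := rfl
  rw [this, Spec.map_preimage]

/-- A morphism of affine schemes compatible with given structure maps to `Spec k` comes from a
homomorphism of `k`-algebras. -/
theorem exists_algHom_of_w {A B : Type u} [CommRing A] [Algebra k A] [CommRing B] [Algebra k B]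
    (p : Spec (CommRingCat.of B) ⟶ Spec (CommRingCat.of A))
    (hp : p ≫ Spec.map (CommRingCat.ofHom (algebraMap k A)) =
      Spec.map (CommRingCat.ofHom (algebraMap k B))) :
    ∃ φ : A →ₐ[k] B, p = Spec.map (CommRingCat.ofHom φ.toRingHom) := by
  let ψ : CommRingCat.of A ⟶ CommRingCat.of B := Spec.preimage p
  have hψ : Spec.map ψ = p := Spec.map_preimage _
  have h : CommRingCat.ofHom (algebraMap k A) ≫ ψ = CommRingCat.ofHom (algebraMap k B) := by
    apply Spec.map_injective
    rw [Spec.map_comp, hψ]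
    exact hp
  exact ⟨{ toRingHom := ψ.hom, commutes' := fun r => congrArg (fun q => q.hom r) h }, hψ.symm⟩

theorem specMap_algHom_injective {A B : Type u} [CommRing A] [Algebra k A] [CommRing B]
    [Algebra k B] {φ ψ : A →ₐ[k] B}
    (h : Spec.map (CommRingCat.ofHom φ.toRingHom) = Spec.map (CommRingCat.ofHom ψ.toRingHom)) :
    φ = ψ := by
  have h2 := congrArg CommRingCat.Hom.hom (Spec.map_injective h)
  ext a
  exact congrArg (fun q : A →+* B => q a) h2

theorem specMap_algHom_comp {A B C : Type u} [CommRing A] [Algebra k A] [CommRing B] [Algebra k B]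
    [CommRing C] [Algebra k C] (ψ : B →ₐ[k] C) (φ : A →ₐ[k] B) :
    Spec.map (CommRingCat.ofHom (ψ.comp φ).toRingHom) =
      Spec.map (CommRingCat.ofHom ψ.toRingHom) ≫ Spec.map (CommRingCat.ofHom φ.toRingHom) := by
  rw [← Spec.map_comp]
  rfl

theorem specMap_algHom_w {A B : Type u} [CommRing A] [Algebra k A] [CommRing B] [Algebra k B]
    (φ : A →ₐ[k] B) :
    Spec.map (CommRingCat.ofHom φ.toRingHom) ≫ Spec.map (CommRingCat.ofHom (algebraMap k A)) =
      Spec.map (CommRingCat.ofHom (algebraMap k B)) := by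
  rw [← Spec.map_comp, ← CommRingCat.ofHom_comp]
  congr 2
  exact φ.comp_algebraMap

theorem specOverMap_id (A : Type u) [CommRing A] [Algebra k A] :
    specOverMap (AlgHom.id k A) = 𝟙 (specOver k A) :=
  Over.OverMorphism.ext (Spec.map_id _)

theorem specOverMap_comp {A B C : Type u} [CommRing A] [Algebra k A] [CommRing B] [Algebra k B]
    [CommRing C] [Algebra k C] (ψ : B →ₐ[k] C) (φ : A →ₐ[k] B) :
    specOverMap (ψ.comp φ) = specOverMap ψ ≫ specOverMap φ :=
  Over.OverMorphism.ext (specMap_algHom_comp ψ φ)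

/-- Two morphisms out of a scheme `W` agree if they agree on all affine test objects lying over
some member of an open cover of the target of `h : W ⟶ Z`. -/
theorem hom_ext_of_cover {W Y Z : Scheme.{u}} (h : W ⟶ Z) (𝒰 : Z.OpenCover) {f g : W ⟶ Y}
    (H : ∀ (R : CommRingCat.{u}) (i : 𝒰.I₀) (y : Spec R ⟶ W) (z : Spec R ⟶ 𝒰.X i),
      y ≫ h = z ≫ 𝒰.f i → y ≫ f = y ≫ g) : f = g := by
  refine Scheme.hom_ext_of_forall f g fun x => ?_
  obtain ⟨i, z, hz⟩ := 𝒰.exists_eq (h x)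
  let U : W.Opens := h ⁻¹ᵁ (𝒰.f i).opensRange
  have hxU : x ∈ U := ⟨z, hz⟩
  obtain ⟨V, hV, hxV, hVU⟩ := TopologicalSpace.Opens.isBasis_iff_nbhd.mp W.isBasis_affineOpens hxU
  refine ⟨V, hxV, ?_⟩
  have hV' : IsAffineOpen V := hV
  have e := hV'.fromSpec
  have hr : Set.range (hV'.fromSpec ≫ h) ⊆ Set.range (𝒰.f i) := by
    rintro _ ⟨y, rfl⟩
    have : hV'.fromSpec y ∈ V := by
      have := Set.mem_range_self (f := hV'.fromSpec) y
      rw [hV'.range_fromSpec] at this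
      exact this
    exact hVU this
  have key := H _ i hV'.fromSpec (IsOpenImmersion.lift (𝒰.f i) (hV'.fromSpec ≫ h) hr)
    (IsOpenImmersion.lift_fac _ _ _).symm
  rw [IsAffineOpen.fromSpec, Category.assoc, Category.assoc] at key
  exact (cancel_epi _).mp key

theorem hom_ext_of_affine {W Y : Scheme.{u}} {f g : W ⟶ Y}
    (H : ∀ (R : CommRingCat.{u}) (y : Spec R ⟶ W), y ≫ f = y ≫ g) : f = g :=
  W.affineCover.hom_ext _ _ fun _ => H _ _

theorem over_hom_ext {T Y : Over (Spec (CommRingCat.of k))} {f g : T ⟶ Y}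
    (H : ∀ (A : Type u) [CommRing A] [Algebra k A] (x : specOver k A ⟶ T), x ≫ f = x ≫ g) :
    f = g := by
  ext1
  refine hom_ext_of_affine fun R y => ?_
  obtain ⟨_, x, rfl⟩ := exists_ptHom_eq (T := T) (R := R) y
  rw [← ptHom_comp, ← ptHom_comp, H R x]

/-- The overlap condition for gluing the morphisms given by `θ`. The ring C carries no k-structure;
it receives the one induced through p, after which p and q both come from k-algebra maps and
naturality applies. -/
theorem natural_comp_eq {T Y : Over (Spec (CommRingCat.of k))}
    (θ : ∀ (A : Type u) [CommRing A] [Algebra k A], (specOver k A ⟶ T) → (specOver k A ⟶ Y))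
    (hθ : ∀ (A B : Type u) [CommRing A] [Algebra k A] [CommRing B] [Algebra k B] (φ : A →ₐ[k] B)
      (x : specOver k A ⟶ T), θ B (specOverMap φ ≫ x) = specOverMap φ ≫ θ A x)
    {A B C : Type u} [CommRing A] [Algebra k A] [CommRing B] [Algebra k B]
    [CommRing C] (x : specOver k A ⟶ T) (y : specOver k B ⟶ T)
    (p : Spec (.of C) ⟶ Spec (.of A)) (q : Spec (.of C) ⟶ Spec (.of B))
    (h : p ≫ ptHom x = q ≫ ptHom y) : p ≫ ptHom (θ A x) = q ≫ ptHom (θ B y) := by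
  obtain ⟨_, hC⟩ : ∃ _ : Algebra k C, Spec.map (CommRingCat.ofHom (algebraMap k C)) =
      p ≫ Spec.map (CommRingCat.ofHom (algebraMap k A)) := by
    refine ⟨(Spec.preimage (p ≫ Spec.map (CommRingCat.ofHom (algebraMap k A)))).hom.toAlgebra, ?_⟩
    exact Spec.map_preimage _
  obtain ⟨φ, rfl⟩ := exists_algHom_of_w p hC.symm
  obtain ⟨ψ, rfl⟩ := exists_algHom_of_w q (by
    rw [hC, ← ptHom_w y, ← ptHom_w x, ← Category.assoc, ← h, Category.assoc])
  have h' : specOverMap φ ≫ x = specOverMap ψ ≫ y := ptHom_injective h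
  rw [← ptHom_specOverMap_comp, ← ptHom_specOverMap_comp, ← hθ, ← hθ, h']

theorem exists_hom_of_affineOpenCover {T Y : Scheme.{u}} (𝒰 : T.AffineOpenCover)
    (m : ∀ i : 𝒰.I₀, Spec (𝒰.X i) ⟶ Y)
    (H : ∀ (i j : 𝒰.I₀) (S : CommRingCat.{u}) (p : Spec S ⟶ Spec (𝒰.X i))
      (q : Spec S ⟶ Spec (𝒰.X j)), p ≫ 𝒰.f i = q ≫ 𝒰.f j → p ≫ m i = q ≫ m j) :
    ∃ f : T ⟶ Y, ∀ i, 𝒰.f i ≫ f = m i :=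
  ⟨𝒰.openCover.glueMorphisms m fun i j => hom_ext_of_affine fun S y =>
    (Category.assoc _ _ _).symm.trans <|
      (H i j S (y ≫ pullback.fst _ _) (y ≫ pullback.snd _ _)
        ((Category.assoc _ _ _).trans <| (congrArg (y ≫ ·) pullback.condition).trans
          (Category.assoc _ _ _).symm)).trans (Category.assoc _ _ _),
    fun i => 𝒰.openCover.ι_glueMorphisms _ _ i⟩

/-- A natural transformation between the functors of affine points of two `k`-schemes is induced
by a morphism. -/
theorem exists_hom_of_natural {T Y : Over (Spec (CommRingCat.of k))}
    (θ : ∀ (A : Type u) [CommRing A] [Algebra k A], (specOver k A ⟶ T) → (specOver k A ⟶ Y))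
    (hθ : ∀ (A B : Type u) [CommRing A] [Algebra k A] [CommRing B] [Algebra k B] (φ : A →ₐ[k] B)
      (x : specOver k A ⟶ T), θ B (specOverMap φ ≫ x) = specOverMap φ ≫ θ A x) :
    ∃ f : T ⟶ Y, ∀ (A : Type u) [CommRing A] [Algebra k A] (x : specOver k A ⟶ T),
      x ≫ f = θ A x := by
  obtain ⟨𝒰, -⟩ : ∃ 𝒰 : Scheme.AffineOpenCover.{u} T.left, 𝒰 = 𝒰 := ⟨T.left.affineOpenCover, rfl⟩
  have hpt : ∀ i : 𝒰.I₀, ∃ (_ : Algebra k (𝒰.X i)) (x : specOver k (𝒰.X i) ⟶ T),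
    ptHom x = 𝒰.f i := fun i => exists_ptHom_eq (R := 𝒰.X i) _
  choose alg pt hpt using hpt
  obtain ⟨f₀, hf₀⟩ := exists_hom_of_affineOpenCover 𝒰 (fun i => ptHom (θ (𝒰.X i) (pt i)))
    (fun i j S p q h => natural_comp_eq θ hθ (C := S) (pt i) (pt j) p q (by
      rw [hpt, hpt]; exact h))
  -- The glued morphism agrees with `θ` at any x, because locally x factors through a member of the
  -- cover.
  have main : ∀ (A : Type u) [CommRing A] [Algebra k A] (x : specOver k A ⟶ T),
      ptHom x ≫ f₀ = ptHom (θ A x) := by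
    intro A _ _ x
    refine hom_ext_of_cover (ptHom x) 𝒰.openCover fun S (i : 𝒰.I₀) y
      (z : Spec S ⟶ Spec (𝒰.X i)) hyz => ?_
    rw [← Category.assoc, hyz]
    refine (Category.assoc _ _ _).trans ((congrArg (z ≫ ·) (hf₀ i)).trans ?_)
    refine (natural_comp_eq θ hθ (C := S) x (pt i) y z ?_).symm
    rw [hpt]
    exact hyz
  refine ⟨Over.homMk f₀ ?_, fun A _ _ x => ptHom_injective (main A x)⟩
  refine hom_ext_of_affine fun S y => ?_
  obtain ⟨_, x, rfl⟩ := exists_ptHom_eq (T := T) (R := S) y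
  rw [← Category.assoc, main, ptHom_w, ptHom_w]

end Points

end

end CurveSing

namespace CurveSing

noncomputable section

/-! ### Zariski sheaves on `k`-algebras -/

/-- A set-valued functor on `k`-algebras. -/
structure AlgFunctor (k : Type u) [Field k] where
  obj : ∀ (A : Type u) [CommRing A] [Algebra k A], Type u
  map : ∀ {A B : Type u} [CommRing A] [Algebra k A] [CommRing B] [Algebra k B],
    (A →ₐ[k] B) → obj A → obj B
  map_id : ∀ {A : Type u} [CommRing A] [Algebra k A] (x : obj A), map (AlgHom.id k A) x = x
  map_comp : ∀ {A B C : Type u} [CommRing A] [Algebra k A] [CommRing B] [Algebra k B]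
    [CommRing C] [Algebra k C] (ψ : B →ₐ[k] C) (φ : A →ₐ[k] B) (x : obj A),
    map (ψ.comp φ) x = map ψ (map φ x)

/-- The localization map `A → A_a` as a map of `k`-algebras. -/
abbrev awayMap (k : Type u) [Field k] {A : Type u} [CommRing A] [Algebra k A] (a : A) :
    A →ₐ[k] Localization.Away a :=
  IsScalarTower.toAlgHom k A (Localization.Away a)

theorem exists_awayLift {k : Type u} [Field k] {A B : Type u} [CommRing A] [Algebra k A]
    [CommRing B] [Algebra k B] (a : A) (φ : A →ₐ[k] B) (h : IsUnit (φ a)) :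
    ∃ ψ : Localization.Away a →ₐ[k] B, ψ.comp (awayMap k a) = φ := by
  refine ⟨IsLocalization.liftAlgHom (M := Submonoid.powers a) (f := φ) ?_, ?_⟩
  · rintro ⟨_, n, rfl⟩
    simpa using h.pow n
  · ext x
    simp

theorem awayHom_ext {k : Type u} [Field k] {A B : Type u} [CommRing A] [Algebra k A]
    [CommRing B] [Algebra k B] {a : A} {φ ψ : Localization.Away a →ₐ[k] B}
    (h : φ.comp (awayMap k a) = ψ.comp (awayMap k a)) : φ = ψ := by
  apply AlgHom.coe_ringHom_injective
  refine IsLocalization.ringHom_ext (Submonoid.powers a) ?_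
  ext x
  exact congrArg (fun q : A →ₐ[k] B => q x) h

/-- The induced map `A_a → B_{φ a}`. -/
theorem exists_awayMap_comm {k : Type u} [Field k] {A B : Type u} [CommRing A] [Algebra k A]
    [CommRing B] [Algebra k B] (a : A) (φ : A →ₐ[k] B) :
    ∃ ψ : Localization.Away a →ₐ[k] Localization.Away (φ a),
      ψ.comp (awayMap k a) = (awayMap k (φ a)).comp φ :=
  exists_awayLift a _ (IsLocalization.Away.algebraMap_isUnit (φ a))

theorem span_image_eq_top {A B : Type u} [CommRing A] [CommRing B] (φ : A →+* B) {s : Set A}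
    (hs : Ideal.span s = ⊤) : Ideal.span (φ '' s) = ⊤ := by
  rw [← Ideal.map_span, hs, Ideal.map_top]

/-- If every prime avoids some element of `s`, then finitely many elements of `s` generate the
unit ideal. -/
theorem exists_finset_span_eq_top {A : Type u} [CommRing A] {s : Set A}
    (h : ∀ P : PrimeSpectrum A, ∃ a ∈ s, a ∉ P.asIdeal) :
    ∃ t : Finset A, (t : Set A) ⊆ s ∧ Ideal.span (t : Set A) = ⊤ := by
  rw [← Ideal.span_eq_top_iff_finite]
  by_contra hne
  obtain ⟨m, hm, hle⟩ := Ideal.exists_le_maximal _ hne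
  obtain ⟨a, ha, ham⟩ := h ⟨m, hm.isPrime⟩
  exact ham (hle (Ideal.subset_span ha))

theorem exists_notMem_of_span_eq_top {A : Type u} [CommRing A] {s : Set A}
    (hs : Ideal.span s = ⊤) (P : PrimeSpectrum A) : ∃ a ∈ s, a ∉ P.asIdeal := by
  by_contra! h
  exact P.isPrime.ne_top (top_le_iff.mp (hs ▸ Ideal.span_le.mpr h))

namespace AlgFunctor

variable {k : Type u} [Field k]

/-- Separatedness and gluing for finite covers by basic open sets. -/
structure IsSheaf (F : AlgFunctor k) : Prop where
  sep : ∀ {A : Type u} [CommRing A] [Algebra k A] (s : Finset A), Ideal.span (s : Set A) = ⊤ →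
    ∀ x y : F.obj A, (∀ a ∈ s, F.map (awayMap k a) x = F.map (awayMap k a) y) → x = y
  glue : ∀ {A : Type u} [CommRing A] [Algebra k A] (s : Finset A), Ideal.span (s : Set A) = ⊤ →
    ∀ x : ∀ a : s, F.obj (Localization.Away (a : A)),
      (∀ (a b : s) (B : Type u) [CommRing B] [Algebra k B]
        (φ : Localization.Away (a : A) →ₐ[k] B) (ψ : Localization.Away (b : A) →ₐ[k] B),
        φ.comp (awayMap k (a : A)) = ψ.comp (awayMap k (b : A)) →
          F.map φ (x a) = F.map ψ (x b)) →
      ∃ y : F.obj A, ∀ a : s, F.map (awayMap k (a : A)) y = x a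

/-- Zariski-locally every point of `F` comes from one of the points `u c ∈ F (R c)`. -/
def IsCovering (F : AlgFunctor k) {ι : Type*} (R : ι → Type u) [∀ c, CommRing (R c)]
    [∀ c, Algebra k (R c)] (u : ∀ c, F.obj (R c)) : Prop :=
  ∀ (A : Type u) [CommRing A] [Algebra k A] (x : F.obj A) (P : PrimeSpectrum A),
    ∃ a ∉ P.asIdeal, ∃ (c : ι) (h : R c →ₐ[k] Localization.Away a),
      F.map (awayMap k a) x = F.map h (u c)

variable {ι : Type*} {R : ι → Type u} [∀ c, CommRing (R c)] [∀ c, Algebra k (R c)]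

/-- Quasi-compactness of Spec A replaces the pointwise covering by a finite one. -/
theorem IsCovering.exists_finset {F : AlgFunctor k} {u : ∀ c, F.obj (R c)}
    (hF : F.IsCovering R u) {A : Type u} [CommRing A] [Algebra k A] (x : F.obj A) :
    ∃ s : Finset A, Ideal.span (s : Set A) = ⊤ ∧ ∀ a ∈ s, ∃ (c : ι)
      (h : R c →ₐ[k] Localization.Away a), F.map (awayMap k a) x = F.map h (u c) := by
  obtain ⟨s, hs, hs'⟩ := exists_finset_span_eq_top
    (s := {a : A | ∃ (c : ι) (h : R c →ₐ[k] Localization.Away a),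
      F.map (awayMap k a) x = F.map h (u c)})
    (fun P => by
      obtain ⟨a, ha, h⟩ := hF A x P
      exact ⟨a, h, ha⟩)
  exact ⟨s, hs', fun a ha => hs ha⟩

open Classical in
theorem IsSheaf.sep_map {F : AlgFunctor k} (hF : F.IsSheaf) {A B : Type u} [CommRing A]
    [Algebra k A] [CommRing B] [Algebra k B] {s : Finset A} (hs : Ideal.span (s : Set A) = ⊤)
    (φ : A →ₐ[k] B) {x y : F.obj B}
    (h : ∀ a ∈ s, F.map (awayMap k (φ a)) x = F.map (awayMap k (φ a)) y) : x = y := by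
  refine hF.sep (s.image φ) ?_ x y ?_
  · rw [Finset.coe_image]
    exact span_image_eq_top φ.toRingHom hs
  · intro b hb
    obtain ⟨a, ha, rfl⟩ := Finset.mem_image.mp hb
    exact h a ha

/-- A transformation from a covered functor to a sheaf is determined by, and can be prescribed
on, the covering points. -/
theorem exists_transformation {G F : AlgFunctor k} {g : ∀ c, G.obj (R c)} {u : ∀ c, F.obj (R c)}
    (hG : G.IsCovering R g) (hF : F.IsSheaf)
    (hgu : ∀ (c c' : ι) (B : Type u) [CommRing B] [Algebra k B] (h : R c →ₐ[k] B)
      (h' : R c' →ₐ[k] B), G.map h (g c) = G.map h' (g c') → F.map h (u c) = F.map h' (u c')) :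
    ∃ τ : ∀ (A : Type u) [CommRing A] [Algebra k A], G.obj A → F.obj A,
      (∀ (A B : Type u) [CommRing A] [Algebra k A] [CommRing B] [Algebra k B] (φ : A →ₐ[k] B)
        (x : G.obj A), τ B (G.map φ x) = F.map φ (τ A x)) ∧ ∀ c, τ (R c) (g c) = u c := by
  -- The image y of x is pinned down by its restriction to every B over which x becomes a pull-back
  -- of a covering point. In this form the naturality of the choice can be checked locally.
  have key : ∀ (A : Type u) [CommRing A] [Algebra k A] (x : G.obj A), ∃ y : F.obj A,
      ∀ (B : Type u) [CommRing B] [Algebra k B] (φ : A →ₐ[k] B) (c : ι) (h : R c →ₐ[k] B),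
        G.map φ x = G.map h (g c) → F.map φ y = F.map h (u c) := by
    intro A _ _ x
    obtain ⟨s, hs, hs'⟩ := hG.exists_finset x
    choose c h hc using hs'
    obtain ⟨y, hy⟩ := hF.glue s hs (fun a => F.map (h a a.2) (u _)) (by
      intro a b B _ _ φ ψ hφψ
      rw [← F.map_comp, ← F.map_comp]
      refine hgu _ _ _ _ _ ?_
      rw [G.map_comp, G.map_comp, ← hc, ← hc, ← G.map_comp, ← G.map_comp, hφψ])
    refine ⟨y, fun B _ _ φ c' h' hx => ?_⟩
    refine hF.sep_map hs φ fun a ha => ?_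
    obtain ⟨ψ, hψ⟩ := exists_awayMap_comm a φ
    rw [← F.map_comp, ← hψ, F.map_comp, hy ⟨a, ha⟩, ← F.map_comp, ← F.map_comp]
    refine hgu _ _ _ _ _ ?_
    rw [G.map_comp, ← hc, ← G.map_comp, hψ, G.map_comp, hx, G.map_comp]
  choose τ hτ using key
  have nat : ∀ (A B : Type u) [CommRing A] [Algebra k A] [CommRing B] [Algebra k B] (φ : A →ₐ[k] B)
      (x : G.obj A), τ B (G.map φ x) = F.map φ (τ A x) := by
    intro A B _ _ _ _ φ x
    obtain ⟨s, hs, hs'⟩ := hG.exists_finset x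
    refine hF.sep_map hs φ fun a ha => ?_
    obtain ⟨ψ, hψ⟩ := exists_awayMap_comm a φ
    obtain ⟨c, h, hc⟩ := hs' a ha
    rw [hτ B _ _ (awayMap k (φ a)) c (ψ.comp h), ← F.map_comp,
      hτ A x _ _ c (ψ.comp h)]
    · rw [← hψ, G.map_comp, hc, G.map_comp]
    · rw [← G.map_comp, ← hψ, G.map_comp, hc, G.map_comp]
  refine ⟨τ, nat, fun c => ?_⟩
  have := hτ (R c) (g c) _ (AlgHom.id k _) c (AlgHom.id k _) rfl
  rwa [F.map_id, F.map_id] at this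

/-- Used to see that the transformations built in the two directions are mutually inverse: each
composite fixes the covering points, and these determine everything locally. -/
theorem transformation_eq_id {F : AlgFunctor k} {u : ∀ c, F.obj (R c)}
    (hF : F.IsCovering R u) (hs : F.IsSheaf)
    (τ : ∀ (A : Type u) [CommRing A] [Algebra k A], F.obj A → F.obj A)
    (nat : ∀ (A B : Type u) [CommRing A] [Algebra k A] [CommRing B] [Algebra k B] (φ : A →ₐ[k] B)
        (x : F.obj A), τ B (F.map φ x) = F.map φ (τ A x))
    (hu : ∀ c, τ (R c) (u c) = u c) (A : Type u) [CommRing A] [Algebra k A] (x : F.obj A) :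
    τ A x = x := by
  obtain ⟨s, h1, h2⟩ := hF.exists_finset x
  refine hs.sep s h1 _ _ fun a ha => ?_
  obtain ⟨c, h, hc⟩ := h2 a ha
  rw [← nat, hc, nat, hu]

/-- Two sheaves covered by the same charts with the same gluing relation are isomorphic. -/
theorem exists_bijective_transformation {G F : AlgFunctor k} {g : ∀ c, G.obj (R c)}
    {u : ∀ c, F.obj (R c)} (hG : G.IsCovering R g) (hF : F.IsCovering R u) (hG' : G.IsSheaf)
    (hF' : F.IsSheaf)
    (hgu : ∀ (c c' : ι) (B : Type u) [CommRing B] [Algebra k B] (h : R c →ₐ[k] B)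
      (h' : R c' →ₐ[k] B), G.map h (g c) = G.map h' (g c') ↔ F.map h (u c) = F.map h' (u c')) :
    ∃ τ : ∀ (A : Type u) [CommRing A] [Algebra k A], G.obj A → F.obj A,
      (∀ (A : Type u) [CommRing A] [Algebra k A], Function.Bijective (τ A)) ∧
      (∀ (A B : Type u) [CommRing A] [Algebra k A] [CommRing B] [Algebra k B] (φ : A →ₐ[k] B)
        (x : G.obj A), τ B (G.map φ x) = F.map φ (τ A x)) ∧ ∀ c, τ (R c) (g c) = u c := by
  obtain ⟨τ, nat, hτ⟩ := exists_transformation hG hF' fun c c' B _ _ h h' => (hgu c c' B h h').mp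
  obtain ⟨σ, nat', hσ⟩ := exists_transformation hF hG' fun c c' B _ _ h h' => (hgu c c' B h h').mpr
  refine ⟨τ, fun A _ _ => ?_, nat, hτ⟩
  refine Function.bijective_iff_has_inverse.mpr ⟨σ A, fun x => ?_, fun x => ?_⟩
  · exact transformation_eq_id hG hG' (fun A _ _ x => σ A (τ A x))
      (fun A B _ _ _ _ φ x => by rw [nat, nat']) (fun c => by rw [hτ, hσ]) A x
  · exact transformation_eq_id hF hF' (fun A _ _ x => τ A (σ A x))
      (fun A B _ _ _ _ φ x => by rw [nat', nat]) (fun c => by rw [hσ, hτ]) A x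

/-- The functor of affine points of a `k`-scheme. -/
def points (X : Over (Spec (CommRingCat.of k))) : AlgFunctor k where
  obj A _ _ := specOver k A ⟶ X
  map φ x := specOverMap φ ≫ x
  map_id x := by rw [specOverMap_id, Category.id_comp]
  map_comp ψ φ x := by rw [specOverMap_comp, Category.assoc]

end AlgFunctor

/-! ### Covers of an affine scheme by basic open subsets -/

section Away

variable {k : Type u} [Field k] {A : Type u} [CommRing A] [Algebra k A]

/-- The basic open immersion `Spec A_a → Spec A`. -/
def awaySpec (a : A) : Spec (CommRingCat.of (Localization.Away a)) ⟶ Spec (CommRingCat.of A) :=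
  Spec.map (CommRingCat.ofHom (algebraMap A (Localization.Away a)))

theorem awaySpec_eq (a : A) :
    awaySpec a = Spec.map (CommRingCat.ofHom (awayMap k a).toRingHom) := rfl

theorem hom_ext_of_span {s : Finset A} (hs : Ideal.span (s : Set A) = ⊤) {Y : Scheme.{u}}
    {f g : Spec (CommRingCat.of A) ⟶ Y} (h : ∀ a ∈ s, awaySpec a ≫ f = awaySpec a ≫ g) :
    f = g :=
  (Scheme.affineOpenCoverOfSpanRangeEqTop (R := CommRingCat.of A) (fun a : s => (a : A))
    (by simpa using hs)).openCover.hom_ext _ _ fun a => h a.1 a.2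

theorem exists_hom_of_span {s : Finset A} (hs : Ideal.span (s : Set A) = ⊤) {Y : Scheme.{u}}
    (m : ∀ a : s, Spec (CommRingCat.of (Localization.Away (a : A))) ⟶ Y)
    (H : ∀ (a b : s) (S : CommRingCat.{u})
      (p : Spec S ⟶ Spec (CommRingCat.of (Localization.Away (a : A))))
      (q : Spec S ⟶ Spec (CommRingCat.of (Localization.Away (b : A)))),
      p ≫ awaySpec (a : A) = q ≫ awaySpec (b : A) → p ≫ m a = q ≫ m b) :
    ∃ f : Spec (CommRingCat.of A) ⟶ Y, ∀ a : s, awaySpec (a : A) ≫ f = m a :=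
  exists_hom_of_affineOpenCover (Scheme.affineOpenCoverOfSpanRangeEqTop (R := CommRingCat.of A)
    (fun a : s => (a : A)) (by simpa using hs)) m H

theorem awaySpec_w (a : A) :
    awaySpec a ≫ Spec.map (CommRingCat.ofHom (algebraMap k A)) =
      Spec.map (CommRingCat.ofHom (algebraMap k (Localization.Away a))) :=
  specMap_algHom_w (awayMap k a)

end Away

namespace AlgFunctor

variable {k : Type u} [Field k]

/-- Morphisms into a scheme glue along basic open covers. The test ring S of an overlap gets its
k-structure from p, so that the compatibility assumed for k-algebras covers all overlaps. -/
theorem points_isSheaf (X : Over (Spec (CommRingCat.of k))) : (points X).IsSheaf where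
  sep {A} _ _ s hs x y h :=
    ptHom_injective (hom_ext_of_span hs fun a ha => congrArg ptHom (h a ha))
  glue {A} _ _ s hs x h := by
    obtain ⟨f, hf⟩ := exists_hom_of_span hs (fun a => ptHom (x a)) (by
      intro a b S p q hpq
      obtain ⟨_, hC⟩ : ∃ _ : Algebra k S, Spec.map (CommRingCat.ofHom (algebraMap k S)) =
          p ≫ Spec.map (CommRingCat.ofHom (algebraMap k (Localization.Away (a : A)))) :=
        ⟨(Spec.preimage (p ≫ Spec.map (CommRingCat.ofHom
          (algebraMap k (Localization.Away (a : A)))))).hom.toAlgebra, Spec.map_preimage _⟩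
      obtain ⟨φ, rfl⟩ := exists_algHom_of_w (A := Localization.Away (a : A)) (B := S) p hC.symm
      obtain ⟨ψ, rfl⟩ := exists_algHom_of_w (A := Localization.Away (b : A)) (B := S) q (by
        rw [hC, ← awaySpec_w, ← awaySpec_w, ← Category.assoc, ← hpq, Category.assoc])
      have := h a b S φ ψ (specMap_algHom_injective (by
        rw [specMap_algHom_comp, specMap_algHom_comp, ← awaySpec_eq, ← awaySpec_eq]
        exact hpq))
      exact congrArg ptHom this)
    have hw : f ≫ X.hom = Spec.map (CommRingCat.ofHom (algebraMap k A)) := by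
      refine hom_ext_of_span hs fun a ha => ?_
      rw [← Category.assoc, hf ⟨a, ha⟩]
      exact (ptHom_w (x ⟨a, ha⟩)).trans (awaySpec_w a).symm
    obtain ⟨y, hy⟩ := exists_ptHom_eq_of_w f hw
    exact ⟨y, fun a => ptHom_injective ((congrArg (awaySpec _ ≫ ·) hy).trans (hf a))⟩

end AlgFunctor

end

end CurveSing

namespace CurveSing

noncomputable section

/-! ### Gluing affine charts of a Zariski sheaf -/

namespace AlgFunctor

variable {k : Type u} [Field k]

/-- The subfunctor `Q` of `F` is represented by the `k`-algebra `R`, with universal point `pt`. -/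
structure Rep (F : AlgFunctor k)
    (Q : ∀ (A : Type u) [CommRing A] [Algebra k A], F.obj A → Prop) where
  R : Type u
  [commRing : CommRing R]
  [algebra : Algebra k R]
  pt : F.obj R
  mem : Q R pt
  exists_hom : ∀ (A : Type u) [CommRing A] [Algebra k A] (x : F.obj A), Q A x →
    ∃ h : R →ₐ[k] A, F.map h pt = x
  hom_ext : ∀ (A : Type u) [CommRing A] [Algebra k A] (h h' : R →ₐ[k] A),
    F.map h pt = F.map h' pt → h = h'

attribute [instance] Rep.commRing Rep.algebra

/-- Compatible subfunctors. -/
def IsStable (F : AlgFunctor k)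
    (Q : ∀ (A : Type u) [CommRing A] [Algebra k A], F.obj A → Prop) : Prop :=
  ∀ (A B : Type u) [CommRing A] [Algebra k A] [CommRing B] [Algebra k B] (φ : A →ₐ[k] B)
    (x : F.obj A), Q A x → Q B (F.map φ x)

variable {F : AlgFunctor k}
  {Q Q' : ∀ (A : Type u) [CommRing A] [Algebra k A], F.obj A → Prop}

/-- A basic open subfunctor of a representable functor is represented by the localization. -/
def Rep.localization (r : Rep F Q) (f : r.R)
    (hQ : ∀ (A : Type u) [CommRing A] [Algebra k A] (x : F.obj A), Q' A x → Q A x)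
    (hf : ∀ (B : Type u) [CommRing B] [Algebra k B] (φ : r.R →ₐ[k] B),
      Q' B (F.map φ r.pt) ↔ IsUnit (φ f)) : Rep F Q' where
  R := Localization.Away f
  pt := F.map (awayMap k f) r.pt
  mem := (hf _ _).mpr (IsLocalization.Away.algebraMap_isUnit f)
  exists_hom A _ _ x hx := by
    obtain ⟨h, rfl⟩ := r.exists_hom A x (hQ A x hx)
    obtain ⟨ψ, rfl⟩ := exists_awayLift f h ((hf A h).mp hx)
    exact ⟨ψ, (F.map_comp _ _ _).symm⟩
  hom_ext A _ _ h h' e := by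
    rw [← F.map_comp, ← F.map_comp] at e
    exact awayHom_ext (r.hom_ext A _ _ e)

/-- Both `r'.R` and the localization of `r.R` at f represent `Q'`, the latter by the unit criterion,
so they are isomorphic over `r.R`. -/
theorem Rep.isOpenImmersion (r : Rep F Q) (r' : Rep F Q') (f : r.R)
    (hf : ∀ (B : Type u) [CommRing B] [Algebra k B] (φ : r.R →ₐ[k] B),
      Q' B (F.map φ r.pt) ↔ IsUnit (φ f)) (h : r.R →ₐ[k] r'.R) (hh : F.map h r.pt = r'.pt) :
    IsOpenImmersion (Spec.map (CommRingCat.ofHom h.toRingHom)) := by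
  obtain ⟨ψ, hψ⟩ := exists_awayLift f h ((hf _ h).mp (hh ▸ r'.mem))
  obtain ⟨χ, hχ⟩ := r'.exists_hom _ (F.map (awayMap k f) r.pt)
    ((hf _ _).mpr (IsLocalization.Away.algebraMap_isUnit f))
  have h1 : ψ.comp χ = AlgHom.id k _ := r'.hom_ext _ _ _ (by
    rw [F.map_comp, hχ, ← F.map_comp, hψ, hh, F.map_id])
  have h2 : χ.comp ψ = AlgHom.id k _ := awayHom_ext (r.hom_ext _ _ _ (by
    rw [AlgHom.comp_assoc, hψ, F.map_comp, hh, hχ, AlgHom.id_comp]))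
  let e : Localization.Away f ≃ₐ[k] r'.R := AlgEquiv.ofAlgHom ψ χ h1 h2
  let _ : Algebra r.R r'.R := h.toRingHom.toAlgebra
  have : IsLocalization.Away f r'.R := by
    refine IsLocalization.isLocalization_of_algEquiv (Submonoid.powers f)
      (S := Localization.Away f) (AlgEquiv.ofRingEquiv (f := e.toRingEquiv) fun x => ?_)
    exact congrArg (fun q : r.R →ₐ[k] r'.R => q x) hψ
  exact IsOpenImmersion.of_isLocalization (S := r'.R) f

/-- A Zariski sheaf with a covering by representable subfunctors `chart c`, each of which
restricts to a basic open subfunctor on every other one. -/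
structure Atlas (F : AlgFunctor k) (ι : Type u) where
  chart : ι → ∀ (A : Type u) [CommRing A] [Algebra k A], F.obj A → Prop
  stable : ∀ c, F.IsStable (chart c)
  rep : ∀ c, Rep F (chart c)
  basic : ∀ (c c' : ι) (A : Type u) [CommRing A] [Algebra k A] (x : F.obj A), chart c A x →
    ∃ f : A, ∀ (B : Type u) [CommRing B] [Algebra k B] (φ : A →ₐ[k] B),
      chart c' B (F.map φ x) ↔ IsUnit (φ f)
  cover : ∀ (A : Type u) [CommRing A] [Algebra k A] (x : F.obj A) (P : PrimeSpectrum A),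
    ∃ a ∉ P.asIdeal, ∃ c, chart c (Localization.Away a) (F.map (awayMap k a) x)

namespace Atlas

variable {ι : Type u} (𝒜 : Atlas F ι)

/-- The intersection of the charts indexed by `S`. -/
def inter (S : Finset ι) (A : Type u) [CommRing A] [Algebra k A] (x : F.obj A) : Prop :=
  ∀ c ∈ S, 𝒜.chart c A x

/-- A finite intersection of basic open conditions is the basic open condition of the product. -/
theorem exists_basic_inter {c : ι} (S : Finset ι) {A : Type u} [CommRing A] [Algebra k A]
    (x : F.obj A) (hx : 𝒜.chart c A x) :
    ∃ f : A, ∀ (B : Type u) [CommRing B] [Algebra k B] (φ : A →ₐ[k] B),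
      𝒜.inter S B (F.map φ x) ↔ IsUnit (φ f) := by
  choose f hf using fun c' => 𝒜.basic c c' A x hx
  refine ⟨∏ c' ∈ S, f c', fun B _ _ φ => ?_⟩
  rw [map_prod, IsUnit.prod_iff]
  exact forall₂_congr fun c' _ => hf c' B φ

theorem nonempty_rep_inter {S : Finset ι} (hS : S.Nonempty) : Nonempty (Rep F (𝒜.inter S)) := by
  obtain ⟨c, hc⟩ := hS
  obtain ⟨f, hf⟩ := 𝒜.exists_basic_inter S (𝒜.rep c).pt (𝒜.rep c).mem
  exact ⟨(𝒜.rep c).localization f (fun A _ _ x hx => hx c hc) hf⟩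

/-- Nonempty finite sets of charts, ordered by reverse inclusion. -/
abbrev Index (ι : Type u) := {S : Finset ι // S.Nonempty}ᵒᵈ

/-- The set of charts underlying an index. -/
def Index.set (S : Index ι) : Finset ι := (OrderDual.ofDual S).1

theorem Index.set_nonempty (S : Index ι) : S.set.Nonempty := (OrderDual.ofDual S).2

theorem Index.set_subset {S T : Index ι} (h : S ≤ T) : T.set ⊆ S.set := h

/-- The representing algebra of an intersection of charts. -/
def repInter (S : Index ι) : Rep F (𝒜.inter S.set) :=
  (𝒜.nonempty_rep_inter S.set_nonempty).some

theorem exists_res {S T : Index ι} (h : S ≤ T) :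
    ∃ φ : (𝒜.repInter T).R →ₐ[k] (𝒜.repInter S).R,
      F.map φ (𝒜.repInter T).pt = (𝒜.repInter S).pt :=
  (𝒜.repInter T).exists_hom _ _ fun c hc => (𝒜.repInter S).mem c (Index.set_subset h hc)

/-- The restriction map between the algebras of intersections of charts. -/
def res {S T : Index ι} (h : S ≤ T) : (𝒜.repInter T).R →ₐ[k] (𝒜.repInter S).R :=
  (𝒜.exists_res h).choose

theorem map_res {S T : Index ι} (h : S ≤ T) :
    F.map (𝒜.res h) (𝒜.repInter T).pt = (𝒜.repInter S).pt := (𝒜.exists_res h).choose_spec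

theorem res_eq {S T : Index ι} (h : S ≤ T) (φ : (𝒜.repInter T).R →ₐ[k] (𝒜.repInter S).R)
    (hφ : F.map φ (𝒜.repInter T).pt = (𝒜.repInter S).pt) : 𝒜.res h = φ :=
  (𝒜.repInter T).hom_ext _ _ _ ((𝒜.map_res h).trans hφ.symm)

/-- The morphism of spectra induced by a restriction map. -/
def specRes {S T : Index ι} (h : S ≤ T) :
    Spec (CommRingCat.of (𝒜.repInter S).R) ⟶ Spec (CommRingCat.of (𝒜.repInter T).R) :=
  Spec.map (CommRingCat.ofHom (𝒜.res h).toRingHom)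

instance isOpenImmersion_specRes {S T : Index ι} (h : S ≤ T) :
    IsOpenImmersion (𝒜.specRes h) := by
  obtain ⟨c, hc⟩ := T.set_nonempty
  obtain ⟨f, hf⟩ := 𝒜.exists_basic_inter S.set (𝒜.repInter T).pt ((𝒜.repInter T).mem c hc)
  exact Rep.isOpenImmersion _ _ f hf _ (𝒜.map_res h)

/-- The gluing diagram of an atlas. -/
def diagram : Index ι ⥤ Scheme.{u} where
  obj S := Spec (CommRingCat.of (𝒜.repInter S).R)
  map f := 𝒜.specRes (leOfHom f)
  map_id S := by
    rw [specRes, 𝒜.res_eq _ (AlgHom.id k _) (F.map_id _)]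
    exact Spec.map_id _
  map_comp {S T U} f g := by
    rw [specRes, specRes, specRes, ← specMap_algHom_comp, 𝒜.res_eq]
    rw [F.map_comp, map_res, map_res]

instance {S T : Index ι} (f : S ⟶ T) : IsOpenImmersion (𝒜.diagram.map f) :=
  𝒜.isOpenImmersion_specRes (leOfHom f)

open Classical in
/-- The union of two sets of charts. -/
def Index.inter (S T : Index ι) : Index ι :=
  OrderDual.toDual ⟨S.set ∪ T.set, S.set_nonempty.mono Finset.subset_union_left⟩

open Classical in
theorem Index.inter_le_left (S T : Index ι) : S.inter T ≤ S :=
  show S.set ⊆ S.set ∪ T.set from Finset.subset_union_left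

open Classical in
theorem Index.inter_le_right (S T : Index ι) : S.inter T ≤ T :=
  show T.set ⊆ S.set ∪ T.set from Finset.subset_union_right

open Classical in
theorem Index.le_inter {S T U : Index ι} (h : U ≤ S) (h' : U ≤ T) : U ≤ S.inter T :=
  show S.set ∪ T.set ⊆ U.set from Finset.union_subset h h'

-- Intersecting charts means uniting index sets: a point lying in all charts of S and in all charts
-- of T lies in those of S ∪ T.
open Classical in
theorem exists_hom_inter {S T : Index ι} {B : Type u} [CommRing B] [Algebra k B]
    (h : (𝒜.repInter S).R →ₐ[k] B) (h' : (𝒜.repInter T).R →ₐ[k] B)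
    (e : F.map h (𝒜.repInter S).pt = F.map h' (𝒜.repInter T).pt) :
    ∃ g : (𝒜.repInter (S.inter T)).R →ₐ[k] B,
      g.comp (𝒜.res (S.inter_le_left T)) = h ∧ g.comp (𝒜.res (S.inter_le_right T)) = h' := by
  obtain ⟨g, hg⟩ := (𝒜.repInter (S.inter T)).exists_hom B (F.map h (𝒜.repInter S).pt) (by
    intro c hc
    rcases Finset.mem_union.mp hc with hc | hc
    · exact 𝒜.stable c _ _ _ _ ((𝒜.repInter S).mem c hc)
    · rw [e]
      exact 𝒜.stable c _ _ _ _ ((𝒜.repInter T).mem c hc))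
  exact ⟨g, (𝒜.repInter S).hom_ext _ _ _ (by rw [F.map_comp, map_res, hg]),
    (𝒜.repInter T).hom_ext _ _ _ (by rw [F.map_comp, map_res, hg, e])⟩

/-- This is the local directedness that lets the colimit of open immersions exist as a gluing. Two
points with the same image come from one field-valued point of the pullback; as a point of F it lies
in both intersections of charts, hence in the smaller one. -/
theorem exists_point_inter {S T U : Index ι} (hS : S ≤ U) (hT : T ≤ U)
    (x : Spec (CommRingCat.of (𝒜.repInter S).R)) (y : Spec (CommRingCat.of (𝒜.repInter T).R))
    (hxy : 𝒜.specRes hS x = 𝒜.specRes hT y) :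
    ∃ z : Spec (CommRingCat.of (𝒜.repInter (S.inter T)).R),
      𝒜.specRes (S.inter_le_left T) z = x ∧ 𝒜.specRes (S.inter_le_right T) z = y := by
  obtain ⟨w, hw, hw'⟩ := Scheme.Pullback.exists_preimage_pullback x y hxy
  let P := pullback (𝒜.specRes hS) (𝒜.specRes hT)
  obtain ⟨K, p, t, ht⟩ : ∃ (K : CommRingCat.{u}) (p : Spec K ⟶ P) (t : Spec K), p t = w :=
    ⟨P.residueField w, P.fromSpecResidueField w, IsLocalRing.closedPoint _,
      Scheme.fromSpecResidueField_apply w _⟩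
  obtain ⟨_, hC⟩ : ∃ _ : Algebra k K, Spec.map (CommRingCat.ofHom (algebraMap k K)) =
      (p ≫ pullback.fst _ _) ≫ Spec.map (CommRingCat.ofHom (algebraMap k (𝒜.repInter S).R)) :=
    ⟨(Spec.preimage ((p ≫ pullback.fst _ _) ≫ Spec.map (CommRingCat.ofHom
      (algebraMap k (𝒜.repInter S).R)))).hom.toAlgebra, Spec.map_preimage _⟩
  obtain ⟨h, hh⟩ := exists_algHom_of_w (B := K) (p ≫ pullback.fst _ _) hC.symm
  have cond : (p ≫ pullback.fst _ _) ≫ 𝒜.specRes hS = (p ≫ pullback.snd _ _) ≫ 𝒜.specRes hT := by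
    rw [Category.assoc, Category.assoc, pullback.condition]
  obtain ⟨h', hh'⟩ := exists_algHom_of_w (B := K) (p ≫ pullback.snd _ _) (by
    rw [hC, ← specMap_algHom_w (𝒜.res hS), ← specMap_algHom_w (𝒜.res hT), ← Category.assoc,
      ← Category.assoc]
    exact congrArg (· ≫ _) cond.symm)
  have hc : h.comp (𝒜.res hS) = h'.comp (𝒜.res hT) := specMap_algHom_injective (by
    rw [specMap_algHom_comp, specMap_algHom_comp, ← hh, ← hh']
    exact cond)
  obtain ⟨g, hg, hg'⟩ := 𝒜.exists_hom_inter h h' (by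
    rw [← 𝒜.map_res hS, ← 𝒜.map_res hT, ← F.map_comp, hc, F.map_comp])
  refine ⟨Spec.map (CommRingCat.ofHom g.toRingHom) t, ?_, ?_⟩
  · rw [specRes, ← Scheme.Hom.comp_apply, ← specMap_algHom_comp, hg, ← hh, Scheme.Hom.comp_apply,
      ht, hw]
  · rw [specRes, ← Scheme.Hom.comp_apply, ← specMap_algHom_comp, hg', ← hh', Scheme.Hom.comp_apply,
      ht, hw']

instance : (𝒜.diagram ⋙ Scheme.forget).IsLocallyDirected where
  cond {S T U} fS fT x y hxy := by
    obtain ⟨z, hz, hz'⟩ := 𝒜.exists_point_inter (leOfHom fS) (leOfHom fT) x y hxy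
    exact ⟨S.inter T, homOfLE (S.inter_le_left T), homOfLE (S.inter_le_right T), z, hz, hz'⟩

/-- The scheme glued from an atlas. -/
def glued : Over (Spec (CommRingCat.of k)) :=
  Over.mk (colimit.desc 𝒜.diagram ⟨Spec (CommRingCat.of k),
    { app := fun S => Spec.map (CommRingCat.ofHom (algebraMap k (𝒜.repInter S).R))
      naturality := fun _ _ f =>
        (specMap_algHom_w (𝒜.res (leOfHom f))).trans (Category.comp_id _).symm }⟩)

/-- The inclusion of an intersection of charts, on schemes. -/
def incl (S : Index ι) : Spec (CommRingCat.of (𝒜.repInter S).R) ⟶ 𝒜.glued.left :=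
  colimit.ι 𝒜.diagram S

instance (S : Index ι) : IsOpenImmersion (𝒜.incl S) :=
  inferInstanceAs (IsOpenImmersion (colimit.ι 𝒜.diagram S))

theorem incl_w (S : Index ι) : 𝒜.incl S ≫ 𝒜.glued.hom =
    Spec.map (CommRingCat.ofHom (algebraMap k (𝒜.repInter S).R)) :=
  colimit.ι_desc _ S

theorem specRes_incl {S T : Index ι} (h : S ≤ T) : 𝒜.specRes h ≫ 𝒜.incl T = 𝒜.incl S :=
  colimit.w 𝒜.diagram (homOfLE h)

theorem incl_jointly_surjective (x : 𝒜.glued.left) :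
    ∃ (S : Index ι) (y : Spec (CommRingCat.of (𝒜.repInter S).R)), 𝒜.incl S y = x :=
  Scheme.IsLocallyDirected.ι_jointly_surjective 𝒜.diagram x

theorem exists_of_incl_eq {S T : Index ι} {x : Spec (CommRingCat.of (𝒜.repInter S).R)}
    {y : Spec (CommRingCat.of (𝒜.repInter T).R)} (h : 𝒜.incl S x = 𝒜.incl T y) :
    𝒜.incl S x ∈ Set.range (𝒜.incl (S.inter T)) := by
  obtain ⟨U, f, g, z, hz, -⟩ := (Scheme.IsLocallyDirected.ι_eq_ι_iff 𝒜.diagram).mp h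
  change Spec (CommRingCat.of (𝒜.repInter U).R) at z
  have hz' : 𝒜.specRes (leOfHom f) z = x := hz
  refine ⟨𝒜.specRes (Index.le_inter (leOfHom f) (leOfHom g)) z, ?_⟩
  rw [← hz', ← Scheme.Hom.comp_apply, ← Scheme.Hom.comp_apply, specRes_incl, specRes_incl]

/-- The gluing relation on affine points is equality in F, which is what identifies the glued scheme
with F. From left to right, the common morphism lands in the open piece of S ∪ T and therefore
factors through it. -/
theorem specMap_incl_eq_iff {S T : Index ι} {B : Type u} [CommRing B] [Algebra k B]
    (h : (𝒜.repInter S).R →ₐ[k] B) (h' : (𝒜.repInter T).R →ₐ[k] B) :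
    Spec.map (CommRingCat.ofHom h.toRingHom) ≫ 𝒜.incl S =
        Spec.map (CommRingCat.ofHom h'.toRingHom) ≫ 𝒜.incl T ↔
      F.map h (𝒜.repInter S).pt = F.map h' (𝒜.repInter T).pt := by
  constructor
  · intro e
    have hr : Set.range (Spec.map (CommRingCat.ofHom h.toRingHom) ≫ 𝒜.incl S) ⊆
        Set.range (𝒜.incl (S.inter T)) := by
      rintro _ ⟨b, rfl⟩
      rw [Scheme.Hom.comp_apply]
      refine 𝒜.exists_of_incl_eq (T := T)
        (y := Spec.map (CommRingCat.ofHom h'.toRingHom) b) ?_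
      rw [← Scheme.Hom.comp_apply, ← Scheme.Hom.comp_apply, e]
    let l := IsOpenImmersion.lift (𝒜.incl (S.inter T)) _ hr
    have hl : l ≫ 𝒜.incl (S.inter T) = Spec.map (CommRingCat.ofHom h.toRingHom) ≫ 𝒜.incl S :=
      IsOpenImmersion.lift_fac _ _ _
    obtain ⟨g, hg⟩ := exists_algHom_of_w (k := k) l (by
      rw [← 𝒜.incl_w, ← Category.assoc, hl, Category.assoc, 𝒜.incl_w, specMap_algHom_w])
    rw [hg] at hl
    have h1 : g.comp (𝒜.res (S.inter_le_left T)) = h := specMap_algHom_injective (by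
      rw [specMap_algHom_comp, ← cancel_mono (𝒜.incl S), Category.assoc, ← hl]
      exact congrArg _ (𝒜.specRes_incl _))
    have h2 : g.comp (𝒜.res (S.inter_le_right T)) = h' := specMap_algHom_injective (by
      rw [specMap_algHom_comp, ← cancel_mono (𝒜.incl T), Category.assoc, ← e, ← hl]
      exact congrArg _ (𝒜.specRes_incl _))
    rw [← h1, ← h2, F.map_comp, F.map_comp, map_res, map_res]
  · intro e
    obtain ⟨g, rfl, rfl⟩ := 𝒜.exists_hom_inter h h' e
    rw [specMap_algHom_comp, specMap_algHom_comp, Category.assoc, Category.assoc]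
    exact congrArg _ ((𝒜.specRes_incl (S.inter_le_left T)).trans (𝒜.specRes_incl _).symm)

/-- The index of a single chart. -/
def Index.single (c : ι) : Index ι := OrderDual.toDual ⟨{c}, Finset.singleton_nonempty c⟩

theorem inter_single {c : ι} {A : Type u} [CommRing A] [Algebra k A] {x : F.obj A} :
    𝒜.inter (Index.single c).set A x ↔ 𝒜.chart c A x := by
  change (∀ c' ∈ ({c} : Finset ι), 𝒜.chart c' A x) ↔ _
  simp

/-- The inclusion of a chart as a morphism of `k`-schemes. -/
def single (c : ι) : specOver k (𝒜.repInter (Index.single c)).R ⟶ 𝒜.glued :=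
  Over.homMk (𝒜.incl (Index.single c)) (𝒜.incl_w _)

theorem ptHom_single (c : ι) : ptHom (𝒜.single c) = 𝒜.incl (Index.single c) := rfl

theorem single_jointly_surjective (x : 𝒜.glued.left) :
    ∃ c, x ∈ Set.range (𝒜.incl (Index.single c)) := by
  obtain ⟨S, y, rfl⟩ := 𝒜.incl_jointly_surjective x
  obtain ⟨c, hc⟩ := S.set_nonempty
  have h : S ≤ Index.single c := show ({c} : Finset ι) ⊆ S.set from
    Finset.singleton_subset_iff.mpr hc
  refine ⟨c, 𝒜.specRes h y, ?_⟩
  rw [← Scheme.Hom.comp_apply, specRes_incl]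

theorem isCovering_points : (points 𝒜.glued).IsCovering
    (fun c => (𝒜.repInter (Index.single c)).R) 𝒜.single := by
  intro A _ _ x P
  change specOver k A ⟶ 𝒜.glued at x
  obtain ⟨c, hc⟩ := 𝒜.single_jointly_surjective (ptHom x P)
  let U := ptHom x ⁻¹ᵁ (𝒜.incl (Index.single c)).opensRange
  have hPU : P ∈ U := hc
  obtain ⟨_, ⟨a, rfl⟩, haP, haU⟩ :=
    TopologicalSpace.Opens.isBasis_iff_nbhd.mp (PrimeSpectrum.isBasis_basic_opens (R := A)) hPU
  have hr : Set.range (awaySpec a ≫ ptHom x) ⊆ Set.range (𝒜.incl (Index.single c)) := by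
    rintro _ ⟨b, rfl⟩
    rw [Scheme.Hom.comp_apply]
    have hb : awaySpec a b ∈ PrimeSpectrum.basicOpen a := by
      have := PrimeSpectrum.localization_away_comap_range (Localization.Away a) a
      have h2 : awaySpec a b ∈ Set.range (PrimeSpectrum.comap
        (algebraMap A (Localization.Away a))) := ⟨b, rfl⟩
      rw [this] at h2
      exact h2
    exact haU hb
  let l := IsOpenImmersion.lift (𝒜.incl (Index.single c)) _ hr
  have hl : l ≫ 𝒜.incl (Index.single c) = awaySpec a ≫ ptHom x := IsOpenImmersion.lift_fac _ _ _
  obtain ⟨g, hg⟩ := exists_algHom_of_w (k := k) l (by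
    rw [← 𝒜.incl_w, ← Category.assoc, hl, Category.assoc, ptHom_w, awaySpec_w])
  refine ⟨a, haP, c, g, ptHom_injective ?_⟩
  rw [hg] at hl
  exact hl.symm

theorem isCovering : F.IsCovering (fun c => (𝒜.repInter (Index.single c)).R)
    (fun c => (𝒜.repInter (Index.single c)).pt) := by
  intro A _ _ x P
  obtain ⟨a, ha, c, hc⟩ := 𝒜.cover A x P
  obtain ⟨h, hh⟩ := (𝒜.repInter (Index.single c)).exists_hom _ _ (𝒜.inter_single.mpr hc)
  exact ⟨a, ha, c, h, hh.symm⟩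

/-- A Zariski sheaf with an atlas is the functor of affine points of the glued scheme. -/
theorem exists_represents (hF : F.IsSheaf) :
    ∃ τ : ∀ (A : Type u) [CommRing A] [Algebra k A], (specOver k A ⟶ 𝒜.glued) → F.obj A,
      (∀ (A : Type u) [CommRing A] [Algebra k A], Function.Bijective (τ A)) ∧
      (∀ (A B : Type u) [CommRing A] [Algebra k A] [CommRing B] [Algebra k B] (φ : A →ₐ[k] B)
        (x : specOver k A ⟶ 𝒜.glued), τ B (specOverMap φ ≫ x) = F.map φ (τ A x)) ∧
      ∀ c, τ _ (𝒜.single c) = (𝒜.repInter (Index.single c)).pt :=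
  exists_bijective_transformation 𝒜.isCovering_points 𝒜.isCovering (points_isSheaf _) hF
    fun c c' B _ _ h h' => by
      rw [← specMap_incl_eq_iff]
      exact ⟨fun e => congrArg ptHom e, fun e => ptHom_injective e⟩

end Atlas

end AlgFunctor

end

end CurveSing

/-! ### Finiteness and affineness for glued schemes -/

namespace CurveSing

noncomputable section

namespace AlgFunctor

variable {k : Type u} [Field k]

/-- Two subfunctors containing each other's universal points have isomorphic algebras; surjectivity
is enough to transport finite type. -/
theorem Rep.exists_surjective {F : AlgFunctor k}
    {Q Q' : ∀ (A : Type u) [CommRing A] [Algebra k A], F.obj A → Prop} (r : Rep F Q)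
    (r' : Rep F Q') (h : Q r'.R r'.pt) (h' : Q' r.R r.pt) :
    ∃ φ : r.R →ₐ[k] r'.R, Function.Surjective φ := by
  obtain ⟨φ, hφ⟩ := r.exists_hom _ r'.pt h
  obtain ⟨ψ, hψ⟩ := r'.exists_hom _ r.pt h'
  have : φ.comp ψ = AlgHom.id k _ := r'.hom_ext _ _ _ (by
    rw [F.map_comp, hψ, hφ, F.map_id])
  exact ⟨φ, fun x => ⟨ψ x, congrArg (fun q : r'.R →ₐ[k] r'.R => q x) this⟩⟩

theorem exists_field_point (X : Scheme.{u}) (x : X) :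
    ∃ (K : Type u) (_ : Field K) (f : Spec (CommRingCat.of K) ⟶ X), Set.range f = {x} :=
  ⟨X.residueField x, inferInstance, X.fromSpecResidueField x, Scheme.range_fromSpecResidueField x⟩

namespace Atlas

variable {F : AlgFunctor k} {ι : Type u} (𝒜 : Atlas F ι)

/-- The open cover of the glued scheme by the charts. -/
def chartCover : 𝒜.glued.left.OpenCover where
  I₀ := ι
  X c := Spec (CommRingCat.of (𝒜.repInter (Index.single c)).R)
  f c := 𝒜.incl (Index.single c)
  mem₀ := by
    rw [Scheme.presieve₀_mem_precoverage_iff]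
    exact ⟨fun x => 𝒜.single_jointly_surjective x, fun c => inferInstanceAs
      (IsOpenImmersion (𝒜.incl (Index.single c)))⟩

theorem finiteType_repInter_single (c : ι) [Algebra.FiniteType k (𝒜.rep c).R] :
    Algebra.FiniteType k (𝒜.repInter (Index.single c)).R := by
  obtain ⟨φ, hφ⟩ := (𝒜.rep c).exists_surjective (𝒜.repInter (Index.single c))
    (𝒜.inter_single.mp (𝒜.repInter (Index.single c)).mem) (𝒜.inter_single.mpr (𝒜.rep c).mem)
  exact Algebra.FiniteType.of_surjective φ hφ

theorem locallyOfFiniteType_glued (h : ∀ c, Algebra.FiniteType k (𝒜.rep c).R) :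
    LocallyOfFiniteType 𝒜.glued.hom := by
  have h0 : HasRingHomProperty (@LocallyOfFiniteType : MorphismProperty Scheme.{u})
    RingHom.FiniteType := inferInstance
  have h1 := @HasRingHomProperty.instIsZariskiLocalAtSource _ _ h0
  refine (IsZariskiLocalAtSource.iff_of_openCover 𝒜.chartCover).mpr ?_
  intro c
  change LocallyOfFiniteType (𝒜.incl (Index.single c) ≫ 𝒜.glued.hom)
  rw [incl_w]
  refine (@HasRingHomProperty.Spec_iff _ _ h0 _ _ _).mpr ?_
  have := h c
  have := 𝒜.finiteType_repInter_single c
  exact (RingHom.finiteType_algebraMap (A := k)).mpr this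

theorem quasiCompact_glued [Finite ι] : QuasiCompact 𝒜.glued.hom := by
  have : Finite 𝒜.chartCover.I₀ := ‹Finite ι›
  have : ∀ i, CompactSpace (𝒜.chartCover.X i) := fun i =>
    inferInstanceAs (CompactSpace (Spec (CommRingCat.of (𝒜.repInter (Index.single i)).R)))
  have := 𝒜.chartCover.compactSpace
  exact quasiCompact_of_compactSpace _

variable {τ : ∀ (A : Type u) [CommRing A] [Algebra k A], (specOver k A ⟶ 𝒜.glued) → F.obj A}

/-- Turns membership in an abstract chart into a condition on the image of the morphism, so that
charts of different schemes can be compared point by point. -/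
theorem chart_iff_range (hτ : ∀ (A : Type u) [CommRing A] [Algebra k A], Function.Injective (τ A))
    (nat : ∀ (A B : Type u) [CommRing A] [Algebra k A] [CommRing B] [Algebra k B] (φ : A →ₐ[k] B)
        (x : specOver k A ⟶ 𝒜.glued), τ B (specOverMap φ ≫ x) = F.map φ (τ A x))
    (hpt : ∀ c, τ _ (𝒜.single c) = (𝒜.repInter (Index.single c)).pt) (c : ι)
    {A : Type u} [CommRing A] [Algebra k A] (x : specOver k A ⟶ 𝒜.glued) :
    𝒜.chart c A (τ A x) ↔ Set.range (ptHom x) ⊆ Set.range (𝒜.incl (Index.single c)) := by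
  constructor
  · intro h
    obtain ⟨g, hg⟩ := (𝒜.repInter (Index.single c)).exists_hom _ _ (𝒜.inter_single.mpr h)
    have hx : x = specOverMap g ≫ 𝒜.single c := hτ A (by rw [nat, hpt, hg])
    rw [hx, ptHom_specOverMap_comp, ptHom_single]
    rintro _ ⟨y, rfl⟩
    exact ⟨_, (Scheme.Hom.comp_apply _ _ _).symm⟩
  · intro h
    let l := IsOpenImmersion.lift (𝒜.incl (Index.single c)) _ h
    have hl : l ≫ 𝒜.incl (Index.single c) = ptHom x := IsOpenImmersion.lift_fac _ _ _
    obtain ⟨g, hg⟩ := exists_algHom_of_w (k := k) l (by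
      rw [← 𝒜.incl_w, ← Category.assoc, hl, ptHom_w])
    have hx : x = specOverMap g ≫ 𝒜.single c := ptHom_injective (by
      rw [ptHom_specOverMap_comp, ptHom_single, ← hg, hl])
    rw [hx, nat, hpt]
    exact 𝒜.stable c _ _ _ _ (𝒜.inter_single.mp (𝒜.repInter (Index.single c)).mem)

/-- A morphism of glued schemes is affine if, on points with values in fields, the charts of the
source are the preimages of the charts of the target. -/
theorem isAffineHom_of_chart {G : AlgFunctor k} (ℬ : Atlas G ι)
    {σ : ∀ (A : Type u) [CommRing A] [Algebra k A], (specOver k A ⟶ ℬ.glued) → G.obj A}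
    (hτ : ∀ (A : Type u) [CommRing A] [Algebra k A], Function.Injective (τ A))
    (nat : ∀ (A B : Type u) [CommRing A] [Algebra k A] [CommRing B] [Algebra k B] (φ : A →ₐ[k] B)
        (x : specOver k A ⟶ 𝒜.glued), τ B (specOverMap φ ≫ x) = F.map φ (τ A x))
    (hpt : ∀ c, τ _ (𝒜.single c) = (𝒜.repInter (Index.single c)).pt)
    (hσ : ∀ (A : Type u) [CommRing A] [Algebra k A], Function.Injective (σ A))
    (nat' : ∀ (A B : Type u) [CommRing A] [Algebra k A] [CommRing B] [Algebra k B] (φ : A →ₐ[k] B)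
        (x : specOver k A ⟶ ℬ.glued), σ B (specOverMap φ ≫ x) = G.map φ (σ A x))
    (hpt' : ∀ c, σ _ (ℬ.single c) = (ℬ.repInter (Index.single c)).pt)
    (a : 𝒜.glued ⟶ ℬ.glued)
    (H : ∀ (c : ι) (K : Type u) [Field K] [Algebra k K] (x : specOver k K ⟶ 𝒜.glued),
      𝒜.chart c K (τ K x) ↔ ℬ.chart c K (σ K (x ≫ a))) : IsAffineHom a.left := by
  refine isAffineHom_of_forall_exists_isAffineOpen _ fun y => ?_
  obtain ⟨c, hc⟩ := ℬ.single_jointly_surjective y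
  refine ⟨(ℬ.incl (Index.single c)).opensRange, hc, isAffineOpen_opensRange _, ?_⟩
  -- Open subsets are compared pointwise, every point being the image of a field-valued one.
  have : a.left ⁻¹ᵁ (ℬ.incl (Index.single c)).opensRange =
      (𝒜.incl (Index.single c)).opensRange := by
    ext x
    obtain ⟨K, _, f, hr⟩ := exists_field_point 𝒜.glued.left x
    obtain ⟨_, p, rfl⟩ := exists_ptHom_eq (k := k) (T := 𝒜.glued) f
    have h1 := 𝒜.chart_iff_range hτ nat hpt c p
    have h2 := ℬ.chart_iff_range hσ nat' hpt' c (p ≫ a)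
    have h3 := H c K p
    have hr' : Set.range (ptHom p ≫ a.left) = {a.left x} := by
      rw [Scheme.Hom.comp_base, TopCat.coe_comp, Set.range_comp, hr, Set.image_singleton]
    rw [hr, Set.singleton_subset_iff] at h1
    rw [ptHom_comp, hr', Set.singleton_subset_iff] at h2
    exact h2.symm.trans (h3.symm.trans h1)
  rw [this]
  exact isAffineOpen_opensRange _

end Atlas

/-! ### Limits of sequences -/

section Limit

variable {X : ℕ → Over (Spec (CommRingCat.of k))} (a : ∀ m, X (m + 1) ⟶ X m)
  {Y : Over (Spec (CommRingCat.of k))} (π : ∀ m, Y ⟶ X m) (hπ : ∀ m, π (m + 1) ≫ a m = π m)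

/-- The cone over a sequence given by compatible maps. -/
def seqCone : Cone (Functor.ofOpSequence a) where
  pt := Y
  π := NatTrans.ofOpSequence (F := (Functor.const ℕᵒᵖ).obj Y) (G := Functor.ofOpSequence a) π
    (fun m => by
      rw [Functor.ofOpSequence_map_homOfLE_succ]
      exact (Category.id_comp _).trans (hπ m).symm)

/-- A cone over a sequence of `k`-schemes is a limit cone if it is one on affine points. -/
theorem nonempty_isLimit_seqCone
    (inj : ∀ (A : Type u) [CommRing A] [Algebra k A] (x y : specOver k A ⟶ Y),
      (∀ m, x ≫ π m = y ≫ π m) → x = y)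
    (surj : ∀ (A : Type u) [CommRing A] [Algebra k A] (x : ∀ m, specOver k A ⟶ X m),
      (∀ m, x (m + 1) ≫ a m = x m) → ∃ y : specOver k A ⟶ Y, ∀ m, y ≫ π m = x m) :
    Nonempty (IsLimit (seqCone a π hπ)) := by
  have lift : ∀ (W : Over (Spec (CommRingCat.of k))) (p : ∀ m, W ⟶ X m),
      (∀ m, p (m + 1) ≫ a m = p m) → ∃ l : W ⟶ Y, ∀ m, l ≫ π m = p m := by
    intro W p hp
    choose θ hθ using fun (A : Type u) (_ : CommRing A) (_ : Algebra k A)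
      (x : specOver k A ⟶ W) => surj A (fun m => x ≫ p m)
        (fun m => (Category.assoc _ _ _).trans (congrArg (x ≫ ·) (hp m)))
    obtain ⟨l, hl⟩ := exists_hom_of_natural (fun A _ _ x => θ A _ _ x) (by
      intro A B _ _ _ _ φ x
      refine inj B _ _ fun m => ?_
      rw [hθ, Category.assoc, Category.assoc, hθ])
    refine ⟨l, fun m => over_hom_ext fun A _ _ x => ?_⟩
    rw [← Category.assoc, hl, hθ]
  have uniq : ∀ (W : Over (Spec (CommRingCat.of k))) (t l : W ⟶ Y),
      (∀ m, t ≫ π m = l ≫ π m) → t = l := fun W t l h =>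
    over_hom_ext fun A _ _ x => inj A _ _ fun m => by
      rw [Category.assoc, Category.assoc, h]
  have hs : ∀ (s : Cone (Functor.ofOpSequence a)) (m : ℕ),
      s.π.app (op (m + 1)) ≫ a m = s.π.app (op m) := fun s m => by
    have := s.w (homOfLE (Nat.le_add_right m 1)).op
    rwa [Functor.ofOpSequence_map_homOfLE_succ] at this
  choose l hl using fun s : Cone (Functor.ofOpSequence a) =>
    lift s.pt (fun m => s.π.app (op m)) (hs s)
  exact ⟨{
    lift := l
    fac := fun s m => hl s m.unop
    uniq := fun s t ht => uniq _ _ _ fun m => (ht (op m)).trans (hl s m).symm }⟩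

end Limit

/-! ### Solutions of polynomial equations -/

/-- The functor of solutions of a system of polynomial equations is represented by the quotient
of the polynomial ring. -/
theorem exists_hom_quotient_iff {σ : Type u} (E : Set (MvPolynomial σ k)) {A : Type u} [CommRing A]
    [Algebra k A] (y : σ → A) (hy : ∀ f ∈ E, MvPolynomial.aeval y f = 0) :
    ∃ h : (MvPolynomial σ k ⧸ Ideal.span E) →ₐ[k] A,
      ∀ i, h (Ideal.Quotient.mk _ (MvPolynomial.X i)) = y i := by
  refine ⟨Ideal.Quotient.liftₐ _ (MvPolynomial.aeval y) ?_, fun i => ?_⟩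
  · have : Ideal.span E ≤ RingHom.ker (MvPolynomial.aeval (R := k) y) := Ideal.span_le.mpr hy
    exact fun f hf => this hf
  · exact MvPolynomial.aeval_X y i

theorem quotient_hom_ext {σ : Type u} {E : Set (MvPolynomial σ k)} {A : Type u} [CommRing A]
    [Algebra k A] {h h' : (MvPolynomial σ k ⧸ Ideal.span E) →ₐ[k] A}
    (e : ∀ i, h (Ideal.Quotient.mk _ (MvPolynomial.X i)) =
      h' (Ideal.Quotient.mk _ (MvPolynomial.X i))) : h = h' := by
  apply Ideal.Quotient.algHom_ext
  exact MvPolynomial.algHom_ext e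

/-- The colimit of a sequence of `k`-algebras. -/
theorem exists_seqColimit (R : ℕ → Type u) [∀ m, CommRing (R m)] [∀ m, Algebra k (R m)]
    (f : ∀ m, R m →ₐ[k] R (m + 1)) :
    ∃ (C : Type u) (_ : CommRing C) (_ : Algebra k C) (i : ∀ m, R m →ₐ[k] C),
      (∀ m, (i (m + 1)).comp (f m) = i m) ∧
      (∀ (A : Type u) [CommRing A] [Algebra k A] (g : ∀ m, R m →ₐ[k] A),
        (∀ m, (g (m + 1)).comp (f m) = g m) → ∃ h : C →ₐ[k] A, ∀ m, h.comp (i m) = g m) ∧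
      ∀ (A : Type u) [CommRing A] [Algebra k A] (h h' : C →ₐ[k] A),
        (∀ m, h.comp (i m) = h'.comp (i m)) → h = h' := by
  let σ := Σ m, R m
  -- One generator for each element of each `R m`. The relations impose addition, multiplication and
  -- scalars, and identify every element with its image one stage later.
  let E : Set (MvPolynomial σ k) :=
    {p | (∃ m r s, p = .X ⟨m, r + s⟩ - (.X ⟨m, r⟩ + .X ⟨m, s⟩)) ∨
      (∃ m r s, p = .X ⟨m, r * s⟩ - (.X ⟨m, r⟩ * .X ⟨m, s⟩)) ∨
      (∃ m c, p = .X ⟨m, algebraMap k (R m) c⟩ - .C c) ∨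
      (∃ m r, p = .X ⟨m + 1, f m r⟩ - .X ⟨m, r⟩)}
  let q : MvPolynomial σ k →ₐ[k] MvPolynomial σ k ⧸ Ideal.span E := Ideal.Quotient.mkₐ k _
  have hq : ∀ {p p' : MvPolynomial σ k}, p - p' ∈ E → q p = q p' := fun h =>
    Ideal.Quotient.eq.mpr (Ideal.subset_span h)
  have hadd : ∀ m r s, q (.X ⟨m, r + s⟩) = q (.X ⟨m, r⟩) + q (.X ⟨m, s⟩) := fun m r s => by
    rw [← map_add]
    exact hq (Or.inl ⟨m, r, s, rfl⟩)
  have hmul : ∀ m r s, q (.X ⟨m, r * s⟩) = q (.X ⟨m, r⟩) * q (.X ⟨m, s⟩) := fun m r s => by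
    rw [← map_mul]
    exact hq (Or.inr (Or.inl ⟨m, r, s, rfl⟩))
  have halg : ∀ m c, q (.X ⟨m, algebraMap k (R m) c⟩) = algebraMap k _ c := fun m c => by
    rw [hq (Or.inr (Or.inr (Or.inl ⟨m, c, rfl⟩)))]
    exact q.commutes c
  have hf : ∀ m r, q (.X ⟨m + 1, f m r⟩) = q (.X ⟨m, r⟩) := fun m r =>
    hq (Or.inr (Or.inr (Or.inr ⟨m, r, rfl⟩)))
  let i : ∀ m, R m →ₐ[k] MvPolynomial σ k ⧸ Ideal.span E := fun m =>
    { toFun := fun r => q (.X ⟨m, r⟩)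
      map_one' := by
        have := halg m 1
        rwa [map_one, map_one] at this
      map_mul' := hmul m
      map_zero' := by
        have := halg m 0
        rwa [map_zero, map_zero] at this
      map_add' := hadd m
      commutes' := halg m }
  refine ⟨MvPolynomial σ k ⧸ Ideal.span E, inferInstance, inferInstance, i, fun m => ?_,
    fun A _ _ g hg => ?_, fun A _ _ h h' e => ?_⟩
  · ext r
    exact hf m r
  · obtain ⟨h, hh⟩ := exists_hom_quotient_iff E (fun s : σ => g s.1 s.2) (by
      rintro _ (⟨m, r, s, rfl⟩ | ⟨m, r, s, rfl⟩ | ⟨m, c, rfl⟩ | ⟨m, r, rfl⟩)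
      · simp
      · simp
      · simp
      · have := congrArg (fun q : R m →ₐ[k] A => q r) (hg m)
        simp only [AlgHom.comp_apply] at this
        simp [this])
    refine ⟨h, fun m => ?_⟩
    ext r
    exact hh ⟨m, r⟩
  · refine quotient_hom_ext fun s => ?_
    exact congrArg (fun q : R s.1 →ₐ[k] A => q s.2) (e s.1)

end AlgFunctor

end

end CurveSing

namespace CurveSing

noncomputable section

/-! ### Truncated power series -/

section Truncation

variable {N : ℕ} {A B C : Type u} [CommRing A] [CommRing B] [CommRing C]

/-- Every monomial other than 1 is divided by its variable of least index, so `g i` collects the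
part of f whose least variable is X_i. -/
theorem exists_eq_sum_X_mul (f : MvPowerSeries (Fin N) A) (n : ℕ)
    (hf : ∀ μ : Fin N →₀ ℕ, μ.degree < n + 1 → MvPowerSeries.coeff μ f = 0) :
    ∃ g : Fin N → MvPowerSeries (Fin N) A, f = ∑ i, MvPowerSeries.X i * g i ∧
      ∀ i, ∀ μ : Fin N →₀ ℕ, μ.degree < n → MvPowerSeries.coeff μ (g i) = 0 := by
  classical
  let g : Fin N → MvPowerSeries (Fin N) A := fun i ν =>
    if ∀ j < i, ν j = 0 then MvPowerSeries.coeff (ν + Finsupp.single i 1) f else 0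
  have hg : ∀ i ν, MvPowerSeries.coeff ν (g i) =
    if ∀ j < i, ν j = 0 then MvPowerSeries.coeff (ν + Finsupp.single i 1) f else 0 :=
    fun _ _ => rfl
  refine ⟨g, ?_, fun i μ hμ => ?_⟩
  · ext μ
    rw [map_sum]
    have key : ∀ i, MvPowerSeries.coeff μ (MvPowerSeries.X i * g i) =
        if 1 ≤ μ i ∧ ∀ j < i, μ j = 0 then MvPowerSeries.coeff μ f else 0 := by
      intro i
      rw [MvPowerSeries.X, MvPowerSeries.coeff_monomial_mul]
      by_cases h : 1 ≤ μ i
      · have hle : Finsupp.single i 1 ≤ μ := by simpa using h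
        rw [if_pos hle, one_mul, hg, tsub_add_cancel_of_le hle]
        have : (∀ j < i, (μ - Finsupp.single i 1 : Fin N →₀ ℕ) j = 0) ↔ ∀ j < i, μ j = 0 := by
          refine forall₂_congr fun j hj => ?_
          rw [Finsupp.tsub_apply, Finsupp.single_eq_of_ne hj.ne, tsub_zero]
        rw [if_congr this rfl rfl, if_congr (and_iff_right h) rfl rfl]
      · have hle : ¬ Finsupp.single i 1 ≤ μ := by simpa using h
        rw [if_neg hle, if_neg (fun h' => h h'.1)]
    simp_rw [key]
    by_cases hμ : μ = 0
    · rw [hf μ (by simp [hμ])]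
      simp
    · have hex : ∃ i, 1 ≤ μ i := by
        by_contra! h
        exact hμ (Finsupp.ext fun i => by simpa using h i)
      obtain ⟨i, hi, hmin⟩ : ∃ i, 1 ≤ μ i ∧ ∀ j < i, μ j = 0 := by
        let s := Finset.univ.filter fun i => 1 ≤ μ i
        have hs : s.Nonempty := by
          obtain ⟨i, hi⟩ := hex
          exact ⟨i, by simp [s, hi]⟩
        refine ⟨s.min' hs, by simpa [s] using s.min'_mem hs, fun j hj => ?_⟩
        by_contra h
        exact absurd (s.min'_le j (by simp [s]; omega)) (not_le.mpr hj)
      rw [Finset.sum_eq_single i]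
      · rw [if_pos ⟨hi, hmin⟩]
      · intro j _ hji
        refine if_neg fun h => ?_
        rcases lt_or_gt_of_ne hji with hlt | hgt
        · have := hmin j hlt
          omega
        · have := h.2 i hgt
          omega
      · simp
  · rw [hg]
    split_ifs
    · refine hf _ ?_
      rw [map_add, Finsupp.degree_single]
      omega
    · rfl

/-- Reduces all computations in (X)^n to coefficients. The inclusion with content divides a series
of order at least n + 1 by the variables and inducts. -/
theorem mem_varIdeal_pow {n : ℕ} {f : MvPowerSeries (Fin N) A} :
    f ∈ varIdeal N A ^ n ↔
      ∀ μ : Fin N →₀ ℕ, μ.degree < n → MvPowerSeries.coeff μ f = 0 := by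
  classical
  induction n generalizing f with
  | zero => simp
  | succ n ih =>
    constructor
    · intro hf
      rw [pow_succ'] at hf
      refine Submodule.mul_induction_on hf ?_ ?_
      · intro x hx g hg μ hμ
        refine Submodule.span_induction
          (p := fun x _ => ∀ ν : Fin N →₀ ℕ, ν.degree < n + 1 →
            MvPowerSeries.coeff ν (x * g) = 0) ?_ ?_ ?_ ?_ hx μ hμ
        · rintro _ ⟨i, rfl⟩ ν hν
          rw [MvPowerSeries.X, MvPowerSeries.coeff_monomial_mul]
          split_ifs with h
          · rw [ih.mp hg, mul_zero]
            have := congrArg Finsupp.degree (tsub_add_cancel_of_le h)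
            rw [map_add, Finsupp.degree_single] at this
            omega
          · rfl
        · simp
        · intro x y _ _ hx hy ν hν
          rw [add_mul, map_add, hx ν hν, hy ν hν, add_zero]
        · intro a x _ hx ν hν
          rw [smul_eq_mul, mul_assoc, MvPowerSeries.coeff_mul]
          refine Finset.sum_eq_zero fun p hp => ?_
          have hp' : p.1 + p.2 = ν := by simpa using hp
          rw [hx p.2, mul_zero]
          rw [← hp', map_add] at hν
          omega
      · intro x y hx hy μ hμ
        rw [map_add, hx μ hμ, hy μ hμ, add_zero]
    · intro hf
      obtain ⟨g, rfl, hg⟩ := exists_eq_sum_X_mul f n hf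
      rw [pow_succ']
      exact Ideal.sum_mem _ fun i _ => Ideal.mul_mem_mul
        (Ideal.subset_span ⟨i, rfl⟩) (ih.mpr (hg i))

/-- The multi-indices of degree less than `n`. -/
def lowMon (N n : ℕ) : Finset (Fin N →₀ ℕ) :=
  (Finsupp.finite_of_degree_lt n).toFinset

theorem mem_lowMon {n : ℕ} {μ : Fin N →₀ ℕ} : μ ∈ lowMon N n ↔ μ.degree < n := by
  simp [lowMon]

/-- The monomial `X^μ`. -/
abbrev mon (A : Type u) [CommRing A] (μ : Fin N →₀ ℕ) : MvPowerSeries (Fin N) A :=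
  MvPowerSeries.monomial μ 1

theorem mon_mem (μ : Fin N →₀ ℕ) {n : ℕ} (h : n ≤ μ.degree) : mon A μ ∈ varIdeal N A ^ n := by
  classical
  rw [mem_varIdeal_pow]
  intro ν hν
  rw [MvPowerSeries.coeff_monomial, if_neg]
  rintro rfl
  omega

theorem mon_mul (μ ν : Fin N →₀ ℕ) : mon A μ * mon A ν = mon A (μ + ν) := by
  rw [mon, mon, MvPowerSeries.monomial_mul_monomial, one_mul]

theorem map_mon (φ : A →+* B) (μ : Fin N →₀ ℕ) :
    MvPowerSeries.map φ (mon A μ) = mon B μ := by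
  classical
  ext ν
  rw [MvPowerSeries.coeff_map, MvPowerSeries.coeff_monomial, MvPowerSeries.coeff_monomial]
  split_ifs <;> simp

theorem map_smul_series (φ : A →+* B) (c : A) (f : MvPowerSeries (Fin N) A) :
    MvPowerSeries.map φ (c • f) = φ c • MvPowerSeries.map φ f := by
  ext ν
  simp [MvPowerSeries.coeff_map]

theorem sub_trunc_mem (f : MvPowerSeries (Fin N) A) (n : ℕ) :
    f - ∑ μ ∈ lowMon N n, MvPowerSeries.coeff μ f • mon A μ ∈ varIdeal N A ^ n := by
  classical
  rw [mem_varIdeal_pow]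
  intro ν hν
  rw [map_sub, map_sum, Finset.sum_eq_single ν]
  · simp
  · intro μ _ hμ
    rw [map_smul, MvPowerSeries.coeff_monomial, if_neg hμ.symm, smul_zero]
  · intro h
    exact absurd (mem_lowMon.mpr hν) h

/-- To check membership in an `A`-submodule containing `(X)^n`, monomials suffice. -/
theorem mem_of_mon_mem (S : Submodule A (MvPowerSeries (Fin N) A)) (n : ℕ)
    (h₁ : ∀ f ∈ varIdeal N A ^ n, f ∈ S)
    (h₂ : ∀ μ : Fin N →₀ ℕ, μ.degree < n → mon A μ ∈ S) (f : MvPowerSeries (Fin N) A) :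
    f ∈ S := by
  have := S.add_mem (h₁ _ (sub_trunc_mem f n))
    (S.sum_mem fun μ hμ => S.smul_mem (MvPowerSeries.coeff μ f) (h₂ μ (mem_lowMon.mp hμ)))
  simpa using this

theorem linearMap_ext_of_trunc {M : Type*} [AddCommGroup M] [Module A M] (n : ℕ)
    {π π' : MvPowerSeries (Fin N) A →ₗ[A] M}
    (h : ∀ f ∈ varIdeal N A ^ n, π f = 0) (h' : ∀ f ∈ varIdeal N A ^ n, π' f = 0)
    (hm : ∀ μ : Fin N →₀ ℕ, μ.degree < n → π (mon A μ) = π' (mon A μ)) : π = π' := by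
  ext1 f
  refine mem_of_mon_mem (LinearMap.eqLocus π π') n (fun f hf => ?_) (fun μ hμ => hm μ hμ) f
  exact (h f hf).trans (h' f hf).symm

theorem smul_mem_ideal {J : Ideal (MvPowerSeries (Fin N) A)} (c : A)
    {f : MvPowerSeries (Fin N) A} (h : f ∈ J) : c • f ∈ J :=
  Submodule.smul_of_tower_mem J c h

/-- The `A`-linear map on `A[[X]]` which vanishes on `(X)^n` and takes the values `y μ` on the
monomials `X^μ` of degree less than `n`. -/
def ofCoord {β : Type*} (n : ℕ) (y : (Fin N →₀ ℕ) → β → A) :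
    MvPowerSeries (Fin N) A →ₗ[A] (β → A) :=
  ∑ μ ∈ lowMon N n, (MvPowerSeries.coeff (R := A) μ).smulRight (y μ)

theorem ofCoord_apply {β : Type*} (n : ℕ) (y : (Fin N →₀ ℕ) → β → A)
    (f : MvPowerSeries (Fin N) A) (b : β) :
    ofCoord n y f b = ∑ μ ∈ lowMon N n, MvPowerSeries.coeff μ f * y μ b := by
  simp [ofCoord, LinearMap.sum_apply, Finset.sum_apply]

theorem ofCoord_of_mem {β : Type*} {n : ℕ} (y : (Fin N →₀ ℕ) → β → A)
    {f : MvPowerSeries (Fin N) A} (hf : f ∈ varIdeal N A ^ n) : ofCoord n y f = 0 := by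
  ext b
  rw [ofCoord_apply]
  refine Finset.sum_eq_zero fun μ hμ => ?_
  rw [mem_varIdeal_pow.mp hf μ (mem_lowMon.mp hμ), zero_mul]

theorem ofCoord_mon {β : Type*} {n : ℕ} (y : (Fin N →₀ ℕ) → β → A)
    {μ : Fin N →₀ ℕ} (hμ : μ.degree < n) : ofCoord n y (mon A μ) = y μ := by
  classical
  ext b
  rw [ofCoord_apply, Finset.sum_eq_single μ]
  · simp
  · intro ν _ hν
    rw [MvPowerSeries.coeff_monomial, if_neg hν, zero_mul]
  · intro h
    exact absurd (mem_lowMon.mpr hμ) h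

theorem eq_ofCoord {β : Type*} {n : ℕ} {π : MvPowerSeries (Fin N) A →ₗ[A] (β → A)}
    (h : ∀ f ∈ varIdeal N A ^ n, π f = 0) : π = ofCoord n fun μ => π (mon A μ) :=
  linearMap_ext_of_trunc n h (fun _ hf => ofCoord_of_mem _ hf)
    fun μ hμ => (ofCoord_mon (fun μ => π (mon A μ)) hμ).symm

theorem ofCoord_map {β : Type*} (n : ℕ) (φ : A →+* B) (y : (Fin N →₀ ℕ) → β → A)
    (f : MvPowerSeries (Fin N) A) (b : β) :
    ofCoord n (fun μ b => φ (y μ b)) (MvPowerSeries.map φ f) b = φ (ofCoord n y f b) := by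
  rw [ofCoord_apply, ofCoord_apply, map_sum]
  exact Finset.sum_congr rfl fun μ _ => by rw [MvPowerSeries.coeff_map, map_mul]

end Truncation

/-! ### Extension of ideals along maps of coefficients -/

section Extension

variable {N : ℕ} {A B C : Type u} [CommRing A] [CommRing B] [CommRing C]

theorem extendIdeal_varIdeal_pow (φ : A →+* B) (n : ℕ) :
    extendIdeal φ (varIdeal N A ^ n) = varIdeal N B ^ n := by
  rw [extendIdeal, Ideal.map_pow, varIdeal, Ideal.map_span, ← Set.range_comp]
  congr 3
  funext i
  exact map_mon φ _

theorem extendIdeal_sup (φ : A →+* B) (I J : Ideal (MvPowerSeries (Fin N) A)) :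
    extendIdeal φ (I ⊔ J) = extendIdeal φ I ⊔ extendIdeal φ J :=
  Ideal.map_sup _ _ _

theorem extendIdeal_mono (φ : A →+* B) {I J : Ideal (MvPowerSeries (Fin N) A)} (h : I ≤ J) :
    extendIdeal φ I ≤ extendIdeal φ J :=
  Ideal.map_mono h

theorem extendIdeal_id (I : Ideal (MvPowerSeries (Fin N) A)) :
    extendIdeal (RingHom.id A) I = I := by
  have : MvPowerSeries.map (σ := Fin N) (RingHom.id A) = RingHom.id _ := by
    ext f μ
    simp
  rw [extendIdeal, this, Ideal.map_id]

theorem extendIdeal_comp (φ : A →+* B) (ψ : B →+* C) (I : Ideal (MvPowerSeries (Fin N) A)) :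
    extendIdeal ψ (extendIdeal φ I) = extendIdeal (ψ.comp φ) I := by
  have : MvPowerSeries.map (σ := Fin N) (ψ.comp φ) =
      (MvPowerSeries.map ψ).comp (MvPowerSeries.map φ) := by
    ext f μ
    simp [MvPowerSeries.coeff_map]
  rw [extendIdeal, extendIdeal, extendIdeal, Ideal.map_map, this]

theorem varIdeal_pow_le_extendIdeal (φ : A →+* B) {n : ℕ} {J : Ideal (MvPowerSeries (Fin N) A)}
    (h : varIdeal N A ^ n ≤ J) : varIdeal N B ^ n ≤ extendIdeal φ J := by
  rw [← extendIdeal_varIdeal_pow φ n]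
  exact extendIdeal_mono φ h

theorem map_mem_extendIdeal (φ : A →+* B) {J : Ideal (MvPowerSeries (Fin N) A)}
    {f : MvPowerSeries (Fin N) A} (h : f ∈ J) : MvPowerSeries.map φ f ∈ extendIdeal φ J :=
  Ideal.mem_map_of_mem _ h

theorem extendIdeal_sup_pow (φ : A →+* B) (J : Ideal (MvPowerSeries (Fin N) A)) (n : ℕ) :
    extendIdeal φ (J ⊔ varIdeal N A ^ n) = extendIdeal φ J ⊔ varIdeal N B ^ n := by
  rw [extendIdeal_sup, extendIdeal_varIdeal_pow]

/-- A linear map vanishing on the extension of the elements of `J` multiplied by monomials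
vanishes on the extension of `J`. -/
theorem extendIdeal_le_ker {M : Type*} [AddCommGroup M] [Module B M] (φ : A →+* B) (n : ℕ)
    {J : Ideal (MvPowerSeries (Fin N) A)} (π : MvPowerSeries (Fin N) B →ₗ[B] M)
    (h₁ : ∀ f ∈ varIdeal N B ^ n, π f = 0) (h₂ : ∀ f ∈ J, π (MvPowerSeries.map φ f) = 0)
    {g : MvPowerSeries (Fin N) B} (hg : g ∈ extendIdeal φ J) : π g = 0 := by
  -- The claim is strengthened to all multiples of g, because the kernel of a linear map need not be
  -- an ideal.
  suffices h : ∀ h, π (h * g) = 0 by simpa using h 1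
  refine Submodule.span_induction (p := fun g _ => ∀ h, π (h * g) = 0) ?_ ?_ ?_ ?_ hg
  · rintro _ ⟨f, hf, rfl⟩ h
    refine mem_of_mon_mem
      (LinearMap.ker (π ∘ₗ LinearMap.mulRight B (MvPowerSeries.map φ f))) n ?_ ?_ h
    · intro h hh
      exact h₁ _ (Ideal.mul_mem_right _ _ hh)
    · intro μ _
      change π (mon B μ * MvPowerSeries.map φ f) = 0
      rw [← map_mon φ, ← map_mul]
      exact h₂ _ (J.mul_mem_left _ hf)
  · simp
  · intro x y _ _ hx hy h
    rw [mul_add, map_add, hx, hy, add_zero]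
  · intro a x _ hx h
    rw [smul_eq_mul, ← mul_assoc]
    exact hx _

end Extension

/-! ### Bases of quotients and their base change -/

section Bases

variable {N : ℕ} {A B : Type u} [CommRing A] [CommRing B] {β : Type*} [Fintype β] [DecidableEq β]

/-- The images of the `v b` form a basis of `A[[X]] / J`: there is a coordinate map with
kernel `J`. -/
def IsBasisMod (J : Ideal (MvPowerSeries (Fin N) A)) (v : β → MvPowerSeries (Fin N) A) : Prop :=
  ∃ π : MvPowerSeries (Fin N) A →ₗ[A] (β → A),
    (∀ f, π f = 0 ↔ f ∈ J) ∧ ∀ b, π (v b) = Pi.single b 1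

theorem coord_sum {π : MvPowerSeries (Fin N) A →ₗ[A] (β → A)}
    {v : β → MvPowerSeries (Fin N) A} (hv : ∀ b, π (v b) = Pi.single b 1) (c : β → A) :
    π (∑ b, c b • v b) = c := by
  rw [map_sum]
  simp_rw [map_smul, hv]
  ext b
  simp [Finset.sum_apply, Pi.single_apply]

theorem sub_coord_mem {J : Ideal (MvPowerSeries (Fin N) A)}
    {π : MvPowerSeries (Fin N) A →ₗ[A] (β → A)}
    {v : β → MvPowerSeries (Fin N) A} (hJ : ∀ f, π f = 0 ↔ f ∈ J)
    (hv : ∀ b, π (v b) = Pi.single b 1) (f : MvPowerSeries (Fin N) A) :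
    f - ∑ b, π f b • v b ∈ J := by
  rw [← hJ, map_sub, coord_sum hv, sub_self]

theorem isBasisMod_iff {J : Ideal (MvPowerSeries (Fin N) A)} {v : β → MvPowerSeries (Fin N) A} :
    IsBasisMod J v ↔ (∀ f, ∃ c : β → A, f - ∑ b, c b • v b ∈ J) ∧
      ∀ c : β → A, ∑ b, c b • v b ∈ J → c = 0 := by
  constructor
  · rintro ⟨π, hJ, hv⟩
    refine ⟨fun f => ⟨π f, sub_coord_mem hJ hv f⟩, fun c hc => ?_⟩
    rw [← coord_sum hv c]
    exact (hJ _).mpr hc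
  · rintro ⟨h₁, h₂⟩
    have huniq : ∀ f (c c' : β → A), f - ∑ b, c b • v b ∈ J → f - ∑ b, c' b • v b ∈ J →
        c = c' := by
      intro f c c' h h'
      rw [← sub_eq_zero]
      refine h₂ _ ?_
      have := J.sub_mem h' h
      simpa [sub_smul, Finset.sum_sub_distrib] using this
    choose π hπ using h₁
    refine ⟨{ toFun := π, map_add' := fun f g => ?_, map_smul' := fun a f => ?_ },
      fun f => ⟨fun h => ?_, fun h => ?_⟩, fun b => ?_⟩
    · refine huniq (f + g) _ _ (hπ _) ?_
      have := J.add_mem (hπ f) (hπ g)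
      simpa [add_smul, Finset.sum_add_distrib, add_sub_add_comm] using this
    · refine huniq (a • f) _ _ (hπ _) ?_
      have := smul_mem_ideal a (hπ f)
      simpa [smul_sub, Finset.smul_sum, mul_smul] using this
    · have h' : π f = 0 := h
      simpa [h'] using hπ f
    · exact huniq f _ 0 (hπ f) (by simpa using h)
    · refine huniq (v b) _ _ (hπ _) ?_
      simp [Pi.single_apply]

/-- Base change of a coordinate map. -/
theorem ofCoord_extend_eq_zero_iff (φ : A →+* B) {n : ℕ} {J : Ideal (MvPowerSeries (Fin N) A)}
    {y : (Fin N →₀ ℕ) → β → A} {v : β → MvPowerSeries (Fin N) A}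
    (hJ : ∀ f, ofCoord n y f = 0 ↔ f ∈ J) (hv : ∀ b, ofCoord n y (v b) = Pi.single b 1)
    (g : MvPowerSeries (Fin N) B) :
    ofCoord n (fun μ b => φ (y μ b)) g = 0 ↔ g ∈ extendIdeal φ J := by
  have hn : varIdeal N A ^ n ≤ J := fun f hf => (hJ f).mp (ofCoord_of_mem y hf)
  have hmap : ∀ f, ofCoord n (fun μ b => φ (y μ b)) (MvPowerSeries.map φ f) =
      fun b => φ (ofCoord n y f b) := fun f => by
    funext b
    rw [ofCoord_map]
  refine ⟨fun hg => ?_, fun hg => ?_⟩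
  -- S consists of the series congruent to the combination of the v b prescribed by the extended
  -- coordinates. It contains (X)^n and the monomials, hence everything.
  · let S : Submodule B (MvPowerSeries (Fin N) B) :=
      ((extendIdeal φ J).restrictScalars B).comap
      (LinearMap.id - (Fintype.linearCombination B fun b => MvPowerSeries.map φ (v b)) ∘ₗ
        ofCoord n fun μ b => φ (y μ b))
    have hS : ∀ g, g ∈ S ↔ g - ∑ b, ofCoord n (fun μ b => φ (y μ b)) g b •
        MvPowerSeries.map φ (v b) ∈ extendIdeal φ J := fun g => Iff.rfl
    have := (hS g).mp (mem_of_mon_mem S n (fun f hf => ?_) (fun μ hμ => ?_) g)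
    · rw [hg] at this
      simpa using this
    · rw [hS, ofCoord_of_mem _ hf]
      simpa using varIdeal_pow_le_extendIdeal φ hn hf
    · have := map_mem_extendIdeal φ (sub_coord_mem hJ hv (mon A μ))
      rw [map_sub, map_sum] at this
      rw [hS, ← map_mon φ, hmap]
      simpa only [map_smul_series] using this
  · refine extendIdeal_le_ker φ n _ (fun f hf => ofCoord_of_mem _ hf) (fun f hf => ?_) hg
    rw [hmap, (hJ f).mpr hf]
    ext b
    simp

theorem ofCoord_extend_single (φ : A →+* B) {n : ℕ} {y : (Fin N →₀ ℕ) → β → A}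
    {v : β → MvPowerSeries (Fin N) A} (hv : ∀ b, ofCoord n y (v b) = Pi.single b 1) (b : β) :
    ofCoord n (fun μ b => φ (y μ b)) (MvPowerSeries.map φ (v b)) = Pi.single b 1 := by
  ext b'
  rw [ofCoord_map, hv]
  simp [Pi.single_apply, apply_ite φ]

theorem IsBasisMod.exists_ofCoord {n : ℕ} {J : Ideal (MvPowerSeries (Fin N) A)}
    (hn : varIdeal N A ^ n ≤ J) {v : β → MvPowerSeries (Fin N) A} (h : IsBasisMod J v) :
    ∃ y : (Fin N →₀ ℕ) → β → A, (∀ f, ofCoord n y f = 0 ↔ f ∈ J) ∧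
      ∀ b, ofCoord n y (v b) = Pi.single b 1 := by
  obtain ⟨π, hJ, hv⟩ := h
  have hπ := eq_ofCoord (n := n) (π := π) fun f hf => (hJ f).mpr (hn hf)
  exact ⟨fun μ => π (mon A μ), hπ ▸ hJ, hπ ▸ hv⟩

theorem IsBasisMod.extend (φ : A →+* B) {n : ℕ} {J : Ideal (MvPowerSeries (Fin N) A)}
    (hn : varIdeal N A ^ n ≤ J) {v : β → MvPowerSeries (Fin N) A} (h : IsBasisMod J v) :
    IsBasisMod (extendIdeal φ J) fun b => MvPowerSeries.map φ (v b) := by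
  obtain ⟨y, hJ, hv⟩ := h.exists_ofCoord hn
  exact ⟨_, ofCoord_extend_eq_zero_iff φ hJ hv, ofCoord_extend_single φ hv⟩

/-- Criterion for another family to be a basis, by a determinant. -/
theorem isBasisMod_iff_det {J : Ideal (MvPowerSeries (Fin N) A)}
    {π : MvPowerSeries (Fin N) A →ₗ[A] (β → A)}
    {v : β → MvPowerSeries (Fin N) A} (hJ : ∀ f, π f = 0 ↔ f ∈ J)
    (hv : ∀ b, π (v b) = Pi.single b 1) (w : β → MvPowerSeries (Fin N) A) :
    IsBasisMod J w ↔ IsUnit (Matrix.of fun b b' => π (w b') b).det := by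
  rw [← Matrix.isUnit_iff_isUnit_det]
  set P : Matrix β β A := Matrix.of fun b b' => π (w b') b
  have hP : ∀ c : β → A, π (∑ b, c b • w b) = P.mulVec c := by
    intro c
    ext b
    rw [map_sum]
    simp [Finset.sum_apply, P, Matrix.mulVec, dotProduct, mul_comm]
  constructor
  · intro h
    rw [← Matrix.mulVec_surjective_iff_isUnit]
    intro c
    obtain ⟨d, hd⟩ := (isBasisMod_iff.mp h).1 (∑ b, c b • v b)
    refine ⟨d, ?_⟩
    rw [← hJ, map_sub, coord_sum hv, hP, sub_eq_zero] at hd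
    exact hd.symm
  · intro h
    refine isBasisMod_iff.mpr ⟨fun f => ?_, fun c hc => ?_⟩
    · obtain ⟨c, hc⟩ := Matrix.mulVec_surjective_iff_isUnit.mpr h (π f)
      refine ⟨c, ?_⟩
      rw [← hJ, map_sub, hP, hc, sub_self]
    · rw [← hJ, hP] at hc
      exact (Matrix.mulVec_injective_of_isUnit h) (hc.trans (Matrix.mulVec_zero P).symm)

/-- Being a basis is an open condition. -/
theorem IsBasisMod.exists_isUnit_iff {n : ℕ} {J : Ideal (MvPowerSeries (Fin N) A)}
    (hn : varIdeal N A ^ n ≤ J) {v : β → MvPowerSeries (Fin N) A} (h : IsBasisMod J v)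
    (w : β → MvPowerSeries (Fin N) A) :
    ∃ d : A, ∀ (B : Type u) [CommRing B] (φ : A →+* B),
      IsBasisMod (extendIdeal φ J) (fun b => MvPowerSeries.map φ (w b)) ↔ IsUnit (φ d) := by
  obtain ⟨y, hJ, hv⟩ := h.exists_ofCoord hn
  refine ⟨(Matrix.of fun b b' => ofCoord n y (w b') b).det, fun B _ φ => ?_⟩
  rw [isBasisMod_iff_det (ofCoord_extend_eq_zero_iff φ hJ hv) (ofCoord_extend_single φ hv),
    RingHom.map_det]
  have : (Matrix.of fun b b' =>
      ofCoord n (fun μ b => φ (y μ b)) (MvPowerSeries.map φ (w b')) b) =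
      φ.mapMatrix (Matrix.of fun b b' => ofCoord n y (w b') b) := by
    ext b b'
    exact ofCoord_map n φ y (w b') b
  rw [this]

end Bases

end

end CurveSing

namespace CurveSing

noncomputable section

/-! ### Base change of quotients, localization, spreading out -/

section BaseChange

variable {N : ℕ} {A B : Type u} [CommRing A] [CommRing B]

/-- The quotient map as a linear map over the coefficients. -/
def mkLin (J : Ideal (MvPowerSeries (Fin N) A)) :
    MvPowerSeries (Fin N) A →ₗ[A] MvPowerSeries (Fin N) A ⧸ J :=
  (Ideal.Quotient.mkₐ A J).toLinearMap

theorem mkLin_surjective (J : Ideal (MvPowerSeries (Fin N) A)) : Function.Surjective (mkLin J) :=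
  Ideal.Quotient.mk_surjective

theorem mkLin_eq_zero {J : Ideal (MvPowerSeries (Fin N) A)} {f : MvPowerSeries (Fin N) A} :
    mkLin J f = 0 ↔ f ∈ J := Ideal.Quotient.eq_zero_iff_mem

/-- Linear maps on `A[[X]]` vanishing on `J` factor through the quotient. -/
theorem exists_lift_mkLin {M : Type*} [AddCommGroup M] [Module A M]
    {J : Ideal (MvPowerSeries (Fin N) A)} (π : MvPowerSeries (Fin N) A →ₗ[A] M)
    (h : ∀ f ∈ J, π f = 0) :
    ∃ ρ : (MvPowerSeries (Fin N) A ⧸ J) →ₗ[A] M, ∀ f, ρ (mkLin J f) = π f := by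
  refine ⟨{ toFun := fun x => Quotient.liftOn' x π fun f g hfg => ?_
            map_add' := ?_, map_smul' := ?_ }, fun f => rfl⟩
  · rw [← sub_eq_zero, ← map_sub]
    exact h _ ((Submodule.quotientRel_def J).mp hfg)
  · intro x y
    obtain ⟨f, rfl⟩ := Ideal.Quotient.mk_surjective x
    obtain ⟨g, rfl⟩ := Ideal.Quotient.mk_surjective y
    exact map_add π f g
  · intro c x
    obtain ⟨f, rfl⟩ := Ideal.Quotient.mk_surjective x
    exact map_smul π c f

/-- Forming power series does not commute with tensor products, but modulo an ideal containing (X)^n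
only the finitely many monomials of degree < n matter. The inverse map reads off the coefficients of
those. -/
theorem exists_baseChangeEquiv [Algebra A B] {n : ℕ} {J : Ideal (MvPowerSeries (Fin N) A)}
    (hn : varIdeal N A ^ n ≤ J) :
    ∃ e : (B ⊗[A] (MvPowerSeries (Fin N) A ⧸ J)) ≃ₗ[B]
        (MvPowerSeries (Fin N) B ⧸ extendIdeal (algebraMap A B) J),
      ∀ f, e (1 ⊗ₜ mkLin J f) = mkLin _ (MvPowerSeries.map (algebraMap A B) f) := by
  set φ := algebraMap A B
  let π₀ : MvPowerSeries (Fin N) A →ₗ[A] (MvPowerSeries (Fin N) B ⧸ extendIdeal φ J) :=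
    { toFun := fun f => mkLin _ (MvPowerSeries.map φ f)
      map_add' := fun f g => by rw [map_add, map_add]
      map_smul' := fun c f => by
        rw [map_smul_series, map_smul, RingHom.id_apply, algebraMap_smul] }
  obtain ⟨ρ, hρ⟩ := exists_lift_mkLin (J := J) π₀
    fun f hf => mkLin_eq_zero.mpr (map_mem_extendIdeal φ hf)
  let F := LinearMap.liftBaseChange B ρ
  have hF : ∀ f, F (1 ⊗ₜ mkLin J f) = mkLin _ (MvPowerSeries.map φ f) := fun f => by
    simp only [F, LinearMap.liftBaseChange_tmul, one_smul, hρ]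
    rfl
  let π₁ : MvPowerSeries (Fin N) B →ₗ[B] B ⊗[A] (MvPowerSeries (Fin N) A ⧸ J) :=
    ∑ μ ∈ lowMon N n, (MvPowerSeries.coeff (R := B) μ).smulRight (1 ⊗ₜ mkLin J (mon A μ))
  have hπ₁ : ∀ g, π₁ g = ∑ μ ∈ lowMon N n, MvPowerSeries.coeff μ g • (1 ⊗ₜ mkLin J (mon A μ)) :=
    fun g => by simp [π₁, LinearMap.sum_apply]
  have hmap : ∀ f, π₁ (MvPowerSeries.map φ f) = 1 ⊗ₜ mkLin J f := by
    intro f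
    have h0 := hn (sub_trunc_mem f n)
    rw [← mkLin_eq_zero, map_sub, sub_eq_zero] at h0
    rw [hπ₁, h0, map_sum, TensorProduct.tmul_sum]
    refine Finset.sum_congr rfl fun μ _ => ?_
    rw [MvPowerSeries.coeff_map, map_smul, TensorProduct.tmul_smul, algebraMap_smul]
  have hkill : ∀ f ∈ varIdeal N B ^ n, π₁ f = 0 := fun f hf => by
    rw [hπ₁]
    refine Finset.sum_eq_zero fun μ hμ => ?_
    rw [mem_varIdeal_pow.mp hf μ (mem_lowMon.mp hμ), zero_smul]
  obtain ⟨G, hG⟩ := exists_lift_mkLin (J := extendIdeal φ J) π₁ fun g hg =>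
    extendIdeal_le_ker φ n π₁ hkill (fun f hf => by
      rw [hmap, mkLin_eq_zero.mpr hf, TensorProduct.tmul_zero]) hg
  have hFG : ∀ y, F (G y) = y := by
    intro y
    obtain ⟨g, rfl⟩ := mkLin_surjective _ y
    rw [hG]
    refine LinearMap.congr_fun (linearMap_ext_of_trunc n (π := F ∘ₗ π₁)
      (π' := mkLin (extendIdeal φ J)) (fun f hf => ?_) (fun f hf => ?_) fun μ _ => ?_) g
    · rw [LinearMap.comp_apply, hkill f hf, map_zero]
    · exact mkLin_eq_zero.mpr (varIdeal_pow_le_extendIdeal φ hn hf)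
    · rw [LinearMap.comp_apply, ← map_mon φ, hmap, hF]
  have hGF : ∀ x, G (F x) = x := by
    intro x
    induction x with
    | zero => rw [map_zero, map_zero]
    | add x y hx hy => rw [map_add, map_add, hx, hy]
    | tmul b x =>
      obtain ⟨f, rfl⟩ := mkLin_surjective _ x
      have : b ⊗ₜ[A] mkLin J f = b • ((1 : B) ⊗ₜ[A] mkLin J f) := by
        rw [TensorProduct.smul_tmul', smul_eq_mul, mul_one]
      rw [this, map_smul, map_smul, hF, hG, hmap]
  exact ⟨LinearEquiv.ofBijective F
    ⟨Function.LeftInverse.injective hGF, Function.RightInverse.surjective hFG⟩, hF⟩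

theorem moduleFinite_quotient {n : ℕ} {J : Ideal (MvPowerSeries (Fin N) A)}
    (hn : varIdeal N A ^ n ≤ J) : Module.Finite A (MvPowerSeries (Fin N) A ⧸ J) := by
  classical
  refine ⟨⟨(lowMon N n).image fun μ => mkLin J (mon A μ), ?_⟩⟩
  rw [eq_top_iff]
  rintro x -
  obtain ⟨f, rfl⟩ := mkLin_surjective J x
  refine mem_of_mon_mem ((Submodule.span A _).comap (mkLin J)) n (fun f hf => ?_)
    (fun μ hμ => ?_) f
  · rw [Submodule.mem_comap, mkLin_eq_zero.mpr (hn hf)]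
    exact Submodule.zero_mem _
  · refine Submodule.subset_span ?_
    rw [Finset.coe_image]
    exact ⟨μ, Finset.mem_coe.mpr (mem_lowMon.mpr hμ), rfl⟩

theorem IsLocallyFreeOfRank.of_equiv {Q Q' : Type u} [AddCommGroup Q] [Module A Q]
    [AddCommGroup Q'] [Module A Q'] {r : ℤ} (e : Q ≃ₗ[A] Q') (h : IsLocallyFreeOfRank A Q r) :
    IsLocallyFreeOfRank A Q' r := by
  obtain ⟨h₁, h₂, h₃⟩ := h
  exact ⟨Module.Finite.equiv e, Module.Projective.of_equiv e, fun P => by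
    rw [← h₃ P, Module.rankAtStalk_eq_of_equiv e]⟩

theorem IsLocallyFreeOfRank.extend (φ : A →+* B) {n : ℕ} {J : Ideal (MvPowerSeries (Fin N) A)}
    (hn : varIdeal N A ^ n ≤ J) {r : ℤ}
    (h : IsLocallyFreeOfRank A (MvPowerSeries (Fin N) A ⧸ J) r) :
    IsLocallyFreeOfRank B (MvPowerSeries (Fin N) B ⧸ extendIdeal φ J) r := by
  let _ := φ.toAlgebra
  obtain ⟨e, -⟩ := exists_baseChangeEquiv (B := B) hn
  refine IsLocallyFreeOfRank.of_equiv e ?_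
  obtain ⟨h₁, h₂, h₃⟩ := h
  exact ⟨inferInstance, inferInstance, fun P => by rw [Module.rankAtStalk_baseChange, h₃]⟩

end BaseChange

/-! ### Generators, ranks and spreading out -/

section Bases

variable {N : ℕ} {A B : Type u} [CommRing A] [CommRing B] {β : Type*} [Fintype β]

/-- The images of the `v b` generate `A[[X]] / J`. -/
def IsSpanMod (J : Ideal (MvPowerSeries (Fin N) A)) (v : β → MvPowerSeries (Fin N) A) : Prop :=
  ∀ f, ∃ c : β → A, f - ∑ b, c b • v b ∈ J

theorem isSpanMod_iff_surjective {J : Ideal (MvPowerSeries (Fin N) A)}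
    {v : β → MvPowerSeries (Fin N) A} : IsSpanMod J v ↔
      Function.Surjective (Fintype.linearCombination A fun b => mkLin J (v b)) := by
  constructor
  · intro h x
    obtain ⟨f, rfl⟩ := mkLin_surjective J x
    obtain ⟨c, hc⟩ := h f
    refine ⟨c, ?_⟩
    rw [← mkLin_eq_zero, map_sub, sub_eq_zero, map_sum] at hc
    simp_rw [map_smul] at hc
    exact hc.symm
  · intro h f
    obtain ⟨c, hc⟩ := h (mkLin J f)
    refine ⟨c, ?_⟩
    rw [← mkLin_eq_zero, map_sub, sub_eq_zero, map_sum]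
    simp_rw [map_smul]
    exact hc.symm

theorem isBasisMod_iff_bijective [DecidableEq β] {J : Ideal (MvPowerSeries (Fin N) A)}
    {v : β → MvPowerSeries (Fin N) A} : IsBasisMod J v ↔
      Function.Bijective (Fintype.linearCombination A fun b => mkLin J (v b)) := by
  rw [isBasisMod_iff, Function.Bijective, and_comm]
  refine and_congr ?_ isSpanMod_iff_surjective
  rw [← LinearMap.ker_eq_bot, LinearMap.ker_eq_bot']
  refine forall_congr' fun c => ?_
  rw [Fintype.linearCombination_apply, ← mkLin_eq_zero, map_sum]
  simp_rw [map_smul]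

theorem IsBasisMod.isSpanMod [DecidableEq β] {J : Ideal (MvPowerSeries (Fin N) A)}
    {v : β → MvPowerSeries (Fin N) A} (h : IsBasisMod J v) : IsSpanMod J v :=
  (isBasisMod_iff.mp h).1

/-- Generators in the expected number of a locally free module form a basis. -/
theorem IsSpanMod.isBasisMod [DecidableEq β] {J : Ideal (MvPowerSeries (Fin N) A)}
    {v : β → MvPowerSeries (Fin N) A}
    (hv : IsSpanMod J v)
    (h : IsLocallyFreeOfRank A (MvPowerSeries (Fin N) A ⧸ J) (Fintype.card β)) :
    IsBasisMod J v := by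
  obtain ⟨h₁, h₂, h₃⟩ := h
  rw [isBasisMod_iff_bijective]
  refine Module.bijective_of_surjective_of_rankAtStalk_eq (isSpanMod_iff_surjective.mp hv)
    fun m hm => ?_
  have : Nontrivial A := ⟨0, 1, fun h0 => hm.ne_top (by
    rw [Ideal.eq_top_iff_one, ← h0]; exact m.zero_mem)⟩
  have := h₃ ⟨m, hm.isPrime⟩
  rw [Module.rankAtStalk_eq_finrank_of_free, Pi.natCast_apply, Module.finrank_pi]
  exact_mod_cast this.symm

theorem isLocallyFreeOfRank_of_isBasisMod [DecidableEq β] {J : Ideal (MvPowerSeries (Fin N) A)}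
    {v : β → MvPowerSeries (Fin N) A} (hv : IsBasisMod J v) :
    IsLocallyFreeOfRank A (MvPowerSeries (Fin N) A ⧸ J) (Fintype.card β) := by
  have e := LinearEquiv.ofBijective _ (isBasisMod_iff_bijective.mp hv)
  have hfree : Module.Free A (MvPowerSeries (Fin N) A ⧸ J) := Module.Free.of_equiv e
  refine ⟨Module.Finite.equiv e, inferInstance, fun P => ?_⟩
  have : Nontrivial A := ⟨0, 1, fun h0 => P.2.ne_top (by
    rw [Ideal.eq_top_iff_one, ← h0]; exact P.asIdeal.zero_mem)⟩
  rw [Module.rankAtStalk_eq_finrank_of_free, Pi.natCast_apply, ← e.finrank_eq, Module.finrank_pi]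
  rfl

theorem finrank_quotient_of_isLocallyFreeOfRank {K : Type u} [Field K]
    {J : Ideal (MvPowerSeries (Fin N) K)} {r : ℤ}
    (h : IsLocallyFreeOfRank K (MvPowerSeries (Fin N) K ⧸ J) r) :
    (Module.finrank K (MvPowerSeries (Fin N) K ⧸ J) : ℤ) = r := by
  rw [← h.2.2 ⊥, Module.rankAtStalk_eq_finrank_of_free]
  rfl

theorem isLocallyFreeOfRank_of_finrank {K : Type u} [Field K] {n : ℕ}
    {J : Ideal (MvPowerSeries (Fin N) K)} {r : ℤ} (hn : varIdeal N K ^ n ≤ J)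
    (h : (Module.finrank K (MvPowerSeries (Fin N) K ⧸ J) : ℤ) = r) :
    IsLocallyFreeOfRank K (MvPowerSeries (Fin N) K ⧸ J) r := by
  refine ⟨moduleFinite_quotient hn, inferInstance, fun P => ?_⟩
  rw [Module.rankAtStalk_eq_finrank_of_free]
  exact h

/-- The hypothesis is generation up to the denominator a, as spreading out provides it; where a
becomes invertible it turns into generation. -/
theorem IsSpanMod.extend (φ : A →+* B) {n : ℕ} {J : Ideal (MvPowerSeries (Fin N) A)}
    (hn : varIdeal N A ^ n ≤ J) {v : β → MvPowerSeries (Fin N) A} {a : A} (ha : IsUnit (φ a))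
    (h : ∀ f, ∃ c : β → A, a • f - ∑ b, c b • v b ∈ J) :
    IsSpanMod (extendIdeal φ J) fun b => MvPowerSeries.map φ (v b) := by
  rw [isSpanMod_iff_surjective, ← LinearMap.range_eq_top, eq_top_iff]
  rintro x -
  obtain ⟨f, rfl⟩ := mkLin_surjective _ x
  refine mem_of_mon_mem ((LinearMap.range (Fintype.linearCombination B fun b =>
    mkLin (extendIdeal φ J) (MvPowerSeries.map φ (v b)))).comap (mkLin _)) n (fun f hf => ?_)
    (fun μ hμ => ?_) f
  · rw [Submodule.mem_comap, mkLin_eq_zero.mpr (varIdeal_pow_le_extendIdeal φ hn hf)]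
    exact Submodule.zero_mem _
  · rw [Submodule.mem_comap]
    obtain ⟨c, hc⟩ := h (mon A μ)
    have hc' := map_mem_extendIdeal φ hc
    rw [map_sub, map_sum, map_smul_series, map_mon, ← mkLin_eq_zero, map_sub, sub_eq_zero,
      map_smul, map_sum] at hc'
    refine (Submodule.smul_mem_iff_of_isUnit _ ha).mp ?_
    rw [hc']
    exact ⟨fun b => φ (c b), by
      rw [Fintype.linearCombination_apply]
      simp_rw [map_smul_series, map_smul]⟩

/-- Generation at a point spreads out to a neighbourhood. -/
theorem exists_notMem_smul_mem {n : ℕ} {J : Ideal (MvPowerSeries (Fin N) A)}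
    (hn : varIdeal N A ^ n ≤ J) (v : β → MvPowerSeries (Fin N) A) (P : PrimeSpectrum A)
    (h : IsSpanMod (extendIdeal (algebraMap A P.asIdeal.ResidueField) J)
      fun b => MvPowerSeries.map (algebraMap A P.asIdeal.ResidueField) (v b)) :
    ∃ a ∉ P.asIdeal, ∀ f, ∃ c : β → A, a • f - ∑ b, c b • v b ∈ J := by
  set L := Fintype.linearCombination A fun b => mkLin J (v b)
  have := moduleFinite_quotient hn
  obtain ⟨e, he⟩ := exists_baseChangeEquiv (B := P.asIdeal.ResidueField) hn
  -- Nakayama's lemma: the cokernel of L is finite and vanishes over the residue field at P, so P is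
  -- outside its support and some a outside P annihilates it.
  have hsupp : P ∉ Module.support A ((MvPowerSeries (Fin N) A ⧸ J) ⧸ LinearMap.range L) := by
    rw [Module.mem_support_iff_nontrivial_residueField_tensorProduct, not_nontrivial_iff_subsingleton]
    refine subsingleton_of_forall_eq 0 fun z => ?_
    obtain ⟨z, rfl⟩ := LinearMap.lTensor_surjective P.asIdeal.ResidueField
      (Submodule.mkQ_surjective (LinearMap.range L)) z
    obtain ⟨g, hg⟩ := mkLin_surjective _ (e z)
    obtain ⟨c, hc⟩ := h g
    have hz : z = ∑ b, c b • ((1 : P.asIdeal.ResidueField) ⊗ₜ[A] mkLin J (v b)) := by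
      apply e.injective
      rw [map_sum]
      simp_rw [map_smul, he]
      rw [← hg]
      rw [← mkLin_eq_zero, map_sub, sub_eq_zero, map_sum] at hc
      simpa only [map_smul] using hc
    rw [hz, map_sum]
    refine Finset.sum_eq_zero fun b _ => ?_
    have h0 : (LinearMap.range L).mkQ (mkLin J (v b)) = 0 := by
      rw [Submodule.mkQ_apply, Submodule.Quotient.mk_eq_zero]
      classical
      exact ⟨Pi.single b 1, by simp [L]⟩
    rw [TensorProduct.smul_tmul', LinearMap.lTensor_tmul, h0, TensorProduct.tmul_zero]
  rw [Module.mem_support_iff_of_finite, SetLike.not_le_iff_exists] at hsupp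
  obtain ⟨a, ha, haP⟩ := hsupp
  refine ⟨a, haP, fun f => ?_⟩
  have := Module.mem_annihilator.mp ha ((LinearMap.range L).mkQ (mkLin J f))
  rw [← map_smul, Submodule.mkQ_apply, Submodule.Quotient.mk_eq_zero] at this
  obtain ⟨c, hc⟩ := this
  refine ⟨c, ?_⟩
  rw [← mkLin_eq_zero, map_sub, sub_eq_zero, map_sum, map_smul, ← hc]
  simp [L, Fintype.linearCombination_apply]

/-- A family generating the quotient at every point generates it. -/
theorem isSpanMod_of_fibres {n : ℕ} {J : Ideal (MvPowerSeries (Fin N) A)}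
    (hn : varIdeal N A ^ n ≤ J) (v : β → MvPowerSeries (Fin N) A)
    (h : ∀ P : PrimeSpectrum A, IsSpanMod (extendIdeal (algebraMap A P.asIdeal.ResidueField) J)
      fun b => MvPowerSeries.map (algebraMap A P.asIdeal.ResidueField) (v b)) :
    IsSpanMod J v := by
  let S : Submodule A (MvPowerSeries (Fin N) A) :=
    (LinearMap.range (Fintype.linearCombination A fun b => mkLin J (v b))).comap (mkLin J)
  have hS : ∀ f, f ∈ S ↔ ∃ c : β → A, f - ∑ b, c b • v b ∈ J := by
    intro f
    change (∃ c, Fintype.linearCombination A (fun b => mkLin J (v b)) c = mkLin J f) ↔ _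
    refine exists_congr fun c => ?_
    rw [← mkLin_eq_zero, map_sub, sub_eq_zero, map_sum, Fintype.linearCombination_apply, eq_comm]
    simp_rw [map_smul]
  -- I is the ideal of scalars that move every series into the span. Spreading out at a maximal
  -- ideal produces an element of I outside it, so I is the unit ideal.
  let I : Ideal A := ⨅ f : MvPowerSeries (Fin N) A,
    S.comap (LinearMap.toSpanSingleton A (MvPowerSeries (Fin N) A) f)
  have hI : ∀ a, a ∈ I ↔ ∀ f, a • f ∈ S := by
    intro a
    simp [I, Submodule.mem_iInf]
  have htop : I = ⊤ := by
    by_contra hne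
    obtain ⟨m, hm, hle⟩ := Ideal.exists_le_maximal I hne
    obtain ⟨a, ha, hf⟩ := exists_notMem_smul_mem hn v ⟨m, hm.isPrime⟩ (h _)
    exact ha (hle ((hI a).mpr fun f => (hS _).mpr (hf f)))
  intro f
  have := (hI 1).mp (htop ▸ Submodule.mem_top) f
  rwa [one_smul, hS] at this

end Bases

/-! ### Ideals over localizations and their gluing -/

section Localization

variable {N : ℕ} {A : Type u} [CommRing A]

/-- A series over A_a need not have a common denominator. Modulo (X)^n only finitely many
coefficients count, and the error is harmless for ideals containing (X)^n. -/
theorem exists_pow_smul_eq_map (a : A) (n : ℕ) (h : MvPowerSeries (Fin N) (Localization.Away a)) :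
    ∃ (m : ℕ) (f : MvPowerSeries (Fin N) A),
      algebraMap A (Localization.Away a) a ^ m • h -
        MvPowerSeries.map (algebraMap A (Localization.Away a)) f ∈
          varIdeal N (Localization.Away a) ^ n := by
  classical
  obtain ⟨⟨b, m, rfl⟩, hb⟩ := IsLocalization.exist_integer_multiples (Submonoid.powers a)
    (lowMon N n) fun μ => MvPowerSeries.coeff μ h
  choose! c hc using hb
  let f : MvPowerSeries (Fin N) A := fun μ => c μ
  have hf : ∀ μ, MvPowerSeries.coeff μ f = c μ := fun _ => rfl
  refine ⟨m, f, mem_varIdeal_pow.mpr fun μ hμ => ?_⟩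
  have := hc μ (mem_lowMon.mpr hμ)
  rw [map_sub, map_smul, MvPowerSeries.coeff_map, sub_eq_zero, hf]
  refine Eq.trans ?_ this.symm
  change _ = (a ^ m) • _
  rw [← map_pow, algebraMap_smul]

theorem exists_pow_smul_mem_of_map_mem (a : A) (n : ℕ) (f : MvPowerSeries (Fin N) A)
    (hf : MvPowerSeries.map (algebraMap A (Localization.Away a)) f ∈
      varIdeal N (Localization.Away a) ^ n) :
    ∃ m : ℕ, a ^ m • f ∈ varIdeal N A ^ n := by
  have h : ∀ μ : Fin N →₀ ℕ, ∃ m : ℕ, μ.degree < n → a ^ m * MvPowerSeries.coeff μ f = 0 := by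
    intro μ
    by_cases hμ : μ.degree < n
    · have := mem_varIdeal_pow.mp hf μ hμ
      rw [MvPowerSeries.coeff_map, IsLocalization.map_eq_zero_iff (Submonoid.powers a)] at this
      obtain ⟨⟨_, m, rfl⟩, hm⟩ := this
      exact ⟨m, fun _ => hm⟩
    · exact ⟨0, fun h => absurd h hμ⟩
  choose m hm using h
  refine ⟨∑ μ ∈ lowMon N n, m μ, mem_varIdeal_pow.mpr fun μ hμ => ?_⟩
  rw [map_smul, smul_eq_mul, ← Finset.sum_erase_add _ _ (mem_lowMon.mpr hμ), pow_add, mul_assoc,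
    hm μ hμ, mul_zero]

theorem exists_pow_smul_eq_map_of_mem (n : ℕ) {J : Ideal (MvPowerSeries (Fin N) A)}
    (a : A) {g : MvPowerSeries (Fin N) (Localization.Away a)}
    (hg : g ∈ extendIdeal (algebraMap A (Localization.Away a)) J) :
    ∃ (m : ℕ) (f : MvPowerSeries (Fin N) A), f ∈ J ∧
      algebraMap A (Localization.Away a) a ^ m • g -
        MvPowerSeries.map (algebraMap A (Localization.Away a)) f ∈
          varIdeal N (Localization.Away a) ^ n := by
  refine Submodule.span_induction (p := fun g _ =>
    ∃ (m : ℕ) (f : MvPowerSeries (Fin N) A), f ∈ J ∧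
      algebraMap A (Localization.Away a) a ^ m • g -
        MvPowerSeries.map (algebraMap A (Localization.Away a)) f ∈
          varIdeal N (Localization.Away a) ^ n) ?_ ?_ ?_ ?_ hg
  · rintro _ ⟨f, hf, rfl⟩
    refine ⟨0, f, hf, ?_⟩
    rw [pow_zero, one_smul, sub_self]
    exact Ideal.zero_mem _
  · exact ⟨0, 0, J.zero_mem, by simp⟩
  · rintro x y _ _ ⟨m, f, hf, h⟩ ⟨m', f', hf', h'⟩
    refine ⟨m + m', a ^ m' • f + a ^ m • f',
      J.add_mem (smul_mem_ideal _ hf) (smul_mem_ideal _ hf'), ?_⟩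
    have := Ideal.add_mem _ (smul_mem_ideal (algebraMap A (Localization.Away a) a ^ m') h)
      (smul_mem_ideal (algebraMap A (Localization.Away a) a ^ m) h')
    rw [smul_sub, smul_sub, smul_smul, smul_smul, ← pow_add, ← pow_add] at this
    rw [map_add, map_smul_series, map_smul_series, map_pow, map_pow, smul_add,
      add_sub_add_comm]
    rwa [add_comm m' m] at this
  · rintro h x _ ⟨m, f, hf, hx⟩
    obtain ⟨m', f', hf'⟩ := exists_pow_smul_eq_map a n h
    refine ⟨m' + m, f' * f, J.mul_mem_left _ hf, ?_⟩
    have := Ideal.add_mem _ (Ideal.mul_mem_right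
      (algebraMap A (Localization.Away a) a ^ m • x) _ hf')
      (Ideal.mul_mem_left _ (MvPowerSeries.map (algebraMap A (Localization.Away a)) f') hx)
    rw [sub_mul, mul_sub, sub_add_sub_cancel] at this
    rwa [smul_eq_mul, map_mul, pow_add, ← smul_mul_smul_comm]

/-- Membership in the localization of an ideal containing a power of `(X)`. -/
theorem exists_pow_smul_mem {n : ℕ} {J : Ideal (MvPowerSeries (Fin N) A)}
    (hn : varIdeal N A ^ n ≤ J) (a : A) {f : MvPowerSeries (Fin N) A}
    (hf : MvPowerSeries.map (algebraMap A (Localization.Away a)) f ∈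
      extendIdeal (algebraMap A (Localization.Away a)) J) :
    ∃ m : ℕ, a ^ m • f ∈ J := by
  obtain ⟨m, g, hg, h⟩ := exists_pow_smul_eq_map_of_mem n a hf
  rw [← map_pow, ← map_smul_series, ← map_sub] at h
  obtain ⟨m', h'⟩ := exists_pow_smul_mem_of_map_mem a n _ h
  refine ⟨m' + m, ?_⟩
  have := J.add_mem (hn h') (smul_mem_ideal (a ^ m') hg)
  rwa [smul_sub, sub_add_cancel, smul_smul, ← pow_add] at this

theorem mem_of_forall_pow_smul_mem {J : Ideal (MvPowerSeries (Fin N) A)} {s : Finset A}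
    (hs : Ideal.span (s : Set A) = ⊤) {f : MvPowerSeries (Fin N) A}
    (h : ∀ a ∈ s, ∃ m : ℕ, a ^ m • f ∈ J) : f ∈ J := by
  choose! m hm using h
  let I : Ideal A := (J.restrictScalars A).comap (LinearMap.toSpanSingleton A _ f)
  have hI : ∀ a, a ∈ I ↔ a • f ∈ J := fun a => by simp [I]
  have htop : I = ⊤ := by
    by_contra hne
    obtain ⟨p, hp, hle⟩ := Ideal.exists_le_maximal I hne
    have : Ideal.span (s : Set A) ≤ p := Ideal.span_le.mpr fun a ha =>
      hp.isPrime.mem_of_pow_mem _ (hle ((hI _).mpr (hm a ha)))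
    exact hp.ne_top (top_le_iff.mp (hs ▸ this))
  have := (hI 1).mp (htop ▸ Submodule.mem_top)
  rwa [one_smul] at this

theorem le_of_forall_away {n : ℕ} {J J' : Ideal (MvPowerSeries (Fin N) A)}
    (hn : varIdeal N A ^ n ≤ J') {s : Finset A} (hs : Ideal.span (s : Set A) = ⊤)
    (h : ∀ a ∈ s, extendIdeal (algebraMap A (Localization.Away a)) J ≤
      extendIdeal (algebraMap A (Localization.Away a)) J') : J ≤ J' :=
  fun _ hf => mem_of_forall_pow_smul_mem hs fun a ha =>
    exists_pow_smul_mem hn a (h a ha (map_mem_extendIdeal _ hf))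

/-- The glued ideal is the intersection of the contractions of the x a. An element g of x a is
replaced, up to a power of a and modulo (X)^n, by a series f over A; on overlaps a power of a moves
f into each x b, and since s is finite one exponent serves all b. -/
theorem exists_glue_ideal {n : ℕ} {s : Finset A}
    (x : ∀ a : s, Ideal (MvPowerSeries (Fin N) (Localization.Away (a : A))))
    (hx : ∀ a : s, varIdeal N (Localization.Away (a : A)) ^ n ≤ x a)
    (hcompat : ∀ a b : s,
      ∃ φ : Localization.Away (a : A) →+*
          Localization.Away (algebraMap A (Localization.Away (b : A)) (a : A)),
        φ.comp (algebraMap A _) = (algebraMap _ _).comp (algebraMap A (Localization.Away (b : A))) ∧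
        extendIdeal φ (x a) = extendIdeal (algebraMap _ _) (x b)) :
    ∃ J : Ideal (MvPowerSeries (Fin N) A), varIdeal N A ^ n ≤ J ∧
      ∀ a : s, extendIdeal (algebraMap A (Localization.Away (a : A))) J = x a := by
  let J : Ideal (MvPowerSeries (Fin N) A) :=
    ⨅ a : s, (x a).comap (MvPowerSeries.map (algebraMap A (Localization.Away (a : A))))
  have hJ : ∀ f, f ∈ J ↔ ∀ a : s,
      MvPowerSeries.map (algebraMap A (Localization.Away (a : A))) f ∈ x a := fun f => by
    simp [J, Submodule.mem_iInf]
  have hnJ : varIdeal N A ^ n ≤ J := fun f hf => (hJ f).mpr fun a => hx a (by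
    have := map_mem_extendIdeal (algebraMap A (Localization.Away (a : A))) hf
    rwa [extendIdeal_varIdeal_pow] at this)
  refine ⟨J, hnJ, fun a => le_antisymm ?_ fun g hg => ?_⟩
  · rw [extendIdeal, Ideal.map_le_iff_le_comap]
    exact iInf_le _ a
  · obtain ⟨m, f, hf⟩ := exists_pow_smul_eq_map (a : A) n g
    have hf' : MvPowerSeries.map (algebraMap A (Localization.Away (a : A))) f ∈ x a := by
      have := (x a).sub_mem (smul_mem_ideal
        (algebraMap A (Localization.Away (a : A)) (a : A) ^ m) hg) (hx a hf)
      rwa [sub_sub_cancel] at this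
    have key : ∀ b : s, ∃ l : ℕ, algebraMap A (Localization.Away (b : A)) a ^ l •
        MvPowerSeries.map (algebraMap A (Localization.Away (b : A))) f ∈ x b := by
      intro b
      obtain ⟨φ, hφ, he⟩ := hcompat a b
      refine exists_pow_smul_mem (hx b) _ ?_
      have h1 := map_mem_extendIdeal φ hf'
      rw [he] at h1
      convert h1 using 1
      ext μ
      simp only [MvPowerSeries.coeff_map]
      exact (RingHom.congr_fun hφ _).symm
    choose l hl using key
    have _ : DecidableEq s := Classical.decEq _
    have hfJ : (a : A) ^ (∑ b, l b) • f ∈ J := by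
      rw [hJ]
      intro b
      rw [map_smul_series, map_pow, ← Finset.sum_erase_add _ _ (Finset.mem_univ b), pow_add,
        mul_smul]
      exact smul_mem_ideal _ (hl b)
    have h2 := map_mem_extendIdeal (algebraMap A (Localization.Away (a : A))) hfJ
    have hu : IsUnit (algebraMap A (Localization.Away (a : A)) a) :=
      IsLocalization.Away.algebraMap_isUnit _
    rw [map_smul_series, map_pow] at h2
    have h3 : MvPowerSeries.map (algebraMap A (Localization.Away (a : A))) f ∈
        (extendIdeal (algebraMap A (Localization.Away (a : A))) J).restrictScalars
          (Localization.Away (a : A)) :=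
      (Submodule.smul_mem_iff_of_isUnit _ (hu.pow _)).mp h2
    have h4 : g ∈ (extendIdeal (algebraMap A (Localization.Away (a : A))) J).restrictScalars
          (Localization.Away (a : A)) := by
      refine (Submodule.smul_mem_iff_of_isUnit _ (hu.pow m)).mp ?_
      have := Ideal.add_mem _ (varIdeal_pow_le_extendIdeal
        (algebraMap A (Localization.Away (a : A))) hnJ hf) h3
      rwa [sub_add_cancel] at this
    exact h4

end Localization

/-! ### Local freeness from local bases -/

section LocallyFree

variable {N : ℕ} {A : Type u} [CommRing A] {β : Type*} [Fintype β] [DecidableEq β]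

/-- Finite presentation and flatness descend from the members of a basic open cover and together
give projectivity; the rank at P is read at a prime of a localization above P. -/
theorem isLocallyFreeOfRank_of_local {n : ℕ} {J : Ideal (MvPowerSeries (Fin N) A)}
    (hn : varIdeal N A ^ n ≤ J)
    (h : ∀ P : PrimeSpectrum A, ∃ a ∉ P.asIdeal,
      ∃ v : β → MvPowerSeries (Fin N) (Localization.Away a),
      IsBasisMod (extendIdeal (algebraMap A (Localization.Away a)) J) v) :
    IsLocallyFreeOfRank A (MvPowerSeries (Fin N) A ⧸ J) (Fintype.card β) := by
  let s : Set A := {a | ∃ v : β → MvPowerSeries (Fin N) (Localization.Away a),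
      IsBasisMod (extendIdeal (algebraMap A (Localization.Away a)) J) v}
  have hs : Ideal.span s = ⊤ := by
    by_contra hne
    obtain ⟨p, hp, hle⟩ := Ideal.exists_le_maximal _ hne
    obtain ⟨a, ha, h'⟩ := h ⟨p, hp.isPrime⟩
    exact ha (hle (Ideal.subset_span h'))
  have key : ∀ a : s, IsLocallyFreeOfRank (Localization.Away (a : A))
      (LocalizedModule.Away (a : A) (MvPowerSeries (Fin N) A ⧸ J)) (Fintype.card β) := by
    rintro ⟨a, v, hv⟩
    obtain ⟨e, -⟩ := exists_baseChangeEquiv (B := Localization.Away a) hn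
    exact (isLocallyFreeOfRank_of_isBasisMod hv).of_equiv
      (e.symm.trans (LocalizedModule.equivTensorProduct (Submonoid.powers a) _).symm)
  have hfp : Module.FinitePresentation A (MvPowerSeries (Fin N) A ⧸ J) :=
    Module.FinitePresentation.of_localizationSpan s hs fun a => by
      obtain ⟨h₁, h₂, -⟩ := key a
      exact Module.finitePresentation_of_projective _ _
  have hflat : Module.Flat A (MvPowerSeries (Fin N) A ⧸ J) :=
    Module.flat_of_localized_span (S := A) _ s hs fun a => by
      obtain ⟨h₁, h₂, -⟩ := key a
      have : Module.Flat (Localization.Away (a : A))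
        (LocalizedModule.Away (a : A) (MvPowerSeries (Fin N) A ⧸ J)) := Module.Flat.of_projective
      exact Module.Flat.trans A (Localization.Away (a : A)) _
  refine ⟨inferInstance, Module.freeLocus_eq_univ_iff.mp Module.freeLocus_eq_univ, fun P => ?_⟩
  obtain ⟨a, ha, v, hv⟩ := h P
  obtain ⟨e, -⟩ := exists_baseChangeEquiv (B := Localization.Away a) hn
  have h' := (isLocallyFreeOfRank_of_isBasisMod hv).of_equiv e.symm
  obtain ⟨P', hP'⟩ : P ∈ Set.range (PrimeSpectrum.comap (algebraMap A (Localization.Away a))) := by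
    rw [PrimeSpectrum.localization_away_comap_range (Localization.Away a) a]
    exact ha
  have := h'.2.2 P'
  rwa [Module.rankAtStalk_baseChange, hP'] at this

end LocallyFree

end

end CurveSing

namespace CurveSing

noncomputable section

/-! ### Charts -/

/-- The index set of the basis `X^μ`, `μ ∈ i`, `ℓ^r X^ν`, `ν ∈ j`, `r < t - e₀`. -/
abbrev CellIdx (a e₀ t : ℕ) := Fin a ⊕ (Fin e₀ × Fin (t - e₀))

namespace CellIdx

variable {a e₀ t n : ℕ}

/-- The order of vanishing guaranteed for the basis elements `ℓ^r X^ν`. -/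
def level : CellIdx a e₀ t → ℕ
  -- The low monomials get level e₀ although their degrees are smaller: only truncations at t ≥ e₀ +
  -- 1 occur, and each of them keeps these elements.
  | .inl _ => e₀
  | .inr (_, r) => e₀ + r

/-- The inclusion of index sets. -/
def incl (h : t ≤ n) : CellIdx a e₀ t → CellIdx a e₀ n :=
  Sum.map id (Prod.map id (Fin.castLE (Nat.sub_le_sub_right h e₀)))

theorem incl_injective (h : t ≤ n) : Function.Injective (incl (a := a) (e₀ := e₀) h) :=
  Function.Injective.sumMap Function.injective_id
    (Function.injective_id.prodMap (Fin.castLE_injective _))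

theorem level_incl (h : t ≤ n) (b : CellIdx a e₀ t) : (incl h b).level = b.level := by
  rcases b with x | ⟨y, r⟩ <;> rfl

theorem level_lt (b : CellIdx a e₀ t) (ht : e₀ + 1 ≤ t) : b.level < t := by
  rcases b with x | ⟨y, r⟩
  · exact ht
  · have := r.2
    simp only [level]
    omega

theorem le_level_of_notMem_range (h : t ≤ n) {b : CellIdx a e₀ n}
    (hb : b ∉ Set.range (incl (a := a) (e₀ := e₀) h)) : t ≤ b.level := by
  rcases b with x | ⟨y, r⟩
  · exact absurd ⟨.inl x, rfl⟩ hb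
  · by_contra hlt
    simp only [level, not_le] at hlt
    exact hb ⟨.inr (y, ⟨r, by omega⟩), rfl⟩

theorem card (a : ℕ) {e₀ t : ℕ} : Fintype.card (CellIdx a e₀ t) = a + e₀ * (t - e₀) := by
  simp

end CellIdx

/-- The discrete data of a chart. -/
structure Chart (N a e₀ s : ℕ) where
  low : Fin a → lowMon N e₀
  top : Fin e₀ → {μ : lowMon N (e₀ + 1) // (μ : Fin N →₀ ℕ).degree = e₀}
  -- Monomials meant to span the quotient modulo the linear form. Any degree up to e₀ is allowed.
  gen : Fin e₀ → lowMon N (e₀ + 1)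
  form : Fin s

instance (N a e₀ s : ℕ) : Finite (Chart N a e₀ s) :=
  Finite.of_injective (fun c : Chart N a e₀ s => (c.low, c.top, c.gen, c.form)) (by
    rintro ⟨_, _, _, _⟩ ⟨_, _, _, _⟩ h
    simpa using h)

section

variable {k : Type u} [Field k] {N a e₀ s : ℕ}

/-- Extension of coefficients. -/
def base (A : Type u) [CommRing A] [Algebra k A] (f : MvPowerSeries (Fin N) k) :
    MvPowerSeries (Fin N) A :=
  MvPowerSeries.map (algebraMap k A) f

theorem map_base {A B : Type u} [CommRing A] [Algebra k A] [CommRing B] [Algebra k B]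
    (φ : A →ₐ[k] B) (f : MvPowerSeries (Fin N) k) :
    MvPowerSeries.map φ.toRingHom (base A f) = base B f := by
  ext μ
  simp only [base, MvPowerSeries.coeff_map]
  exact φ.commutes _

theorem base_mul (A : Type u) [CommRing A] [Algebra k A] (f g : MvPowerSeries (Fin N) k) :
    base A (f * g) = base A f * base A g := map_mul _ f g

theorem base_mon (A : Type u) [CommRing A] [Algebra k A] (μ : Fin N →₀ ℕ) :
    base A (mon k μ) = mon A μ := map_mon _ μ

theorem base_X (A : Type u) [CommRing A] [Algebra k A] (i : Fin N) :
    base A (MvPowerSeries.X i : MvPowerSeries (Fin N) k) = MvPowerSeries.X i :=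
  MvPowerSeries.map_X _ i

theorem base_mem {A : Type u} [CommRing A] [Algebra k A] {f : MvPowerSeries (Fin N) k} {n : ℕ}
    (h : f ∈ varIdeal N k ^ n) : base A f ∈ varIdeal N A ^ n := by
  have := map_mem_extendIdeal (algebraMap k A) h
  rwa [extendIdeal_varIdeal_pow] at this

theorem sup_pow_sup_pow {A : Type u} [CommRing A] (J : Ideal (MvPowerSeries (Fin N) A)) {t m : ℕ}
    (h : t ≤ m) : J ⊔ varIdeal N A ^ m ⊔ varIdeal N A ^ t = J ⊔ varIdeal N A ^ t := by
  rw [sup_assoc, sup_of_le_right (Ideal.pow_le_pow_right (I := varIdeal N A) h)]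

theorem linForm_mem {A : Type u} [CommRing A] (l : Fin N → A) : linForm l ∈ varIdeal N A :=
  Ideal.sum_mem _ fun i _ => Ideal.mul_mem_left _ _ (Ideal.subset_span ⟨i, rfl⟩)

namespace Chart

variable (c : Chart N a e₀ s) (L : Fin s → Fin N → k)

/-- The linear form of a chart. -/
def ell : MvPowerSeries (Fin N) k := linForm (L c.form)

/-- The elements `X^μ` and `ℓ^r X^ν`. -/
def vec (t : ℕ) : CellIdx a e₀ t → MvPowerSeries (Fin N) k
  | .inl x => mon k (c.low x : Fin N →₀ ℕ)
  | .inr (y, r) => c.ell L ^ (r : ℕ) * mon k ((c.top y : lowMon N (e₀ + 1)) : Fin N →₀ ℕ)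

/-- The elements `ℓ X^μ`, together with generators modulo `ℓ`. -/
def wec : CellIdx a e₀ (e₀ + 1) → MvPowerSeries (Fin N) k
  | .inl x => c.ell L * mon k (c.low x : Fin N →₀ ℕ)
  | .inr (y, _) => mon k (c.gen y : Fin N →₀ ℕ)

theorem vec_incl {t n : ℕ} (h : t ≤ n) (b : CellIdx a e₀ t) :
    c.vec L n (CellIdx.incl h b) = c.vec L t b := by
  rcases b with x | ⟨y, r⟩ <;> rfl

theorem vec_mem {t n : ℕ} (ht : e₀ + 1 ≤ t) {b : CellIdx a e₀ n} (h : t ≤ b.level) :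
    c.vec L n b ∈ varIdeal N k ^ t := by
  rcases b with x | ⟨y, r⟩
  · simp only [CellIdx.level] at h
    omega
  · refine Ideal.pow_le_pow_right h ?_
    simp only [CellIdx.level, vec]
    rw [add_comm, pow_add]
    exact Ideal.mul_mem_mul (Ideal.pow_mem_pow (linForm_mem _) _) (mon_mem _ (c.top y).2.ge)

/-- Discarding the basis elements of high order. -/
theorem sum_vec_sub_mem {A : Type u} [CommRing A] [Algebra k A] {t n : ℕ} (ht : e₀ + 1 ≤ t)
    (h : t ≤ n) (d : CellIdx a e₀ n → A) :
    ∑ b, d b • base A (c.vec L n b) -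
      ∑ b, d (CellIdx.incl h b) • base A (c.vec L t b) ∈ varIdeal N A ^ t := by
  rw [← mkLin_eq_zero, map_sub, sub_eq_zero, map_sum, map_sum]
  refine (Fintype.sum_of_injective (CellIdx.incl h) (CellIdx.incl_injective h) _ _ ?_ ?_).symm
  · intro b hb
    rw [map_smul, mkLin_eq_zero.mpr (base_mem (c.vec_mem L ht
      (CellIdx.le_level_of_notMem_range h hb))), smul_zero]
  · intro b
    rw [vec_incl]

/-- The ideal `J` belongs to the chart `c`. -/
structure Mem (n : ℕ) (A : Type u) [CommRing A] [Algebra k A]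
    (J : Ideal (MvPowerSeries (Fin N) A)) : Prop where
  le : varIdeal N A ^ n ≤ J
  -- Every order t is included, so that charts are stable under truncation.
  vec : ∀ t, e₀ + 1 ≤ t → t ≤ n →
    IsBasisMod (J ⊔ varIdeal N A ^ t) fun b => base A (c.vec L t b)
  -- The form of `InU` suitable for charts: modulo ℓ only the e₀ monomials `gen` survive, and being
  -- a basis is a determinant condition.
  wec : IsBasisMod (J ⊔ varIdeal N A ^ (e₀ + 1)) fun b => base A (c.wec L b)

variable {c L} {n : ℕ} {A B : Type u} [CommRing A] [Algebra k A] [CommRing B] [Algebra k B]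

theorem Mem.extend (φ : A →ₐ[k] B) {J : Ideal (MvPowerSeries (Fin N) A)} (h : c.Mem L n A J) :
    c.Mem L n B (extendIdeal φ.toRingHom J) where
  le := varIdeal_pow_le_extendIdeal _ h.le
  vec t ht htn := by
    have := (h.vec t ht htn).extend φ.toRingHom le_sup_right
    rw [extendIdeal_sup_pow] at this
    simpa only [map_base] using this
  wec := by
    have := h.wec.extend φ.toRingHom le_sup_right
    rw [extendIdeal_sup_pow] at this
    simpa only [map_base] using this

theorem Mem.trunc {J : Ideal (MvPowerSeries (Fin N) A)} (h : c.Mem L n A J) {m : ℕ}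
    (hm : e₀ + 1 ≤ m) (hmn : m ≤ n) : c.Mem L m A (J ⊔ varIdeal N A ^ m) where
  le := le_sup_right
  vec t ht htm := by
    rw [sup_pow_sup_pow J htm]
    exact h.vec t ht (htm.trans hmn)
  wec := by
    rw [sup_pow_sup_pow J hm]
    exact h.wec

/-- Inside a chart, the other charts are basic open subsets. -/
theorem Mem.exists_isUnit_iff {J : Ideal (MvPowerSeries (Fin N) A)} (h : c.Mem L n A J)
    (c' : Chart N a e₀ s) (hn : e₀ + 1 ≤ n) :
    ∃ d : A, ∀ (B : Type u) [CommRing B] [Algebra k B] (φ : A →ₐ[k] B),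
      c'.Mem L n B (extendIdeal φ.toRingHom J) ↔ IsUnit (φ d) := by
  have h₁ : ∀ t : Finset.Icc (e₀ + 1) n, ∃ d : A, ∀ (B : Type u) [CommRing B] [Algebra k B]
      (φ : A →ₐ[k] B), IsBasisMod (extendIdeal φ.toRingHom J ⊔ varIdeal N B ^ (t : ℕ))
        (fun b => base B (c'.vec L t b)) ↔ IsUnit (φ d) := by
    rintro ⟨t, ht⟩
    obtain ⟨ht₁, ht₂⟩ := Finset.mem_Icc.mp ht
    obtain ⟨d, hd⟩ := (h.vec t ht₁ ht₂).exists_isUnit_iff le_sup_right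
      fun b => base A (c'.vec L t b)
    refine ⟨d, fun B _ _ φ => ?_⟩
    have := hd B φ.toRingHom
    rw [extendIdeal_sup_pow] at this
    simp only [map_base] at this
    exact this
  choose d hd using h₁
  obtain ⟨d', hd'⟩ := (h.vec (e₀ + 1) le_rfl hn).exists_isUnit_iff le_sup_right
      fun b => base A (c'.wec L b)
  refine ⟨d' * ∏ t, d t, fun B _ _ φ => ?_⟩
  have hw := hd' B φ.toRingHom
  rw [extendIdeal_sup_pow] at hw
  simp only [map_base] at hw
  rw [map_mul, IsUnit.mul_iff, map_prod]
  have hprod : IsUnit (∏ t, φ (d t)) ↔ ∀ t, IsUnit (φ (d t)) := by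
    simp
  rw [hprod]
  constructor
  · intro hm
    exact ⟨hw.mp hm.wec, fun t => (hd t B φ).mp
      (hm.vec t (Finset.mem_Icc.mp t.2).1 (Finset.mem_Icc.mp t.2).2)⟩
  · rintro ⟨hu, hv⟩
    exact ⟨varIdeal_pow_le_extendIdeal _ h.le,
      fun t ht htn => (hd ⟨t, Finset.mem_Icc.mpr ⟨ht, htn⟩⟩ B φ).mpr (hv _), hw.mpr hu⟩

end Chart

end

end

end CurveSing

namespace CurveSing

noncomputable section

/-! ### Equations of the charts -/

namespace Chart

variable {k : Type u} [Field k] {N a e₀ s : ℕ} (c : Chart N a e₀ s) (L : Fin s → Fin N → k)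
  {n : ℕ}

/-- The matrix of the elements `c.wec` in truncated coordinates. -/
def wecMatrix (hn : e₀ + 1 ≤ n) {A : Type u} [CommRing A] [Algebra k A]
    (y : (Fin N →₀ ℕ) → CellIdx a e₀ n → A) :
    Matrix (CellIdx a e₀ (e₀ + 1)) (CellIdx a e₀ (e₀ + 1)) A :=
  Matrix.of fun b b' => ofCoord n y (base A (c.wec L b')) (CellIdx.incl hn b)

/-- The equations for the coordinates of the monomials with respect to the basis `c.vec`. -/
structure IsSol (hn : e₀ + 1 ≤ n) {A : Type u} [CommRing A] [Algebra k A]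
    (y : (Fin N →₀ ℕ) → CellIdx a e₀ n → A) (z : A) : Prop where
  single : ∀ b b', ofCoord n y (base A (c.vec L n b)) b' =
    algebraMap k A ((Pi.single b 1 : CellIdx a e₀ n → k) b')
  -- This makes the kernel of the coordinate map stable under multiplication by the variables.
  mul : ∀ i (μ : Fin N →₀ ℕ) b', μ.degree < n →
    ofCoord n y (base A (MvPowerSeries.X i * mon k μ)) b' =
      ∑ b, y μ b * ofCoord n y (base A (MvPowerSeries.X i * c.vec L n b)) b'
  -- Triangularity with respect to degree: dropping the coordinates of high level then gives the
  -- coordinates modulo (X)^t.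
  low : ∀ (μ : Fin N →₀ ℕ) (b : CellIdx a e₀ n), μ.degree < n → b.level < μ.degree → y μ b = 0
  -- The extra unknown z inverts the determinant, turning an open condition into an equation.
  det : z * (c.wecMatrix L hn y).det = 1

variable {c L} {hn : e₀ + 1 ≤ n} {A B : Type u} [CommRing A] [Algebra k A] [CommRing B]
  [Algebra k B] {y : (Fin N →₀ ℕ) → CellIdx a e₀ n → A}

theorem ofCoord_base (φ : A →ₐ[k] B) (y : (Fin N →₀ ℕ) → CellIdx a e₀ n → A)
    (f : MvPowerSeries (Fin N) k) (b : CellIdx a e₀ n) :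
    ofCoord n (fun μ b => φ (y μ b)) (base B f) b = φ (ofCoord n y (base A f) b) := by
  rw [← map_base φ]
  exact ofCoord_map n φ.toRingHom y _ b

theorem wecMatrix_map (φ : A →ₐ[k] B) (y : (Fin N →₀ ℕ) → CellIdx a e₀ n → A) :
    (c.wecMatrix L hn fun μ b => φ (y μ b)).det = φ (c.wecMatrix L hn y).det := by
  rw [AlgHom.map_det]
  congr 1
  ext b b'
  exact ofCoord_base φ y _ _

theorem single_iff : (∀ b b', ofCoord n y (base A (c.vec L n b)) b' =
    algebraMap k A ((Pi.single b 1 : CellIdx a e₀ n → k) b')) ↔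
      ∀ b, ofCoord n y (base A (c.vec L n b)) = Pi.single b 1 := by
  refine forall_congr' fun b => ?_
  rw [funext_iff]
  refine forall_congr' fun b' => ?_
  simp only [Pi.single_apply, apply_ite (algebraMap k A), map_one, map_zero]

/-- Truncated coordinates compute the quotients by `(X)^t`. -/
theorem trunc_coord {J : Ideal (MvPowerSeries (Fin N) A)}
    (hJ : ∀ f, ofCoord n y f = 0 ↔ f ∈ J)
    (hv : ∀ b, ofCoord n y (base A (c.vec L n b)) = Pi.single b 1)
    (hlow : ∀ (μ : Fin N →₀ ℕ) (b : CellIdx a e₀ n), μ.degree < n → b.level < μ.degree →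
      y μ b = 0) {t : ℕ} (ht : e₀ + 1 ≤ t) (htn : t ≤ n) :
    (∀ f, (LinearMap.funLeft A A (CellIdx.incl htn)) (ofCoord n y f) = 0 ↔
      f ∈ J ⊔ varIdeal N A ^ t) ∧
    ∀ b, (LinearMap.funLeft A A (CellIdx.incl htn)) (ofCoord n y (base A (c.vec L t b))) =
      Pi.single b 1 := by
  refine ⟨fun f => ⟨fun h => ?_, fun h => ?_⟩, fun b => ?_⟩
  · have h₁ := sub_coord_mem hJ hv f
    have h₂ := c.sum_vec_sub_mem L ht htn (ofCoord n y f)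
    have h₃ : ∀ b, ofCoord n y f (CellIdx.incl htn b) = 0 := fun b => congrFun h b
    simp only [h₃, zero_smul, Finset.sum_const_zero, sub_zero] at h₂
    have := Ideal.add_mem _ (Ideal.mem_sup_left h₁) (Ideal.mem_sup_right (S := J) h₂)
    rwa [sub_add_cancel] at this
  · obtain ⟨g, hg, g', hg', rfl⟩ := Submodule.mem_sup.mp h
    rw [map_add, (hJ g).mpr hg, zero_add]
    ext b
    rw [LinearMap.funLeft_apply, ofCoord_apply]
    refine Finset.sum_eq_zero fun μ hμ => ?_
    by_cases hμt : μ.degree < t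
    · rw [mem_varIdeal_pow.mp hg' μ hμt, zero_mul]
    · rw [hlow μ _ (mem_lowMon.mp hμ) ?_, mul_zero]
      rw [CellIdx.level_incl]
      exact (b.level_lt ht).trans_le (not_lt.mp hμt)
  · rw [← c.vec_incl L htn, hv]
    ext b'
    simp [LinearMap.funLeft_apply, Pi.single_apply, (CellIdx.incl_injective htn).eq_iff]

/-- The ideal is the kernel of the coordinate map. The equations `mul` are an identity of linear
maps checked on monomials; they make the kernel stable under each X_i, then under monomials, and
finally under all series because (X)^n is killed. -/
theorem IsSol.exists_mem {z : A} (h : c.IsSol L hn y z) :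
    ∃ J, (∀ f, ofCoord n y f = 0 ↔ f ∈ J) ∧ c.Mem L n A J := by
  have hX : ∀ i f, ofCoord n y f = 0 → ofCoord n y (MvPowerSeries.X i * f) = 0 := by
    intro i f hf
    have key : ∀ b', ofCoord n y (MvPowerSeries.X i * f) b' =
        ∑ b, ofCoord n y f b * ofCoord n y (base A (MvPowerSeries.X i * c.vec L n b)) b' := by
      intro b'
      let p : MvPowerSeries (Fin N) A →ₗ[A] A :=
        LinearMap.proj b' ∘ₗ ofCoord n y ∘ₗ LinearMap.mulLeft A (MvPowerSeries.X i)
      let p' : MvPowerSeries (Fin N) A →ₗ[A] A :=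
        (∑ b, (LinearMap.proj b).smulRight
          (ofCoord n y (base A (MvPowerSeries.X i * c.vec L n b)) b')) ∘ₗ ofCoord n y
      have hp' : ∀ f, p' f =
          ∑ b, ofCoord n y f b * ofCoord n y (base A (MvPowerSeries.X i * c.vec L n b)) b' := by
        intro f
        simp [p', LinearMap.sum_apply]
      rw [← hp']
      refine LinearMap.congr_fun (linearMap_ext_of_trunc n (π := p) (π' := p') ?_ ?_ ?_) f
      · intro f hf
        change ofCoord n y (MvPowerSeries.X i * f) b' = 0
        rw [ofCoord_of_mem y (Ideal.mul_mem_left _ _ hf), Pi.zero_apply]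
      · intro f hf
        rw [hp', ofCoord_of_mem y hf]
        simp
      · intro μ hμ
        rw [hp', ofCoord_mon y hμ, ← h.mul i μ b' hμ]
        change ofCoord n y (MvPowerSeries.X i * mon A μ) b' = _
        rw [base_mul, base_mon, base_X]
    ext b'
    rw [key, hf]
    simp
  have hmon : ∀ (μ : Fin N →₀ ℕ) f, ofCoord n y f = 0 → ofCoord n y (mon A μ * f) = 0 := by
    intro μ
    induction μ using Finsupp.induction_linear with
    | zero =>
      intro f hf
      have : mon A (0 : Fin N →₀ ℕ) = 1 := rfl
      rwa [this, one_mul]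
    | add μ ν hμ hν =>
      intro f hf
      rw [← mon_mul, mul_assoc]
      exact hμ _ (hν _ hf)
    | single i m =>
      intro f hf
      have : mon A (Finsupp.single i m) = MvPowerSeries.X i ^ m := (MvPowerSeries.X_pow_eq i m).symm
      rw [this]
      induction m with
      | zero => simpa using hf
      | succ m ih =>
        rw [pow_succ', mul_assoc]
        exact hX _ _ (ih (MvPowerSeries.X_pow_eq i m).symm)
  let J : Ideal (MvPowerSeries (Fin N) A) :=
    { carrier := {f | ofCoord n y f = 0}
      add_mem' := fun {f g} hf hg => by
        change ofCoord n y (f + g) = 0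
        rw [map_add, show ofCoord n y f = 0 from hf, show ofCoord n y g = 0 from hg, add_zero]
      zero_mem' := map_zero _
      smul_mem' := fun g f hf => mem_of_mon_mem
        (LinearMap.ker (ofCoord n y ∘ₗ LinearMap.mulRight A f)) n
        (fun g hg => ofCoord_of_mem y (Ideal.mul_mem_right _ _ hg)) (fun μ _ => hmon μ f hf) g }
  have hJ : ∀ f, ofCoord n y f = 0 ↔ f ∈ J := fun f => Iff.rfl
  have hv := single_iff.mp h.single
  refine ⟨J, hJ, fun f hf => ofCoord_of_mem y hf, fun t ht htn => ?_, ?_⟩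
  · obtain ⟨h₁, h₂⟩ := trunc_coord hJ hv h.low ht htn
    exact ⟨LinearMap.funLeft A A (CellIdx.incl htn) ∘ₗ ofCoord n y, h₁, h₂⟩
  · obtain ⟨h₁, h₂⟩ := trunc_coord hJ hv h.low le_rfl hn
    refine (isBasisMod_iff_det (π := LinearMap.funLeft A A (CellIdx.incl hn) ∘ₗ ofCoord n y)
      h₁ h₂ _).mpr ?_
    exact IsUnit.of_mul_eq_one z ((mul_comm _ _).trans h.det)

theorem Mem.exists_isSol {J : Ideal (MvPowerSeries (Fin N) A)} (h : c.Mem L n A J)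
    (hn : e₀ + 1 ≤ n) : ∃ y z, c.IsSol L hn y z ∧ ∀ f, ofCoord n y f = 0 ↔ f ∈ J := by
  have hb := h.vec n hn le_rfl
  rw [sup_eq_left.mpr h.le] at hb
  obtain ⟨y, hJ, hv⟩ := hb.exists_ofCoord h.le
  -- The coordinate at b is examined modulo (X)^(b.level + 1), where X^μ is already zero while b
  -- still indexes a basis element.
  have hlow : ∀ (μ : Fin N →₀ ℕ) (b : CellIdx a e₀ n), μ.degree < n → b.level < μ.degree →
      y μ b = 0 := by
    intro μ b hμ hlt
    have hbl := b.level_lt hn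
    have ht : e₀ + 1 ≤ b.level + 1 := by
      rcases b with x | ⟨y, r⟩ <;> simp only [CellIdx.level] <;> omega
    have htn : b.level + 1 ≤ n := hbl
    obtain ⟨b', hb'⟩ : b ∈ Set.range (CellIdx.incl (a := a) (e₀ := e₀) htn) := by
      by_contra hb
      have := CellIdx.le_level_of_notMem_range htn hb
      omega
    have h₁ := sub_coord_mem hJ hv (mon A μ)
    have h₂ := c.sum_vec_sub_mem L ht htn (ofCoord n y (mon A μ))
    have h₃ : ∑ b', ofCoord n y (mon A μ) (CellIdx.incl htn b') •
        base A (c.vec L (b.level + 1) b') ∈ J ⊔ varIdeal N A ^ (b.level + 1) := by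
      have := Ideal.sub_mem _ (Ideal.mem_sup_right (S := J) (mon_mem (A := A) μ hlt))
        (Ideal.add_mem _ (Ideal.mem_sup_left h₁) (Ideal.mem_sup_right (S := J) h₂))
      rwa [sub_add_sub_cancel, sub_sub_cancel] at this
    have := congrFun ((isBasisMod_iff.mp (h.vec _ ht htn)).2 _ h₃) b'
    simp only [hb', ofCoord_mon y hμ] at this
    exact this
  obtain ⟨h₁, h₂⟩ := trunc_coord hJ hv hlow le_rfl hn
  have hdet := (isBasisMod_iff_det (π := LinearMap.funLeft A A (CellIdx.incl hn) ∘ₗ ofCoord n y)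
      h₁ h₂ _).mp h.wec
  obtain ⟨z, hz⟩ := hdet.exists_left_inv
  refine ⟨y, z, ⟨single_iff.mpr hv, fun i μ b' hμ => ?_, hlow, hz⟩, hJ⟩
  have h₃ := J.mul_mem_left (MvPowerSeries.X i) (sub_coord_mem hJ hv (mon A μ))
  rw [← hJ, mul_sub, map_sub, sub_eq_zero, Finset.mul_sum, map_sum, ofCoord_mon y hμ] at h₃
  rw [base_mul, base_mon, base_X, h₃, Finset.sum_apply]
  refine Finset.sum_congr rfl fun b _ => ?_
  rw [mul_smul_comm, map_smul, base_mul, base_X]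
  rfl

/-- Gives uniqueness of classifying maps. Only degrees < n are compared, as `ofCoord n` reads no
other values of y. -/
theorem IsSol.unique {y' : (Fin N →₀ ℕ) → CellIdx a e₀ n → A} {z z' : A}
    (h : c.IsSol L hn y z) (h' : c.IsSol L hn y' z')
    (e : ∀ f, ofCoord n y f = 0 ↔ ofCoord n y' f = 0) :
    (∀ μ : Fin N →₀ ℕ, μ.degree < n → y μ = y' μ) ∧ z = z' := by
  obtain ⟨J, hJ, -⟩ := h.exists_mem
  have he : ofCoord n y = ofCoord n y' := by
    ext1 f
    have := sub_coord_mem hJ (single_iff.mp h.single) f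
    rw [← hJ, e, map_sub, coord_sum (single_iff.mp h'.single), sub_eq_zero] at this
    exact this.symm
  refine ⟨fun μ hμ => by rw [← ofCoord_mon y hμ, he, ofCoord_mon y' hμ], ?_⟩
  have h₁ := h.det
  have h₂ := h'.det
  rw [wecMatrix, ← he] at h₂
  change z' * (c.wecMatrix L hn y).det = 1 at h₂
  calc z = z * (z' * (c.wecMatrix L hn y).det) := by rw [h₂, mul_one]
    _ = z' * (z * (c.wecMatrix L hn y).det) := by ring
    _ = z' := by rw [h₁, mul_one]

theorem IsSol.map {z : A} (h : c.IsSol L hn y z) (φ : A →ₐ[k] B) :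
    c.IsSol L hn (fun μ b => φ (y μ b)) (φ z) where
  single b b' := by rw [ofCoord_base, h.single, AlgHom.commutes]
  mul i μ b' hμ := by
    simp only [ofCoord_base, h.mul i μ b' hμ, map_sum, map_mul]
  low μ b hμ hl := by rw [h.low μ b hμ hl, map_zero]
  det := by rw [wecMatrix_map, ← map_mul, h.det, map_one]

/-- The unknowns. -/
abbrev Unknown (N a e₀ n : ℕ) : Type u := ULift.{u} (lowMon N n × CellIdx a e₀ n ⊕ Unit)

/-- The coordinates determined by values of the unknowns. -/
def coordOf (w : Unknown.{u} N a e₀ n → A) (μ : Fin N →₀ ℕ) (b : CellIdx a e₀ n) : A :=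
  if h : μ ∈ lowMon N n then w ⟨.inl (⟨μ, h⟩, b)⟩ else 0

theorem coordOf_map (φ : A →ₐ[k] B) (w : Unknown.{u} N a e₀ n → A) :
    coordOf (fun i => φ (w i)) = fun μ b => φ (coordOf w μ b) := by
  funext μ b
  simp only [coordOf]
  split_ifs <;> simp

variable (c L hn) in
/-- The equations of a chart. -/
def equations : Set (MvPolynomial (Unknown.{u} N a e₀ n) k) :=
  let Y := coordOf (A := MvPolynomial (Unknown.{u} N a e₀ n) k) MvPolynomial.X
  {p | (∃ b b', p = ofCoord n Y (base _ (c.vec L n b)) b' -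
      algebraMap k _ ((Pi.single b 1 : CellIdx a e₀ n → k) b')) ∨
    (∃ i, ∃ μ : Fin N →₀ ℕ, ∃ b', μ.degree < n ∧
      p = ofCoord n Y (base _ (MvPowerSeries.X i * mon k μ)) b' -
        ∑ b, Y μ b * ofCoord n Y (base _ (MvPowerSeries.X i * c.vec L n b)) b') ∨
    (∃ (μ : Fin N →₀ ℕ) (b : CellIdx a e₀ n), μ.degree < n ∧ b.level < μ.degree ∧ p = Y μ b) ∨
    p = MvPolynomial.X ⟨.inr ()⟩ * (c.wecMatrix L hn Y).det - 1}

theorem isSol_iff (w : Unknown.{u} N a e₀ n → A) :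
    c.IsSol L hn (coordOf w) (w ⟨.inr ()⟩) ↔
      ∀ p ∈ equations c L hn, MvPolynomial.aeval w p = 0 := by
  set P := MvPolynomial (Unknown.{u} N a e₀ n) k
  set Y := coordOf (A := P) MvPolynomial.X
  let φ : P →ₐ[k] A := MvPolynomial.aeval w
  have hY : coordOf w = fun μ b => φ (Y μ b) := by
    rw [← coordOf_map]
    exact congrArg coordOf (funext fun i => (MvPolynomial.aeval_X w i).symm)
  have hz : w ⟨.inr ()⟩ = φ (MvPolynomial.X ⟨.inr ()⟩) := (MvPolynomial.aeval_X w _).symm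
  rw [hY, hz]
  constructor
  · rintro ⟨h₁, h₂, h₃, h₄⟩ p (⟨b, b', rfl⟩ | ⟨i, μ, b', hμ, rfl⟩ | ⟨μ, b, hμ, hb, rfl⟩ | rfl)
    · change φ _ = 0
      rw [map_sub, AlgHom.commutes, ← ofCoord_base, h₁, sub_self]
    · change φ _ = 0
      rw [map_sub, ← ofCoord_base, h₂ i μ b' hμ, sub_eq_zero, map_sum]
      simp only [map_mul, ofCoord_base]
      rfl
    · exact h₃ μ b hμ hb
    · change φ _ = 0
      rw [map_sub, map_mul, ← wecMatrix_map, h₄, map_one, sub_self]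
  · intro h
    refine ⟨fun b b' => ?_, fun i μ b' hμ => ?_, fun μ b hμ hb => ?_, ?_⟩
    · have : φ _ = 0 := h _ (Or.inl ⟨b, b', rfl⟩)
      rwa [map_sub, AlgHom.commutes, ← ofCoord_base, sub_eq_zero] at this
    · have : φ _ = 0 := h _ (Or.inr (Or.inl ⟨i, μ, b', hμ, rfl⟩))
      rw [map_sub, ← ofCoord_base, sub_eq_zero, map_sum] at this
      simp only [map_mul] at this
      refine this.trans (Finset.sum_congr rfl fun b _ => ?_)
      rw [ofCoord_base]
    · exact h _ (Or.inr (Or.inr (Or.inl ⟨μ, b, hμ, hb, rfl⟩)))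
    · have : φ _ = 0 := h _ (Or.inr (Or.inr (Or.inr rfl)))
      rwa [map_sub, map_mul, ← wecMatrix_map, map_one, sub_eq_zero] at this

variable (c L) in
/-- Each chart is represented by a `k`-algebra of finite type. -/
theorem exists_universal (hn : e₀ + 1 ≤ n) :
    ∃ (R : Type u) (_ : CommRing R) (_ : Algebra k R) (J : Ideal (MvPowerSeries (Fin N) R)),
      Algebra.FiniteType k R ∧ c.Mem L n R J ∧
      (∀ (A : Type u) [CommRing A] [Algebra k A] (I : Ideal (MvPowerSeries (Fin N) A)),
        c.Mem L n A I → ∃ h : R →ₐ[k] A, extendIdeal h.toRingHom J = I) ∧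
      ∀ (A : Type u) [CommRing A] [Algebra k A] (h h' : R →ₐ[k] A),
        extendIdeal h.toRingHom J = extendIdeal h'.toRingHom J → h = h' := by
  let P := MvPolynomial (Unknown.{u} N a e₀ n) k
  let R := P ⧸ Ideal.span (equations c L hn)
  let q : P →ₐ[k] R := Ideal.Quotient.mkₐ k _
  let w : Unknown.{u} N a e₀ n → R := fun i => q (MvPolynomial.X i)
  have hsol : c.IsSol L hn (coordOf w) (w ⟨.inr ()⟩) := by
    rw [isSol_iff]
    intro p hp
    have : MvPolynomial.aeval (R := k) w = q := by
      ext i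
      simp [w]
    rw [this]
    exact Ideal.Quotient.eq_zero_iff_mem.mpr (Ideal.subset_span hp)
  obtain ⟨J, hJ, hmem⟩ := hsol.exists_mem
  have hext : ∀ (A : Type u) [CommRing A] [Algebra k A] (h : R →ₐ[k] A) f,
      ofCoord n (coordOf fun i => h (w i)) f = 0 ↔ f ∈ extendIdeal h.toRingHom J := by
    intro A _ _ h f
    rw [coordOf_map]
    exact ofCoord_extend_eq_zero_iff h.toRingHom hJ (single_iff.mp hsol.single) f
  refine ⟨R, inferInstance, inferInstance, J, ?_, hmem, fun A _ _ I hI => ?_,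
    fun A _ _ h h' e => ?_⟩
  · exact Algebra.FiniteType.of_surjective q (Ideal.Quotient.mkₐ_surjective k _)
  · obtain ⟨y, z, hyz, hI'⟩ := hI.exists_isSol hn
    let w' : Unknown.{u} N a e₀ n → A := fun i => Sum.elim (fun p => y p.1 p.2) (fun _ => z) i.down
    have hc : ∀ f, ofCoord n (coordOf w') f = ofCoord n y f := by
      intro f
      ext b
      rw [ofCoord_apply, ofCoord_apply]
      refine Finset.sum_congr rfl fun μ hμ => ?_
      rw [coordOf, dif_pos hμ]
      rfl
    have hs : c.IsSol L hn (coordOf w') (w' ⟨.inr ()⟩) := by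
      have hcy : ∀ (μ : Fin N →₀ ℕ) b, μ.degree < n → coordOf w' μ b = y μ b := by
        intro μ b hμ
        rw [coordOf, dif_pos (mem_lowMon.mpr hμ)]
        rfl
      refine ⟨fun b b' => ?_, fun i μ b' hμ => ?_, fun μ b hμ hb => ?_, ?_⟩
      · rw [hc, hyz.single]
      · simp only [hc, hyz.mul i μ b' hμ, hcy μ _ hμ]
      · rw [hcy μ b hμ, hyz.low μ b hμ hb]
      · have : c.wecMatrix L hn (coordOf w') = c.wecMatrix L hn y := by
          ext b b'
          simp only [wecMatrix, Matrix.of_apply, hc]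
        rw [this]
        exact hyz.det
    obtain ⟨h, hh⟩ := AlgFunctor.exists_hom_quotient_iff (equations c L hn) w'
      ((isSol_iff w').mp hs)
    refine ⟨h, ?_⟩
    ext f
    have hw : (fun i => h (w i)) = w' := funext hh
    rw [← hext, hw, hc, hI']
  · refine AlgFunctor.quotient_hom_ext fun i => ?_
    change h (w i) = h' (w i)
    have hs := hsol.map h
    have hs' := hsol.map h'
    rw [← coordOf_map] at hs hs'
    obtain ⟨h₁, h₂⟩ := hs.unique hs' fun f => by rw [hext, hext, e]
    rcases i with ⟨⟨μ, b⟩ | x⟩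
    · have := congrFun (h₁ μ (mem_lowMon.mp μ.2)) b
      rwa [coordOf, coordOf, dif_pos μ.2, dif_pos μ.2] at this
    · exact h₂

end Chart

end

end CurveSing

namespace CurveSing

noncomputable section

/-! ### Dimension counts over a field -/

section Field

variable {N : ℕ} {K : Type u} [Field K]

theorem finrank_le_of_le {n : ℕ} {J J' : Ideal (MvPowerSeries (Fin N) K)}
    (hn : varIdeal N K ^ n ≤ J) (h : J ≤ J') :
    Module.finrank K (MvPowerSeries (Fin N) K ⧸ J') ≤
      Module.finrank K (MvPowerSeries (Fin N) K ⧸ J) := by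
  have := moduleFinite_quotient hn
  obtain ⟨ρ, hρ⟩ := exists_lift_mkLin (J := J) (mkLin J') fun f hf => mkLin_eq_zero.mpr (h hf)
  refine LinearMap.finrank_le_finrank_of_surjective (f := ρ) fun x => ?_
  obtain ⟨f, rfl⟩ := mkLin_surjective J' x
  exact ⟨_, hρ f⟩

theorem le_of_finrank_le {n : ℕ} {J J' : Ideal (MvPowerSeries (Fin N) K)}
    (hn : varIdeal N K ^ n ≤ J) (h : J ≤ J')
    (hr : Module.finrank K (MvPowerSeries (Fin N) K ⧸ J) ≤
      Module.finrank K (MvPowerSeries (Fin N) K ⧸ J')) : J' ≤ J := by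
  have := moduleFinite_quotient hn
  have := moduleFinite_quotient (hn.trans h)
  obtain ⟨ρ, hρ⟩ := exists_lift_mkLin (J := J) (mkLin J') fun f hf => mkLin_eq_zero.mpr (h hf)
  have hsurj : Function.Surjective ρ := fun x => by
    obtain ⟨f, rfl⟩ := mkLin_surjective J' x
    exact ⟨_, hρ f⟩
  have hinj := (LinearMap.injective_iff_surjective_of_finrank_eq_finrank
    (le_antisymm hr (finrank_le_of_le hn h))).mpr hsurj
  intro f hf
  rw [← mkLin_eq_zero]
  apply hinj
  rw [hρ, map_zero, mkLin_eq_zero]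
  exact hf

/-- Multiplication by `ℓ` from `K[[X]] / J'` to `K[[X]] / J`. -/
theorem finrank_mul {n : ℕ} {J J' : Ideal (MvPowerSeries (Fin N) K)}
    (hn : varIdeal N K ^ n ≤ J) (hn' : varIdeal N K ^ n ≤ J')
    (ℓ : MvPowerSeries (Fin N) K) (h : ∀ f ∈ J', ℓ * f ∈ J) :
    Module.finrank K (MvPowerSeries (Fin N) K ⧸ J) ≤
      Module.finrank K (MvPowerSeries (Fin N) K ⧸ J') +
        Module.finrank K (MvPowerSeries (Fin N) K ⧸ (J ⊔ Ideal.span {ℓ})) ∧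
    (Module.finrank K (MvPowerSeries (Fin N) K ⧸ J) =
      Module.finrank K (MvPowerSeries (Fin N) K ⧸ J') +
        Module.finrank K (MvPowerSeries (Fin N) K ⧸ (J ⊔ Ideal.span {ℓ})) ↔
      ∀ f, ℓ * f ∈ J → f ∈ J') := by
  have := moduleFinite_quotient hn
  have := moduleFinite_quotient hn'
  obtain ⟨g, hg⟩ := exists_lift_mkLin (J := J') (mkLin J ∘ₗ LinearMap.mulLeft K ℓ)
    fun f hf => mkLin_eq_zero.mpr (h f hf)
  obtain ⟨p, hp⟩ := exists_lift_mkLin (J := J) (mkLin (J ⊔ Ideal.span {ℓ}))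
    fun f hf => mkLin_eq_zero.mpr (Ideal.mem_sup_left hf)
  have hpsurj : LinearMap.range p = ⊤ := LinearMap.range_eq_top.mpr fun x => by
    obtain ⟨f, rfl⟩ := mkLin_surjective _ x
    exact ⟨_, hp f⟩
  -- The sequence K[[X]]/J' → K[[X]]/J → K[[X]]/(J + (ℓ)) → 0 is exact, and both assertions are rank
  -- counts in it.
  have hker : LinearMap.ker p = LinearMap.range g := by
    ext x
    obtain ⟨f, rfl⟩ := mkLin_surjective _ x
    rw [LinearMap.mem_ker, hp, mkLin_eq_zero, Submodule.mem_sup]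
    constructor
    · rintro ⟨u, hu, w, hw, rfl⟩
      obtain ⟨r, rfl⟩ := Ideal.mem_span_singleton'.mp hw
      refine ⟨mkLin J' r, ?_⟩
      rw [hg, map_add, mkLin_eq_zero.mpr hu, zero_add, mul_comm]
      rfl
    · rintro ⟨y, hy⟩
      obtain ⟨r, rfl⟩ := mkLin_surjective _ y
      rw [hg] at hy
      refine ⟨f - ℓ * r, ?_, ℓ * r, Ideal.mul_mem_right _ _ (Ideal.mem_span_singleton_self ℓ), by
        ring⟩
      rw [← mkLin_eq_zero, map_sub, ← hy]
      exact sub_self _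
  have h₁ := LinearMap.finrank_range_add_finrank_ker p
  have h₂ := LinearMap.finrank_range_add_finrank_ker g
  rw [hpsurj, finrank_top, hker] at h₁
  have h₃ : (∀ f, ℓ * f ∈ J → f ∈ J') ↔ Module.finrank K (LinearMap.ker g) = 0 := by
    rw [Submodule.finrank_eq_zero, LinearMap.ker_eq_bot']
    constructor
    · intro hf x hx
      obtain ⟨f, rfl⟩ := mkLin_surjective _ x
      rw [hg] at hx
      exact mkLin_eq_zero.mpr (hf f (mkLin_eq_zero.mp hx))
    · intro hf f hx
      exact mkLin_eq_zero.mp (hf _ ((hg f).trans (mkLin_eq_zero.mpr hx)))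
  rw [h₃]
  constructor
  · omega
  · constructor <;> omega

theorem finrank_le_card_of_isSpanMod {β : Type*} [Fintype β] {J : Ideal (MvPowerSeries (Fin N) K)}
    {v : β → MvPowerSeries (Fin N) K} (h : IsSpanMod J v) :
    Module.finrank K (MvPowerSeries (Fin N) K ⧸ J) ≤ Fintype.card β := by
  have := LinearMap.finrank_le_finrank_of_surjective (isSpanMod_iff_surjective.mp h)
  rwa [Module.finrank_pi] at this

theorem finrank_eq_card_of_isBasisMod {β : Type*} [Fintype β] [DecidableEq β]
    {J : Ideal (MvPowerSeries (Fin N) K)}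
    {v : β → MvPowerSeries (Fin N) K} (h : IsBasisMod J v) :
    Module.finrank K (MvPowerSeries (Fin N) K ⧸ J) = Fintype.card β := by
  have := (LinearEquiv.ofBijective _ (isBasisMod_iff_bijective.mp h)).finrank_eq
  rw [Module.finrank_pi] at this
  exact this.symm

theorem IsSpanMod.isBasisMod_of_finrank {β : Type*} [Fintype β] [DecidableEq β] {n : ℕ}
    {J : Ideal (MvPowerSeries (Fin N) K)} (hn : varIdeal N K ^ n ≤ J)
    {v : β → MvPowerSeries (Fin N) K} (h : IsSpanMod J v)
    (hr : Module.finrank K (MvPowerSeries (Fin N) K ⧸ J) = Fintype.card β) : IsBasisMod J v :=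
  h.isBasisMod (isLocallyFreeOfRank_of_finrank hn (by exact_mod_cast hr))

theorem isBasisMod_of_linearIndependent {β : Type*} [Fintype β] [DecidableEq β] {n : ℕ}
    {J : Ideal (MvPowerSeries (Fin N) K)} (hn : varIdeal N K ^ n ≤ J)
    {v : β → MvPowerSeries (Fin N) K} (h : ∀ c : β → K, ∑ b, c b • v b ∈ J → c = 0)
    (hr : Module.finrank K (MvPowerSeries (Fin N) K ⧸ J) = Fintype.card β) : IsBasisMod J v := by
  have := moduleFinite_quotient hn
  rw [isBasisMod_iff_bijective]
  have hinj : Function.Injective (Fintype.linearCombination K fun b => mkLin J (v b)) := by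
    rw [← LinearMap.ker_eq_bot, LinearMap.ker_eq_bot']
    intro c hc
    refine h c ?_
    rw [← mkLin_eq_zero, map_sum]
    simp only [map_smul]
    exact hc
  exact ⟨hinj, (LinearMap.injective_iff_surjective_of_finrank_eq_finrank
    (by rw [hr, Module.finrank_pi])).mp hinj⟩

/-- A quotient of dimension at most `e` which is killed by `(X)^(e+1)` is killed by `(X)^e`. -/
theorem pow_le_of_finrank_le {e : ℕ} {J : Ideal (MvPowerSeries (Fin N) K)}
    (hn : varIdeal N K ^ (e + 1) ≤ J)
    (hr : Module.finrank K (MvPowerSeries (Fin N) K ⧸ J) ≤ e) : varIdeal N K ^ e ≤ J := by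
  by_contra hne
  -- If (X)^e is not contained in J, the ideals J + (X)^j strictly decrease up to j = e + 1: a stall
  -- at j ≤ e, multiplied by (X)^(e - j), would put (X)^e into J. The dimension would then be at
  -- least e + 1.
  have key : ∀ j, j ≤ e + 1 →
      j ≤ Module.finrank K (MvPowerSeries (Fin N) K ⧸ (J ⊔ varIdeal N K ^ j)) := by
    intro j
    induction j with
    | zero => intro _; exact Nat.zero_le _
    | succ j ih =>
      intro hj
      refine (Nat.succ_le_succ (ih (by omega))).trans (Nat.succ_le_of_lt ?_)
      by_contra hlt
      have hle : J ⊔ varIdeal N K ^ (j + 1) ≤ J ⊔ varIdeal N K ^ j :=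
        sup_le_sup_left (Ideal.pow_le_pow_right (Nat.le_succ j)) J
      have h := le_of_finrank_le (n := e + 1) (hn.trans le_sup_left) hle (not_lt.mp hlt)
      refine hne ?_
      obtain ⟨d, rfl⟩ := Nat.exists_eq_add_of_le (show j ≤ e by omega)
      calc varIdeal N K ^ (j + d) = varIdeal N K ^ j * varIdeal N K ^ d := pow_add _ _ _
        _ ≤ (J ⊔ varIdeal N K ^ (j + 1)) * varIdeal N K ^ d :=
          Ideal.mul_mono_left (le_sup_right.trans h)
        _ = J * varIdeal N K ^ d ⊔ varIdeal N K ^ (j + d + 1) := by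
          rw [Ideal.sup_mul, ← pow_add, add_right_comm]
        _ ≤ J := sup_le Ideal.mul_le_left hn
  have := key (e + 1) le_rfl
  rw [sup_eq_left.mpr hn] at this
  omega

/-- The dimension bound puts (X)^e into I + (ℓ) + (X)^(e+1), and multiplying by powers of (X) pushes
the error term to any order. -/
theorem pow_le_sup_span {e : ℕ} {I : Ideal (MvPowerSeries (Fin N) K)}
    {ℓ : MvPowerSeries (Fin N) K} (h : InU e K ℓ I) (t : ℕ) :
    varIdeal N K ^ e ≤ I ⊔ Ideal.span {ℓ} ⊔ varIdeal N K ^ t := by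
  have h₁ := pow_le_of_finrank_le le_sup_right h
  induction t with
  | zero => simp
  | succ t ih =>
    rcases le_or_gt t e with hte | hte
    · exact h₁.trans (sup_le_sup_left (Ideal.pow_le_pow_right (by omega)) _)
    · obtain ⟨d, rfl⟩ := Nat.exists_eq_add_of_le hte.le
      refine ih.trans (sup_le le_sup_left ?_)
      calc varIdeal N K ^ (e + d) = varIdeal N K ^ e * varIdeal N K ^ d := pow_add _ _ _
        _ ≤ (I ⊔ Ideal.span {ℓ} ⊔ varIdeal N K ^ (e + 1)) * varIdeal N K ^ d :=
          Ideal.mul_mono_left h₁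
        _ = (I ⊔ Ideal.span {ℓ}) * varIdeal N K ^ d ⊔ varIdeal N K ^ (e + d + 1) := by
          rw [Ideal.sup_mul, ← pow_add, add_right_comm]
        _ ≤ _ := sup_le_sup_right Ideal.mul_le_left _

/-- The bound in `InU` at order e + 1 holds at every order, because modulo ℓ the quotient no longer
changes after order e. -/
theorem finrank_sup_span_le {e : ℕ} {I : Ideal (MvPowerSeries (Fin N) K)}
    {ℓ : MvPowerSeries (Fin N) K} (h : InU e K ℓ I) (t : ℕ) :
    Module.finrank K (MvPowerSeries (Fin N) K ⧸ (I ⊔ varIdeal N K ^ t ⊔ Ideal.span {ℓ})) ≤ e := by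
  rw [sup_right_comm]
  rcases le_or_gt t (e + 1) with ht | ht
  · exact (finrank_le_of_le (n := e + 1) le_sup_right
      (sup_le_sup_left (Ideal.pow_le_pow_right ht) _)).trans h
  · have hle : I ⊔ Ideal.span {ℓ} ⊔ varIdeal N K ^ (e + 1) ≤
        I ⊔ Ideal.span {ℓ} ⊔ varIdeal N K ^ t :=
      sup_le le_sup_left ((Ideal.pow_le_pow_right (Nat.le_succ e)).trans (pow_le_sup_span h t))
    have hr := finrank_le_of_le (n := e + 1) le_sup_right hle
    exact hr.trans h

theorem mul_mem_sup_pow {I : Ideal (MvPowerSeries (Fin N) K)} {ℓ : MvPowerSeries (Fin N) K}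
    (hℓ : ℓ ∈ varIdeal N K) (t : ℕ) {f : MvPowerSeries (Fin N) K}
    (hf : f ∈ I ⊔ varIdeal N K ^ t) : ℓ * f ∈ I ⊔ varIdeal N K ^ (t + 1) := by
  obtain ⟨g, hg, g', hg', rfl⟩ := Submodule.mem_sup.mp hf
  rw [mul_add]
  refine Ideal.add_mem _ (Ideal.mem_sup_left (I.mul_mem_left _ hg)) (Ideal.mem_sup_right ?_)
  rw [pow_succ']
  exact Ideal.mul_mem_mul hℓ hg'

/-- If the dimensions grow by `e` in the step from `t` to `t + 1`, then multiplication by `ℓ` is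
injective there. -/
theorem mem_of_mul_mem {e t : ℕ} {I : Ideal (MvPowerSeries (Fin N) K)}
    {ℓ : MvPowerSeries (Fin N) K} (hℓ : ℓ ∈ varIdeal N K) (h : InU e K ℓ I)
    (hr : Module.finrank K (MvPowerSeries (Fin N) K ⧸ (I ⊔ varIdeal N K ^ (t + 1))) =
      Module.finrank K (MvPowerSeries (Fin N) K ⧸ (I ⊔ varIdeal N K ^ t)) + e)
    {f : MvPowerSeries (Fin N) K} (hf : ℓ * f ∈ I ⊔ varIdeal N K ^ (t + 1)) :
    f ∈ I ⊔ varIdeal N K ^ t := by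
  obtain ⟨h₁, h₂⟩ := finrank_mul (n := t + 1) (J := I ⊔ varIdeal N K ^ (t + 1))
    (J' := I ⊔ varIdeal N K ^ t) le_sup_right
    ((Ideal.pow_le_pow_right (Nat.le_succ t)).trans le_sup_right) ℓ
    (fun f hf => mul_mem_sup_pow hℓ t hf)
  have h₃ := finrank_sup_span_le h (t + 1)
  exact h₂.mp (by omega) f hf

end Field

/-! ### Selecting generators from a spanning family -/

section Gen

variable {K : Type*} [Field K] {V : Type*} [AddCommGroup V] [Module K V]

theorem exists_fin_span_eq {ι : Type*} (s : ι → V) {m : ℕ}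
    (h : Module.finrank K (Submodule.span K (Set.range s)) = m)
    [FiniteDimensional K V] :
    ∃ g : Fin m → ι, Submodule.span K (Set.range (s ∘ g)) = Submodule.span K (Set.range s) := by
  subst h
  obtain ⟨f, hf, hspan, -⟩ := Submodule.exists_fun_fin_finrank_span_eq K (Set.range s)
  choose g hg using hf
  refine ⟨g, Eq.trans ?_ hspan⟩
  congr 2
  exact funext hg

theorem exists_fin_span_eq_of_le {ι : Type*} [Nonempty ι] (s : ι → V) {m : ℕ}
    (h : Module.finrank K (Submodule.span K (Set.range s)) ≤ m)
    [FiniteDimensional K V] :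
    ∃ g : Fin m → ι, Submodule.span K (Set.range (s ∘ g)) = Submodule.span K (Set.range s) := by
  obtain ⟨g, hg⟩ := exists_fin_span_eq (K := K) s rfl
  -- Surplus slots repeat an arbitrary index; this cannot enlarge the span beyond that of s.
  refine ⟨fun x => if hx : (x : ℕ) < _ then g ⟨x, hx⟩ else Classical.arbitrary ι,
    le_antisymm (Submodule.span_mono ?_) ?_⟩
  · rintro _ ⟨x, rfl⟩
    exact ⟨_, rfl⟩
  · refine hg.ge.trans (Submodule.span_mono ?_)
    rintro _ ⟨x, rfl⟩
    refine ⟨Fin.castLE h x, ?_⟩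
    simp

end Gen

end

end CurveSing

namespace CurveSing

noncomputable section

/-! ### Charts over a field -/

section

variable {N : ℕ} {K : Type u} [Field K]

theorem isSpanMod_iff_mem_span {β : Type*} [Fintype β] {A : Type u} [CommRing A]
    {J : Ideal (MvPowerSeries (Fin N) A)} {v : β → MvPowerSeries (Fin N) A} :
    IsSpanMod J v ↔ ∀ f, mkLin J f ∈ Submodule.span A (Set.range fun b => mkLin J (v b)) := by
  rw [isSpanMod_iff_surjective, ← LinearMap.range_eq_top, Fintype.range_linearCombination,
    eq_top_iff]
  constructor
  · intro h f
    exact h Submodule.mem_top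
  · rintro h x -
    obtain ⟨f, rfl⟩ := mkLin_surjective J x
    exact h f

theorem IsBasisMod.injective {β : Type*} [Fintype β] [DecidableEq β] {A : Type u} [CommRing A]
    [Nontrivial A] {J : Ideal (MvPowerSeries (Fin N) A)} {v : β → MvPowerSeries (Fin N) A}
    (h : IsBasisMod J v) : Function.Injective v := by
  obtain ⟨π, -, hv⟩ := h
  intro b b' e
  have := congrFun ((hv b).symm.trans ((congrArg π e).trans (hv b'))) b
  by_contra hne
  simp [hne] at this

theorem span_mon_eq_top {A : Type u} [CommRing A] {n : ℕ} {J : Ideal (MvPowerSeries (Fin N) A)}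
    (hn : varIdeal N A ^ n ≤ J) :
    Submodule.span A (Set.range fun μ : lowMon N n => mkLin J (mon A (μ : Fin N →₀ ℕ))) = ⊤ := by
  rw [eq_top_iff]
  rintro x -
  obtain ⟨f, rfl⟩ := mkLin_surjective J x
  refine mem_of_mon_mem ((Submodule.span A _).comap (mkLin J)) n (fun f hf => ?_)
    (fun μ hμ => ?_) f
  · rw [Submodule.mem_comap, mkLin_eq_zero.mpr (hn hf)]
    exact Submodule.zero_mem _
  · exact Submodule.subset_span ⟨⟨μ, mem_lowMon.mpr hμ⟩, rfl⟩

theorem inU_sup_pow_iff {e m : ℕ} (hm : e + 1 ≤ m) {ℓ : MvPowerSeries (Fin N) K}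
    {I : Ideal (MvPowerSeries (Fin N) K)} :
    InU e K ℓ (I ⊔ varIdeal N K ^ m) ↔ InU e K ℓ I := by
  have : I ⊔ varIdeal N K ^ m ⊔ Ideal.span {ℓ} ⊔ varIdeal N K ^ (e + 1) =
      I ⊔ Ideal.span {ℓ} ⊔ varIdeal N K ^ (e + 1) := by
    rw [sup_right_comm I, sup_pow_sup_pow _ hm]
  rw [InU, InU, this]

/-- The dimensions prescribed by the Hilbert polynomial. -/
def HasDims (a e₀ n : ℕ) (I : Ideal (MvPowerSeries (Fin N) K)) : Prop :=
  ∀ t, e₀ + 1 ≤ t → t ≤ n →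
    Module.finrank K (MvPowerSeries (Fin N) K ⧸ (I ⊔ varIdeal N K ^ t)) = a + e₀ * (t - e₀)

end

namespace Chart

variable {k : Type u} [Field k] {N a e₀ s : ℕ} {c : Chart N a e₀ s} {L : Fin s → Fin N → k}
  {n : ℕ} {K : Type u} [Field K] [Algebra k K] {I : Ideal (MvPowerSeries (Fin N) K)}

theorem base_ell_mem : base K (c.ell L) ∈ varIdeal N K := by
  have := base_mem (A := K) (n := 1) ((pow_one (varIdeal N k)).symm ▸ linForm_mem (L c.form))
  rwa [pow_one] at this

theorem base_vec_inl {t : ℕ} (x : Fin a) :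
    base K (c.vec L t (.inl x)) = mon K (c.low x : Fin N →₀ ℕ) := by
  rw [vec, base_mon]

theorem base_vec_inr {t : ℕ} (y : Fin e₀) (r : Fin (t - e₀)) :
    base K (c.vec L t (.inr (y, r))) = base K (linForm (L c.form)) ^ (r : ℕ) *
      mon K ((c.top y : lowMon N (e₀ + 1)) : Fin N →₀ ℕ) := by
  rw [vec, base_mul, base_mon]
  simp [base, ell]

theorem base_wec_inl (x : Fin a) :
    base K (c.wec L (.inl x)) = base K (c.ell L) * mon K (c.low x : Fin N →₀ ℕ) := by
  rw [wec, base_mul, base_mon]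

theorem base_wec_inr (y : Fin e₀) (r : Fin (e₀ + 1 - e₀)) :
    base K (c.wec L (.inr (y, r))) = mon K (c.gen y : Fin N →₀ ℕ) := by
  rw [wec, base_mon]

theorem Mem.hasDims (h : c.Mem L n K I) : HasDims a e₀ n I := fun t ht htn => by
  rw [finrank_eq_card_of_isBasisMod (h.vec t ht htn), CellIdx.card]

/-- Modulo ℓ the elements ℓ X^μ of `wec` vanish, which leaves e₀ generators. -/
theorem Mem.inU (h : c.Mem L n K I) : InU e₀ K (base K (c.ell L)) I := by
  rw [InU]
  have hs : IsSpanMod (I ⊔ Ideal.span {base K (c.ell L)} ⊔ varIdeal N K ^ (e₀ + 1))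
      fun y : Fin e₀ => mon K (c.gen y : Fin N →₀ ℕ) := by
    rw [isSpanMod_iff_mem_span]
    intro f
    obtain ⟨d, hd⟩ := h.wec.isSpanMod f
    have hle : I ⊔ varIdeal N K ^ (e₀ + 1) ≤
        I ⊔ Ideal.span {base K (c.ell L)} ⊔ varIdeal N K ^ (e₀ + 1) :=
      sup_le_sup_right le_sup_left _
    have hd' := mkLin_eq_zero.mpr (hle hd)
    rw [map_sub, sub_eq_zero, map_sum] at hd'
    rw [hd']
    refine Submodule.sum_mem _ fun b _ => ?_
    rw [map_smul]
    refine Submodule.smul_mem _ _ ?_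
    rcases b with x | ⟨y, r⟩
    · convert Submodule.zero_mem _
      simp only [mkLin_eq_zero, base_wec_inl]
      exact Ideal.mem_sup_left (Ideal.mem_sup_right
        (Ideal.mul_mem_right _ _ (Ideal.mem_span_singleton_self _)))
    · refine Submodule.subset_span ⟨y, ?_⟩
      simp only [base_wec_inr]
  simpa using finrank_le_card_of_isSpanMod hs

/-- Membership in a chart lifts along `Ξ_{m+1} → Ξ_m`. -/
theorem mem_succ_of_mem_trunc {m : ℕ} (hm : e₀ + 1 ≤ m) (hI : varIdeal N K ^ (m + 1) ≤ I)
    (hd : HasDims a e₀ (m + 1) I) (h : c.Mem L m K (I ⊔ varIdeal N K ^ m)) :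
    c.Mem L (m + 1) K I := by
  have hU : InU e₀ K (base K (c.ell L)) I := (inU_sup_pow_iff hm).mp h.inU
  have hvec : ∀ t, e₀ + 1 ≤ t → t ≤ m →
      IsBasisMod (I ⊔ varIdeal N K ^ t) fun b => base K (c.vec L t b) := fun t ht htm => by
    have := h.vec t ht htm
    rwa [sup_pow_sup_pow I htm] at this
  refine ⟨hI, fun t ht htm => ?_, ?_⟩
  · rcases htm.lt_or_eq with hlt | rfl
    · exact hvec t ht (Nat.le_of_lt_succ hlt)
    -- Only t = m + 1 is new, and since the dimension is known, linear independence suffices.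
    · refine isBasisMod_of_linearIndependent le_sup_right (fun d hdm => ?_) (by
        rw [hd _ ht le_rfl, CellIdx.card])
      have hb := (isBasisMod_iff.mp (hvec m hm le_rfl)).2
      -- Reduction modulo (X)^m kills the coefficients of the elements already present at order m.
      have h₁ : ∀ b, d (CellIdx.incl (Nat.le_succ m) b) = 0 := by
        refine congrFun (hb (fun b => d (CellIdx.incl (Nat.le_succ m) b)) ?_)
        have h₂ := Ideal.mem_sup_right (S := I) (c.sum_vec_sub_mem L hm (Nat.le_succ m) d)
        have h₃ := sup_le_sup_left (Ideal.pow_le_pow_right (Nat.le_succ m)) I hdm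
        have := Ideal.sub_mem _ h₃ h₂
        rwa [sub_sub_cancel] at this
      -- `e` indexes the new elements ℓ^(m - e₀) X^ν and `e'` the elements ℓ^(m - e₀ - 1) X^ν, which
      -- exist since m ≥ e₀ + 1. The remaining relation is thus ℓ times a combination of basis
      -- elements at order m.
      let e : Fin e₀ → CellIdx a e₀ (m + 1) := fun y => .inr (y, ⟨m - e₀, by omega⟩)
      let e' : Fin e₀ → CellIdx a e₀ m := fun y => .inr (y, ⟨m - e₀ - 1, by omega⟩)
      have he : Function.Injective e := fun y y' h => by simpa [e] using h
      have he' : Function.Injective e' := fun y y' h => by simpa [e'] using h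
      have hrange : ∀ b, b ∉ Set.range e → d b = 0 := by
        intro b hb
        by_cases hb' : b ∈ Set.range (CellIdx.incl (a := a) (e₀ := e₀) (Nat.le_succ m))
        · obtain ⟨b', rfl⟩ := hb'
          exact h₁ b'
        · exfalso
          have := CellIdx.le_level_of_notMem_range _ hb'
          rcases b with x | ⟨y, r⟩
          · simp only [CellIdx.level] at this
            omega
          · simp only [CellIdx.level] at this
            refine hb ⟨y, ?_⟩
            simp only [e]
            congr 2
            ext
            have := r.2
            simp only
            omega
      have hsum : ∑ b, d b • base K (c.vec L (m + 1) b) =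
          base K (c.ell L) * ∑ y, d (e y) • base K (c.vec L m (e' y)) := by
        rw [Finset.mul_sum]
        refine (Fintype.sum_of_injective e he _ _ (fun b hb => ?_) fun y => ?_).symm
        · rw [hrange b hb, zero_smul]
        · rw [mul_smul_comm, ← base_mul]
          congr 2
          simp only [e, e', vec]
          rw [← mul_assoc, ← pow_succ']
          congr 3
          omega
      rw [hsum] at hdm
      -- Cancelling ℓ moves the relation down to order m, where it must be trivial.
      have hmem := mem_of_mul_mem base_ell_mem hU (by
        rw [hd m hm (Nat.le_succ m), hd (m + 1) ht le_rfl, Nat.sub_add_comm (by omega)]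
        ring) hdm
      have hzero := hb (Function.extend e' (d ∘ e) 0) (by
        convert hmem using 1
        refine (Fintype.sum_of_injective e' he' _ _ (fun b hb => ?_) fun y => ?_).symm
        · rw [Function.extend_apply' _ _ _ hb, Pi.zero_apply, zero_smul]
        · rw [he'.extend_apply]
          rfl)
      ext b
      by_cases hb : b ∈ Set.range e
      · obtain ⟨y, rfl⟩ := hb
        have := congrFun hzero (e' y)
        rwa [he'.extend_apply] at this
      · exact hrange b hb
  · have := h.wec
    rwa [sup_pow_sup_pow I hm] at this

/-- Completing a spanning family to a chart. -/
theorem exists_mem_of_isSpanMod (c : Chart N a e₀ s) (hn : e₀ + 1 ≤ n)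
    (hI : varIdeal N K ^ n ≤ I)
    (hspan : ∀ t, e₀ + 1 ≤ t → t ≤ n →
      IsSpanMod (I ⊔ varIdeal N K ^ t) fun b => base K (c.vec L t b))
    (hd : HasDims a e₀ n I) (hU : InU e₀ K (base K (c.ell L)) I) :
    ∃ c' : Chart N a e₀ s, c'.Mem L n K I := by
  set J := I ⊔ Ideal.span {base K (c.ell L)} ⊔ varIdeal N K ^ (e₀ + 1) with hJ
  have hfin : FiniteDimensional K (MvPowerSeries (Fin N) K ⧸ J) :=
    moduleFinite_quotient (n := e₀ + 1) le_sup_right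
  have hne : Nonempty (lowMon N (e₀ + 1)) := ⟨⟨0, mem_lowMon.mpr (by simp)⟩⟩
  have htop := span_mon_eq_top (n := e₀ + 1) (J := J) le_sup_right
  obtain ⟨gen, hgen⟩ := exists_fin_span_eq_of_le (K := K) (m := e₀)
    (fun μ : lowMon N (e₀ + 1) => mkLin J (mon K (μ : Fin N →₀ ℕ))) (by
      rw [htop, finrank_top]
      exact hU)
  rw [htop] at hgen
  refine ⟨⟨c.low, c.top, gen, c.form⟩, hI, fun t ht htn => ?_, ?_⟩
  · exact (hspan t ht htn).isBasisMod_of_finrank le_sup_right (by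
      rw [hd t ht htn, CellIdx.card])
  · refine IsSpanMod.isBasisMod_of_finrank le_sup_right ?_ (by
      rw [hd _ le_rfl hn, CellIdx.card])
    rw [isSpanMod_iff_mem_span]
    intro f
    set S := Submodule.span K (Set.range fun b => mkLin (I ⊔ varIdeal N K ^ (e₀ + 1))
      (base K (Chart.wec ⟨c.low, c.top, gen, c.form⟩ L b)))
    have hgenS : ∀ y, mkLin (I ⊔ varIdeal N K ^ (e₀ + 1)) (mon K (gen y : Fin N →₀ ℕ)) ∈ S :=
      fun y => Submodule.subset_span ⟨.inr (y, ⟨0, by omega⟩), by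
        simp only [Chart.wec]
        rw [base_mon]⟩
    have hlowS : ∀ x, mkLin (I ⊔ varIdeal N K ^ (e₀ + 1))
        (base K (c.ell L) * mon K (c.low x : Fin N →₀ ℕ)) ∈ S :=
      fun x => Submodule.subset_span ⟨.inl x, by
        simp only [Chart.wec]
        rw [base_mul, base_mon]
        rfl⟩
    -- Expand r in the family `vec`: ℓ times a monomial of degree e₀ has order e₀ + 1 and
    -- disappears, so only the products ℓ X^μ with X^μ low remain.
    have hℓS : ∀ r, mkLin (I ⊔ varIdeal N K ^ (e₀ + 1)) (base K (c.ell L) * r) ∈ S := by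
      intro r
      obtain ⟨d, hd⟩ := hspan (e₀ + 1) le_rfl hn r
      have h₁ := mkLin_eq_zero.mpr (Ideal.mul_mem_left _ (base K (c.ell L)) hd)
      rw [mul_sub, map_sub, sub_eq_zero, Finset.mul_sum, map_sum] at h₁
      rw [h₁]
      refine Submodule.sum_mem _ fun b _ => ?_
      rw [mul_smul_comm, map_smul]
      refine Submodule.smul_mem _ _ ?_
      rcases b with x | ⟨y, r⟩
      · simp only [vec]
        rw [base_mon]
        exact hlowS x
      · convert Submodule.zero_mem S
        rw [mkLin_eq_zero]
        refine Ideal.mem_sup_right ?_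
        rw [pow_succ']
        refine Ideal.mul_mem_mul base_ell_mem (base_mem ?_)
        exact Ideal.mul_mem_left _ _ (mon_mem _ (c.top y).2.ge)
    have hf : mkLin J f ∈ Submodule.span K (Set.range ((fun μ : lowMon N (e₀ + 1) =>
        mkLin J (mon K (μ : Fin N →₀ ℕ))) ∘ gen)) := hgen ▸ Submodule.mem_top
    obtain ⟨d, hd'⟩ := (Submodule.mem_span_range_iff_exists_fun K).mp hf
    have hfJ : f - ∑ y, d y • mon K (gen y : Fin N →₀ ℕ) ∈ J := by
      rw [← mkLin_eq_zero, map_sub, ← hd', map_sum]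
      simp
    rw [hJ, sup_right_comm] at hfJ
    obtain ⟨u, hu, w, hw, huw⟩ := Submodule.mem_sup.mp hfJ
    obtain ⟨r, rfl⟩ := Ideal.mem_span_singleton'.mp hw
    have hfeq : f = u + base K (c.ell L) * r + ∑ y, d y • mon K (gen y : Fin N →₀ ℕ) := by
      rw [mul_comm, huw]
      ring
    rw [hfeq, map_add, map_add, map_sum, mkLin_eq_zero.mpr hu, zero_add]
    refine Submodule.add_mem _ (hℓS r) (Submodule.sum_mem _ fun y _ => ?_)
    rw [map_smul]
    exact Submodule.smul_mem _ _ (hgenS y)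

theorem base_linForm (l : Fin N → k) :
    base K (linForm l) = linForm fun i => algebraMap k K (l i) := by
  simp only [base, linForm, map_sum, map_mul, MvPowerSeries.map_X, MvPowerSeries.map_C]

/-- A point of a cell lies in a chart. -/
theorem exists_mem_of_inCell {e₁ : ℤ} (ha : (a : ℤ) = hilbPoly e₀ e₁ ((e₀ : ℤ) - 1))
    (hn : e₀ + 1 ≤ n) (hI : varIdeal N K ^ n ≤ I) (hd : HasDims a e₀ n I)
    {i j : Finset (Fin N →₀ ℕ)} {q : Fin s} (hij : IsCellIndex e₀ e₁ i j)
    (hcell : InCell e₀ n K i j (base K (linForm (L q))) I)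
    (hU : InU e₀ K (base K (linForm (L q))) I) : ∃ c : Chart N a e₀ s, c.Mem L n K I := by
  obtain ⟨hi, hia, hj, hje⟩ := hij
  have hia' : i.card = a := by
    rw [← ha] at hia
    exact_mod_cast hia
  let ei : i ≃ Fin a := i.equivFinOfCardEq hia'
  let ej : j ≃ Fin e₀ := j.equivFinOfCardEq hje
  have hj' : ∀ y, (((ej.symm y : j) : Fin N →₀ ℕ)).degree = e₀ := fun y => hj _ (ej.symm y).2
  let c : Chart N a e₀ s :=
    { low := fun x => ⟨ei.symm x, mem_lowMon.mpr (hi _ (ei.symm x).2)⟩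
      top := fun y => ⟨⟨ej.symm y, mem_lowMon.mpr (by rw [hj' y]; omega)⟩, hj' y⟩
      gen := fun y => ⟨ej.symm y, mem_lowMon.mpr (by rw [hj' y]; omega)⟩
      form := q }
  refine exists_mem_of_isSpanMod c hn hI (fun t ht htn => ?_) hd hU
  rw [isSpanMod_iff_mem_span]
  intro f
  obtain ⟨⟨x, hx⟩, hxf⟩ := hcell.2 (Ideal.Quotient.mk I f)
  have hfx : mkLin (I ⊔ varIdeal N K ^ t) f = mkLin (I ⊔ varIdeal N K ^ t) x := by
    rw [← sub_eq_zero, ← map_sub, mkLin_eq_zero]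
    exact Ideal.mem_sup_left (Ideal.Quotient.eq.mp hxf.symm)
  rw [hfx]
  set S := Submodule.span K (Set.range fun b => mkLin (I ⊔ varIdeal N K ^ t)
    (base K (c.vec L t b)))
  have hle : cellSpace e₀ n i j (base K (linForm (L q))) ≤
      S.comap (mkLin (I ⊔ varIdeal N K ^ t)) := by
    refine Submodule.span_le.mpr ?_
    rintro f (⟨μ, hμ, rfl⟩ | ⟨μ, hμ, r, hr, rfl⟩)
    · refine Submodule.subset_span ⟨.inl (ei ⟨μ, hμ⟩), ?_⟩
      simp only [vec, base_mon]
      simp [c]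
    -- For r ≥ t - e₀ the element ℓ^r X^μ has order at least t and vanishes in the truncation.
    · by_cases hrt : r < t - e₀
      · refine Submodule.subset_span ⟨.inr (ej ⟨μ, hμ⟩, ⟨r, hrt⟩), ?_⟩
        simp only [vec, base_mul, base_mon]
        simp [c, ell, base]
      · change mkLin _ _ ∈ S
        convert Submodule.zero_mem S
        rw [mkLin_eq_zero]
        refine Ideal.mem_sup_right (Ideal.pow_le_pow_right (show t ≤ r + e₀ by omega) ?_)
        rw [pow_add]
        refine Ideal.mul_mem_mul (Ideal.pow_mem_pow ?_ _) (mon_mem _ (hj μ hμ).ge)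
        exact base_ell_mem (c := c)
  exact hle hx

/-- A point of a chart lies in a cell. -/
theorem Mem.exists_inCell {e₁ : ℤ} (ha : (a : ℤ) = hilbPoly e₀ e₁ ((e₀ : ℤ) - 1))
    (hn : e₀ + 1 ≤ n) (h : c.Mem L n K I) :
    ∃ i j : Finset (Fin N →₀ ℕ), IsCellIndex e₀ e₁ i j ∧
      InCell e₀ n K i j (base K (linForm (L c.form))) I := by
  classical
  have hb := h.vec n hn le_rfl
  rw [sup_eq_left.mpr h.le] at hb
  have hinj := hb.injective
  -- Members of a basis are distinct, so the monomials of the chart are distinct and the two index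
  -- sets have the required cardinalities.
  have hlow : Function.Injective fun x => (c.low x : Fin N →₀ ℕ) := fun x x' e => by
    have : (Sum.inl x : CellIdx a e₀ n) = .inl x' := hinj (by
      simp only [base_vec_inl]
      exact congrArg (mon K) e)
    simpa using this
  have htop : Function.Injective fun y => ((c.top y : lowMon N (e₀ + 1)) : Fin N →₀ ℕ) :=
    fun y y' e => by
      have : (Sum.inr (y, ⟨0, by omega⟩) : CellIdx a e₀ n) = .inr (y', ⟨0, by omega⟩) := hinj (by
        simp only [base_vec_inr]
        exact congrArg (fun μ => _ * mon K μ) e)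
      simpa using this
  refine ⟨Finset.univ.image fun x => (c.low x : Fin N →₀ ℕ),
    Finset.univ.image fun y => ((c.top y : lowMon N (e₀ + 1)) : Fin N →₀ ℕ),
    ⟨?_, ?_, ?_, ?_⟩, ?_⟩
  · intro μ hμ
    obtain ⟨x, -, rfl⟩ := Finset.mem_image.mp hμ
    exact mem_lowMon.mp (c.low x).2
  · rw [Finset.card_image_of_injective _ hlow, Finset.card_univ, Fintype.card_fin, ha]
  · intro μ hμ
    obtain ⟨y, -, rfl⟩ := Finset.mem_image.mp hμ
    exact (c.top y).2
  · rw [Finset.card_image_of_injective _ htop, Finset.card_univ, Fintype.card_fin]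
  · have hspan : cellSpace e₀ n (Finset.univ.image fun x => (c.low x : Fin N →₀ ℕ))
        (Finset.univ.image fun y => ((c.top y : lowMon N (e₀ + 1)) : Fin N →₀ ℕ))
        (base K (linForm (L c.form))) = Submodule.span K (Set.range fun b =>
          base K (c.vec L n b)) := by
      rw [cellSpace]
      congr 1
      ext f
      constructor
      · rintro (⟨μ, hμ, rfl⟩ | ⟨μ, hμ, r, hr, rfl⟩)
        · obtain ⟨x, -, rfl⟩ := Finset.mem_image.mp hμ
          exact ⟨.inl x, base_vec_inl x⟩
        · obtain ⟨y, -, rfl⟩ := Finset.mem_image.mp hμ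
          exact ⟨.inr (y, ⟨r, hr⟩), base_vec_inr _ _⟩
      · rintro ⟨x | ⟨y, r⟩, rfl⟩
        · exact Or.inl ⟨_, Finset.mem_image_of_mem _ (Finset.mem_univ x), 
            base_vec_inl x⟩
        · exact Or.inr ⟨_, Finset.mem_image_of_mem _ (Finset.mem_univ y), r, r.2,
            base_vec_inr y r⟩
    constructor
    · rintro ⟨x, hx⟩ ⟨x', hx'⟩ e
      have hmem : x - x' ∈ I := Ideal.Quotient.eq.mp e
      have hsub : x - x' ∈ Submodule.span K (Set.range fun b => base K (c.vec L n b)) :=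
        hspan ▸ Submodule.sub_mem _ hx hx'
      obtain ⟨d, hd⟩ := (Submodule.mem_span_range_iff_exists_fun K).mp hsub
      have := (isBasisMod_iff.mp hb).2 d (hd ▸ hmem)
      rw [this] at hd
      simp only [Pi.zero_apply, zero_smul, Finset.sum_const_zero] at hd
      exact Subtype.ext (sub_eq_zero.mp hd.symm)
    · intro x
      obtain ⟨f, rfl⟩ := Ideal.Quotient.mk_surjective x
      obtain ⟨d, hd⟩ := hb.isSpanMod f
      exact ⟨⟨∑ b, d b • base K (c.vec L n b),
        hspan ▸ (Submodule.mem_span_range_iff_exists_fun K).mpr ⟨d, rfl⟩⟩,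
        (Ideal.Quotient.eq.mpr hd).symm⟩

end Chart

end

end CurveSing

namespace CurveSing

noncomputable section

/-! ### Ideals lying locally in a chart -/

section

variable {k : Type u} [Field k] {N a e₀ s : ℕ} {n : ℕ}
  {A B C : Type u} [CommRing A] [Algebra k A] [CommRing B] [Algebra k B] [CommRing C] [Algebra k C]

theorem extendIdeal_algHom_comp (φ : A →ₐ[k] B) (ψ : B →ₐ[k] C)
    (J : Ideal (MvPowerSeries (Fin N) A)) :
    extendIdeal (ψ.comp φ).toRingHom J =
      extendIdeal ψ.toRingHom (extendIdeal φ.toRingHom J) :=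
  (extendIdeal_comp _ _ _).symm

theorem extendIdeal_algHom_id (J : Ideal (MvPowerSeries (Fin N) A)) :
    extendIdeal (AlgHom.id k A).toRingHom J = J :=
  extendIdeal_id J

/-- The `k`-algebra map to the residue field. -/
abbrev residueMap (k : Type u) [Field k] {A : Type u} [CommRing A] [Algebra k A]
    (P : PrimeSpectrum A) : A →ₐ[k] P.asIdeal.ResidueField :=
  IsScalarTower.toAlgHom k A P.asIdeal.ResidueField

theorem isUnit_residueMap {P : PrimeSpectrum A} {f : A} (hf : f ∉ P.asIdeal) :
    IsUnit (residueMap k P f) := by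
  rw [isUnit_iff_ne_zero]
  intro h
  exact hf (Ideal.algebraMap_residueField_eq_zero.mp h)

variable (a) in
/-- The ideal `J` lies in a chart locally on `Spec A`. -/
def LocChart (L : Fin s → Fin N → k) (e₀ n : ℕ) (A : Type u) [CommRing A] [Algebra k A]
    (J : Ideal (MvPowerSeries (Fin N) A)) : Prop :=
  varIdeal N A ^ n ≤ J ∧ ∀ P : PrimeSpectrum A, ∃ f ∉ P.asIdeal, ∃ c : Chart N a e₀ s,
    c.Mem L n (Localization.Away f) (extendIdeal (awayMap k f).toRingHom J)

variable {L : Fin s → Fin N → k} {J : Ideal (MvPowerSeries (Fin N) A)}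

theorem Chart.Mem.locChart {c : Chart N a e₀ s} (h : c.Mem L n A J) : LocChart a L e₀ n A J :=
  ⟨h.le, fun P => ⟨1, fun h1 => P.2.ne_top ((Ideal.eq_top_iff_one _).mpr h1), c,
    h.extend (awayMap k 1)⟩⟩

theorem LocChart.extend (φ : A →ₐ[k] B) (h : LocChart a L e₀ n A J) :
    LocChart a L e₀ n B (extendIdeal φ.toRingHom J) := by
  refine ⟨varIdeal_pow_le_extendIdeal _ h.1, fun P => ?_⟩
  obtain ⟨f, hf, c, hc⟩ := h.2 (PrimeSpectrum.comap φ.toRingHom P)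
  refine ⟨φ f, hf, c, ?_⟩
  obtain ⟨ψ, hψ⟩ := exists_awayMap_comm f φ
  rw [← extendIdeal_algHom_comp, ← hψ, extendIdeal_algHom_comp]
  exact hc.extend ψ

theorem LocChart.trunc (h : LocChart a L e₀ n A J) {m : ℕ} (hm : e₀ + 1 ≤ m) (hmn : m ≤ n) :
    LocChart a L e₀ m A (J ⊔ varIdeal N A ^ m) := by
  refine ⟨le_sup_right, fun P => ?_⟩
  obtain ⟨f, hf, c, hc⟩ := h.2 P
  refine ⟨f, hf, c, ?_⟩
  rw [extendIdeal_sup_pow]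
  exact hc.trunc hm hmn

theorem LocChart.exists_mem_residue (h : LocChart a L e₀ n A J) (P : PrimeSpectrum A) :
    ∃ c : Chart N a e₀ s,
      c.Mem L n P.asIdeal.ResidueField (extendIdeal (residueMap k P).toRingHom J) := by
  obtain ⟨f, hf, c, hc⟩ := h.2 P
  obtain ⟨ψ, hψ⟩ := exists_awayLift f (residueMap k P) (isUnit_residueMap hf)
  refine ⟨c, ?_⟩
  rw [← hψ, extendIdeal_algHom_comp]
  exact hc.extend ψ

theorem LocChart.isLocallyFreeOfRank (h : LocChart a L e₀ n A J) {t : ℕ} (ht : e₀ + 1 ≤ t)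
    (htn : t ≤ n) :
    IsLocallyFreeOfRank A (MvPowerSeries (Fin N) A ⧸ (J ⊔ varIdeal N A ^ t))
      (Fintype.card (CellIdx a e₀ t)) := by
  refine isLocallyFreeOfRank_of_local le_sup_right fun P => ?_
  obtain ⟨f, hf, c, hc⟩ := h.2 P
  refine ⟨f, hf, fun b => base _ (c.vec L t b), ?_⟩
  have := hc.vec t ht htn
  rw [← extendIdeal_sup_pow] at this
  exact this

/-- Membership in a chart can be checked on fibres. -/
theorem LocChart.mem_of_fibres (h : LocChart a L e₀ n A J) (hn : e₀ + 1 ≤ n) {c : Chart N a e₀ s}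
    (hc : ∀ P : PrimeSpectrum A,
      c.Mem L n P.asIdeal.ResidueField (extendIdeal (residueMap k P).toRingHom J)) :
    c.Mem L n A J := by
  refine ⟨h.1, fun t ht htn => ?_, ?_⟩
  · refine IsSpanMod.isBasisMod ?_ (h.isLocallyFreeOfRank ht htn)
    refine isSpanMod_of_fibres le_sup_right _ fun P => ?_
    have := ((hc P).vec t ht htn).isSpanMod
    rw [← extendIdeal_sup_pow] at this
    simp only [← map_base (residueMap k P)] at this
    exact this
  · refine IsSpanMod.isBasisMod ?_ (h.isLocallyFreeOfRank le_rfl hn)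
    refine isSpanMod_of_fibres le_sup_right _ fun P => ?_
    have := (hc P).wec.isSpanMod
    rw [← extendIdeal_sup_pow] at this
    simp only [← map_base (residueMap k P)] at this
    exact this

/-- Membership in a chart lifts along `Ξ_{m+1} → Ξ_m`. -/
theorem LocChart.mem_succ {m : ℕ} (h : LocChart a L e₀ (m + 1) A J) (hm : e₀ + 1 ≤ m)
    {c : Chart N a e₀ s} (hc : c.Mem L m A (J ⊔ varIdeal N A ^ m)) : c.Mem L (m + 1) A J := by
  refine h.mem_of_fibres (by omega) fun P => ?_
  obtain ⟨c', hc'⟩ := h.exists_mem_residue P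
  refine Chart.mem_succ_of_mem_trunc hm hc'.le hc'.hasDims ?_
  rw [← extendIdeal_sup_pow]
  exact hc.extend _

theorem LocChart.of_local {t : Finset A} (ht : Ideal.span (t : Set A) = ⊤)
    (hJ : varIdeal N A ^ n ≤ J)
    (h : ∀ f ∈ t, LocChart a L e₀ n (Localization.Away f)
      (extendIdeal (awayMap k f).toRingHom J)) : LocChart a L e₀ n A J := by
  refine ⟨hJ, fun P => ?_⟩
  obtain ⟨f, hft, hfP⟩ := exists_notMem_of_span_eq_top ht P
  obtain ⟨P', hP'⟩ : P ∈ Set.range (PrimeSpectrum.comap (algebraMap A (Localization.Away f))) := by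
    rw [PrimeSpectrum.localization_away_comap_range (Localization.Away f) f]
    exact hfP
  obtain ⟨g, hg, c, hc⟩ := (h f hft).2 P'
  -- The neighbourhood of P' where g is invertible is replaced by a basic open subset of Spec A
  -- itself, that of f g', with g' a numerator of g.
  obtain ⟨m, g', hg'⟩ := IsLocalization.Away.surj f g
  have hg'P : g' ∉ P.asIdeal := by
    intro hmem
    rw [← hP'] at hmem
    have h1 : algebraMap A (Localization.Away f) g' ∈ P'.asIdeal := hmem
    rw [← hg'] at h1
    rcases P'.2.mem_or_mem h1 with h2 | h2
    · exact hg h2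
    · exact P'.2.ne_top (Ideal.eq_top_of_isUnit_mem _ (P'.2.mem_of_pow_mem _ h2)
        (IsLocalization.Away.algebraMap_isUnit f))
  have hu : IsUnit (awayMap k (f * g') (f * g')) := IsLocalization.Away.algebraMap_isUnit _
  rw [map_mul, IsUnit.mul_iff] at hu
  obtain ⟨ψ, hψ⟩ := exists_awayLift f (awayMap k (f * g')) hu.1
  have hψ' : ∀ x, ψ (algebraMap A _ x) = awayMap k (f * g') x := fun x =>
    congrArg (fun q : A →ₐ[k] _ => q x) hψ
  obtain ⟨ψ', hψ'⟩ := exists_awayLift g ψ (by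
    have h1 : IsUnit (ψ (g * algebraMap A (Localization.Away f) f ^ m)) := by
      rw [hg', hψ']
      exact hu.2
    rw [map_mul, IsUnit.mul_iff] at h1
    exact h1.1)
  refine ⟨f * g', fun hmem => (P.2.mem_or_mem hmem).elim hfP hg'P, c, ?_⟩
  rw [← hψ, ← hψ', extendIdeal_algHom_comp, extendIdeal_algHom_comp]
  exact hc.extend ψ'

/-- The polynomial is linear of slope e₀, so p(t - 1) = p(e₀ - 1) + e₀ (t - e₀). -/
theorem hilbPoly_eq_card {e₁ : ℤ} (ha : (a : ℤ) = hilbPoly e₀ e₁ ((e₀ : ℤ) - 1)) {t : ℕ}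
    (ht : e₀ ≤ t) : hilbPoly e₀ e₁ ((t : ℤ) - 1) = (Fintype.card (CellIdx a e₀ t) : ℕ) := by
  rw [CellIdx.card]
  push_cast [Nat.cast_sub ht]
  rw [ha]
  simp only [hilbPoly]
  ring

/-- Ideals with the right ranks and a fibre in a chart lie in that chart near the fibre. -/
theorem exists_away_mem (hn : e₀ + 1 ≤ n) (hJ : varIdeal N A ^ n ≤ J)
    (hfree : ∀ t, e₀ + 1 ≤ t → t ≤ n →
      IsLocallyFreeOfRank A (MvPowerSeries (Fin N) A ⧸ (J ⊔ varIdeal N A ^ t))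
        (Fintype.card (CellIdx a e₀ t))) {c : Chart N a e₀ s} {P : PrimeSpectrum A}
    (hc : c.Mem L n P.asIdeal.ResidueField (extendIdeal (residueMap k P).toRingHom J)) :
    ∃ f ∉ P.asIdeal, c.Mem L n (Localization.Away f) (extendIdeal (awayMap k f).toRingHom J) := by
  have h₁ : ∀ t : Finset.Icc (e₀ + 1) n, ∃ f ∉ P.asIdeal, ∀ g, ∃ d : CellIdx a e₀ t → A,
      f • g - ∑ b, d b • base A (c.vec L t b) ∈ J ⊔ varIdeal N A ^ (t : ℕ) := by
    rintro ⟨t, ht⟩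
    obtain ⟨ht₁, ht₂⟩ := Finset.mem_Icc.mp ht
    refine exists_notMem_smul_mem le_sup_right (fun b => base A (c.vec L t b)) P ?_
    have := (hc.vec t ht₁ ht₂).isSpanMod
    rw [← extendIdeal_sup_pow] at this
    simp only [← map_base (residueMap k P)] at this
    exact this
  choose f hf hf' using h₁
  obtain ⟨f₀, hf₀, hf₀'⟩ : ∃ f ∉ P.asIdeal, ∀ g, ∃ d : CellIdx a e₀ (e₀ + 1) → A,
      f • g - ∑ b, d b • base A (c.wec L b) ∈ J ⊔ varIdeal N A ^ (e₀ + 1) := by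
    refine exists_notMem_smul_mem le_sup_right (fun b => base A (c.wec L b)) P ?_
    have := hc.wec.isSpanMod
    rw [← extendIdeal_sup_pow] at this
    simp only [← map_base (residueMap k P)] at this
    exact this
  -- One denominator for all truncations and for `wec`. Over A_F the families generate, and
  -- generators in the number of the rank form a basis.
  set F := f₀ * ∏ t, f t
  have hu : IsUnit (awayMap k F F) := IsLocalization.Away.algebraMap_isUnit _
  have hu' : IsUnit (awayMap k F f₀) ∧ ∀ t, IsUnit (awayMap k F (f t)) := by
    have h2 : IsUnit (awayMap k F (f₀ * ∏ t, f t)) := hu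
    rw [map_mul, IsUnit.mul_iff, map_prod] at h2
    refine ⟨h2.1, fun t => ?_⟩
    have h3 := h2.2
    rw [IsUnit.prod_univ_iff] at h3
    exact h3 t
  refine ⟨F, ?_, varIdeal_pow_le_extendIdeal _ hJ, fun t ht htn => ?_, ?_⟩
  · intro hmem
    rcases P.2.mem_or_mem hmem with h | h
    · exact hf₀ h
    · obtain ⟨t, -, h⟩ := (P.2.prod_mem_iff).mp h
      exact hf t h
  · have hs := IsSpanMod.extend (awayMap k F).toRingHom le_sup_right
      (hu'.2 ⟨t, Finset.mem_Icc.mpr ⟨ht, htn⟩⟩) (hf' ⟨t, Finset.mem_Icc.mpr ⟨ht, htn⟩⟩)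
    have := hs.isBasisMod ((hfree t ht htn).extend (awayMap k F).toRingHom le_sup_right)
    rw [extendIdeal_sup_pow] at this
    simp only [map_base] at this
    exact this
  · have hs := IsSpanMod.extend (awayMap k F).toRingHom le_sup_right hu'.1 hf₀'
    have := hs.isBasisMod ((hfree _ le_rfl hn).extend (awayMap k F).toRingHom le_sup_right)
    rw [extendIdeal_sup_pow] at this
    simp only [map_base] at this
    exact this

end

/-- The points of `Ξ_n` are the ideals lying locally in a chart. -/
theorem isPointXi_iff {k : Type u} [Field k] {N a e₀ n : ℕ} {e₁ : ℤ}
    (ha : (a : ℤ) = hilbPoly e₀ e₁ ((e₀ : ℤ) - 1)) (hn : e₀ + 1 ≤ n)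
    (L : Fin (e₀ * (N - 1) + 1) → Fin N → k) {A : Type u} [CommRing A] [Algebra k A]
    {J : Ideal (MvPowerSeries (Fin N) A)} :
    IsPointXi e₁ L n A J ↔ LocChart a L e₀ n A J := by
  have hℓ : ∀ (P : PrimeSpectrum A) q, (linForm fun c => algebraMap A P.asIdeal.ResidueField
      (algebraMap k A (L q c))) = base P.asIdeal.ResidueField (linForm (L q)) := by
    intro P q
    rw [Chart.base_linForm]
    congr 1
  constructor
  · rintro ⟨⟨hJ, hfree⟩, hcell⟩
    have hfree' : ∀ t, e₀ + 1 ≤ t → t ≤ n →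
        IsLocallyFreeOfRank A (MvPowerSeries (Fin N) A ⧸ (J ⊔ varIdeal N A ^ t))
          (Fintype.card (CellIdx a e₀ t)) := fun t ht htn => by
      rw [← hilbPoly_eq_card ha (by omega : e₀ ≤ t)]
      exact hfree t ht htn
    refine ⟨hJ, fun P => ?_⟩
    obtain ⟨i, j, q, hij, hc, hU⟩ := hcell P
    simp only [hℓ] at hc hU
    obtain ⟨c, hc⟩ := Chart.exists_mem_of_inCell (L := L) ha hn
      (varIdeal_pow_le_extendIdeal (residueMap k P).toRingHom hJ) (fun t ht htn => by
        have := finrank_quotient_of_isLocallyFreeOfRank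
          ((hfree' t ht htn).extend (residueMap k P).toRingHom le_sup_right)
        rw [extendIdeal_sup_pow, CellIdx.card] at this
        exact_mod_cast this) hij hc hU
    obtain ⟨f, hf, h⟩ := exists_away_mem hn hJ hfree' hc
    exact ⟨f, hf, c, h⟩
  · intro h
    refine ⟨⟨h.1, fun t ht htn => ?_⟩, fun P => ?_⟩
    · rw [hilbPoly_eq_card ha (by omega : e₀ ≤ t)]
      exact h.isLocallyFreeOfRank ht htn
    · obtain ⟨c, hc⟩ := h.exists_mem_residue P
      obtain ⟨i, j, hij, hcell⟩ := hc.exists_inCell ha hn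
      refine ⟨i, j, c.form, hij, ?_⟩
      simp only [hℓ]
      exact ⟨hcell, hc.inU⟩

end

end CurveSing

namespace CurveSing

noncomputable section

/-! ### The functors of points and their atlases -/

variable {k : Type u} [Field k] {N s : ℕ} (a e₀ : ℕ) (L : Fin s → Fin N → k) (n : ℕ)

/-- The functor of points of `Ξ_n`. -/
def xiFunctor : AlgFunctor k where
  obj A _ _ := {J : Ideal (MvPowerSeries (Fin N) A) // LocChart a L e₀ n A J}
  map φ J := ⟨extendIdeal φ.toRingHom J.1, J.2.extend φ⟩
  map_id J := Subtype.ext (extendIdeal_algHom_id J.1)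
  map_comp ψ φ J := Subtype.ext (extendIdeal_algHom_comp φ ψ J.1)

variable {a e₀ L n}

theorem xiFunctor_isSheaf : (xiFunctor a e₀ L n).IsSheaf where
  sep t ht x y h := Subtype.ext (le_antisymm
    (le_of_forall_away y.2.1 ht fun f hf => (congrArg Subtype.val (h f hf)).le)
    (le_of_forall_away x.2.1 ht fun f hf => (congrArg Subtype.val (h f hf)).ge))
  glue {A} _ _ t ht x hx := by
    obtain ⟨J, hJ, hJx⟩ := exists_glue_ideal (n := n) (s := t) (fun f => (x f).1)
      (fun f => (x f).2.1) (fun f g => by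
        obtain ⟨ψ, hψ⟩ := exists_awayMap_comm (f : A) (awayMap k (g : A))
        exact ⟨ψ.toRingHom, congrArg (fun q : A →ₐ[k] _ => q.toRingHom) hψ,
          congrArg Subtype.val (hx f g _ ψ (awayMap k _) hψ)⟩)
    refine ⟨⟨J, LocChart.of_local ht hJ fun f hf => ?_⟩, fun f => Subtype.ext (hJx f)⟩
    have := (x ⟨f, hf⟩).2
    rwa [← hJx ⟨f, hf⟩] at this

theorem exists_rep_xiFunctor (hn : e₀ + 1 ≤ n) (c : Chart N a e₀ s) :
    ∃ r : (xiFunctor a e₀ L n).Rep fun A _ _ x => c.Mem L n A x.1,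
      Algebra.FiniteType k r.R := by
  obtain ⟨R, _, _, J, hft, hJ, h₁, h₂⟩ := c.exists_universal L hn
  exact ⟨{
    R := R
    pt := ⟨J, hJ.locChart⟩
    mem := hJ
    exists_hom := fun A _ _ x hx => by
      obtain ⟨h, e⟩ := h₁ A x.1 hx
      exact ⟨h, Subtype.ext e⟩
    hom_ext := fun A _ _ h h' e => h₂ A h h' (congrArg Subtype.val e) }, hft⟩

variable (a e₀ L n) in
/-- The atlas of `Ξ_n`. -/
def xiAtlas (hn : e₀ + 1 ≤ n) :
    AlgFunctor.Atlas (xiFunctor a e₀ L n) (ULift.{u} (Chart N a e₀ s)) where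
  chart c A _ _ x := c.down.Mem L n A x.1
  stable _ _ _ _ _ _ _ φ _ hx := hx.extend φ
  rep c := (exists_rep_xiFunctor hn c.down).choose
  basic _ c' _ _ _ _ hx := hx.exists_isUnit_iff c'.down hn
  cover _ _ _ x P := by
    obtain ⟨f, hf, c, hc⟩ := x.2.2 P
    exact ⟨f, hf, ⟨c⟩, hc⟩

theorem finiteType_xiAtlas (hn : e₀ + 1 ≤ n) (c : ULift.{u} (Chart N a e₀ s)) :
    Algebra.FiniteType k ((xiAtlas a e₀ L n hn).rep c).R :=
  (exists_rep_xiFunctor hn c.down).choose_spec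

variable (a e₀ L) in
/-- The functor of compatible sequences of points of the `Ξ_n`. -/
def limFunctor : AlgFunctor k where
  obj A _ _ := {J : ℕ → Ideal (MvPowerSeries (Fin N) A) //
    ∀ m, LocChart a L e₀ (e₀ + 1 + m) A (J m) ∧ J (m + 1) ⊔ varIdeal N A ^ (e₀ + 1 + m) = J m}
  map φ J := ⟨fun m => extendIdeal φ.toRingHom (J.1 m), fun m =>
    ⟨(J.2 m).1.extend φ, by rw [← extendIdeal_sup_pow, (J.2 m).2]⟩⟩
  map_id J := Subtype.ext (funext fun m => extendIdeal_algHom_id (J.1 m))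
  map_comp ψ φ J := Subtype.ext (funext fun m => extendIdeal_algHom_comp φ ψ (J.1 m))

/-- The components of a compatible sequence. -/
def limProj (m : ℕ) {A : Type u} [CommRing A] [Algebra k A] (x : (limFunctor a e₀ L).obj A) :
    (xiFunctor a e₀ L (e₀ + 1 + m)).obj A := ⟨x.1 m, (x.2 m).1⟩

theorem limProj_map (m : ℕ) {A B : Type u} [CommRing A] [Algebra k A] [CommRing B] [Algebra k B]
    (φ : A →ₐ[k] B) (x : (limFunctor a e₀ L).obj A) :
    limProj m ((limFunctor a e₀ L).map φ x) =
      (xiFunctor a e₀ L (e₀ + 1 + m)).map φ (limProj m x) := rfl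

theorem limFunctor_ext {A : Type u} [CommRing A] [Algebra k A] {x y : (limFunctor a e₀ L).obj A}
    (h : ∀ m, limProj m x = limProj m y) : x = y :=
  Subtype.ext (funext fun m => congrArg Subtype.val (h m))

/-- Truncation of points. -/
def xiTrunc (m : ℕ) {A : Type u} [CommRing A] [Algebra k A]
    (x : (xiFunctor a e₀ L (e₀ + 1 + (m + 1))).obj A) : (xiFunctor a e₀ L (e₀ + 1 + m)).obj A :=
  ⟨x.1 ⊔ varIdeal N A ^ (e₀ + 1 + m), x.2.trunc (by omega) (by omega)⟩

theorem xiTrunc_map (m : ℕ) {A B : Type u} [CommRing A] [Algebra k A] [CommRing B] [Algebra k B]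
    (φ : A →ₐ[k] B) (x : (xiFunctor a e₀ L (e₀ + 1 + (m + 1))).obj A) :
    xiTrunc m ((xiFunctor a e₀ L _).map φ x) = (xiFunctor a e₀ L _).map φ (xiTrunc m x) :=
  Subtype.ext (extendIdeal_sup_pow _ _ _).symm

theorem xiTrunc_limProj (m : ℕ) {A : Type u} [CommRing A] [Algebra k A]
    (x : (limFunctor a e₀ L).obj A) : xiTrunc m (limProj (m + 1) x) = limProj m x :=
  Subtype.ext (x.2 m).2

theorem exists_limProj_eq {A : Type u} [CommRing A] [Algebra k A]
    (x : ∀ m, (xiFunctor a e₀ L (e₀ + 1 + m)).obj A) (h : ∀ m, xiTrunc m (x (m + 1)) = x m) :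
    ∃ y : (limFunctor a e₀ L).obj A, ∀ m, limProj m y = x m :=
  ⟨⟨fun m => (x m).1, fun m => ⟨(x m).2, congrArg Subtype.val (h m)⟩⟩, fun _ => rfl⟩

theorem limFunctor_isSheaf : (limFunctor a e₀ L).IsSheaf where
  sep t ht x y h := limFunctor_ext fun m => xiFunctor_isSheaf.sep t ht _ _ fun f hf => by
    rw [← limProj_map, ← limProj_map, h f hf]
  glue {A} _ _ t ht x hx := by
    have hglue : ∀ m, ∃ y : (xiFunctor a e₀ L (e₀ + 1 + m)).obj A, ∀ f : t,
        (xiFunctor a e₀ L (e₀ + 1 + m)).map (awayMap k (f : A)) y = limProj m (x f) := fun m =>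
      xiFunctor_isSheaf.glue t ht (fun f => limProj m (x f)) fun f g B _ _ φ ψ e => by
        rw [← limProj_map, ← limProj_map, hx f g B φ ψ e]
    choose y hy using hglue
    obtain ⟨z, hz⟩ := exists_limProj_eq y fun m => xiFunctor_isSheaf.sep t ht _ _ fun f hf => by
      rw [← xiTrunc_map, hy (m + 1) ⟨f, hf⟩, hy m ⟨f, hf⟩, xiTrunc_limProj]
    refine ⟨z, fun f => limFunctor_ext fun m => ?_⟩
    rw [limProj_map, hz, hy m f]

/-- Since chart membership lifts along truncations, the charts of the limit are detected at the
lowest order e₀ + 1. -/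
theorem mem_limProj_of_mem_zero {A : Type u} [CommRing A] [Algebra k A]
    {x : (limFunctor a e₀ L).obj A} {c : Chart N a e₀ s} (h : c.Mem L (e₀ + 1) A (x.1 0)) (m : ℕ) :
    c.Mem L (e₀ + 1 + m) A (x.1 m) := by
  induction m with
  | zero => exact h
  | succ m ih =>
    refine (x.2 (m + 1)).1.mem_succ (m := e₀ + 1 + m) (by omega) ?_
    rw [(x.2 m).2]
    exact ih

/-- A chart of the limit is an inverse limit of affine charts with the same data, so it is
represented by the colimit of their algebras. -/
theorem nonempty_rep_limFunctor (c : Chart N a e₀ s) :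
    Nonempty ((limFunctor a e₀ L).Rep fun A _ _ x => c.Mem L (e₀ + 1) A (x.1 0)) := by
  choose R hR₁ hR₂ J _ hJ h₁ h₂ using fun m : ℕ =>
    c.exists_universal L (n := e₀ + 1 + m) (by omega)
  choose f hf using fun m : ℕ => h₁ m (R (m + 1)) (J (m + 1) ⊔ varIdeal N _ ^ (e₀ + 1 + m))
    ((hJ (m + 1)).trunc (by omega) (by omega))
  obtain ⟨C, _, _, i, hi, hlift, hext⟩ := AlgFunctor.exists_seqColimit R f
  have hmem : ∀ m, c.Mem L (e₀ + 1 + m) C (extendIdeal (i m).toRingHom (J m)) := fun m =>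
    (hJ m).extend (i m)
  refine ⟨{
    R := C
    pt := ⟨fun m => extendIdeal (i m).toRingHom (J m), fun m => ⟨(hmem m).locChart, ?_⟩⟩
    mem := hmem 0
    exists_hom := fun A _ _ x hx => ?_
    hom_ext := fun A _ _ h h' e => hext A h h' fun m => ?_ }⟩
  · rw [← extendIdeal_sup_pow, ← hf m, ← extendIdeal_algHom_comp, hi]
  · choose g hg using fun m => h₁ m A (x.1 m) (mem_limProj_of_mem_zero hx m)
    obtain ⟨h, hh⟩ := hlift A g fun m => h₂ m A _ _ (by
      rw [extendIdeal_algHom_comp, hf, extendIdeal_sup_pow, hg, hg, (x.2 m).2])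
    refine ⟨h, Subtype.ext (funext fun m => ?_)⟩
    change extendIdeal h.toRingHom (extendIdeal (i m).toRingHom (J m)) = x.1 m
    rw [← extendIdeal_algHom_comp, hh, hg]
  · refine h₂ m A _ _ ?_
    rw [extendIdeal_algHom_comp, extendIdeal_algHom_comp]
    exact congrFun (congrArg Subtype.val e) m

variable (a e₀ L) in
/-- The atlas of the limit of the `Ξ_n`. -/
def limAtlas : AlgFunctor.Atlas (limFunctor a e₀ L) (ULift.{u} (Chart N a e₀ s)) where
  chart c A _ _ x := c.down.Mem L (e₀ + 1) A (x.1 0)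
  stable _ _ _ _ _ _ _ φ _ hx := hx.extend φ
  rep c := (nonempty_rep_limFunctor c.down).some
  basic _ c' _ _ _ _ hx := hx.exists_isUnit_iff c'.down le_rfl
  cover _ _ _ x P := by
    obtain ⟨f, hf, c, hc⟩ := (x.2 0).1.2 P
    exact ⟨f, hf, ⟨c⟩, hc⟩

/-- The schemes `Ξ_n`, their transition maps and their limit, on the level of the functors
of points. -/
theorem exists_xi_system :
    ∃ (Ξ : ℕ → Over (Spec (CommRingCat.of k)))
      (τ : ∀ m (A : Type u) [CommRing A] [Algebra k A], (specOver k A ⟶ Ξ m) →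
        (xiFunctor a e₀ L (e₀ + 1 + m)).obj A)
      (t : ∀ m, Ξ (m + 1) ⟶ Ξ m)
      (H : Cone (Functor.ofOpSequence t))
      (σ : ∀ (A : Type u) [CommRing A] [Algebra k A], (specOver k A ⟶ H.pt) →
        (limFunctor a e₀ L).obj A),
      (∀ m, LocallyOfFiniteType (Ξ m).hom ∧ QuasiCompact (Ξ m).hom) ∧
      (∀ m (A : Type u) [CommRing A] [Algebra k A], Function.Bijective (τ m A)) ∧
      (∀ m (A B : Type u) [CommRing A] [Algebra k A] [CommRing B] [Algebra k B] (φ : A →ₐ[k] B)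
        (x : specOver k A ⟶ Ξ m), τ m B (specOverMap φ ≫ x) = (xiFunctor a e₀ L _).map φ (τ m A x)) ∧
      (∀ m (A : Type u) [CommRing A] [Algebra k A] (x : specOver k A ⟶ Ξ (m + 1)),
        τ m A (x ≫ t m) = xiTrunc m (τ (m + 1) A x)) ∧
      (∀ m, IsAffineHom (t m).left) ∧
      Nonempty (IsLimit H) ∧
      (∀ (A : Type u) [CommRing A] [Algebra k A], Function.Bijective (σ A)) ∧
      (∀ (A B : Type u) [CommRing A] [Algebra k A] [CommRing B] [Algebra k B] (φ : A →ₐ[k] B)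
        (x : specOver k A ⟶ H.pt), σ B (specOverMap φ ≫ x) = (limFunctor a e₀ L).map φ (σ A x)) ∧
      ∀ m (A : Type u) [CommRing A] [Algebra k A] (x : specOver k A ⟶ H.pt),
        τ m A (x ≫ H.π.app (op m)) = limProj m (σ A x) := by
  let 𝒜 : ∀ m, AlgFunctor.Atlas (xiFunctor a e₀ L (e₀ + 1 + m)) (ULift.{u} (Chart N a e₀ s)) :=
    fun m => xiAtlas a e₀ L (e₀ + 1 + m) (by omega)
  choose τ hτ hτnat hτpt using fun m => (𝒜 m).exists_represents xiFunctor_isSheaf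
  obtain ⟨σ, hσ, hσnat, -⟩ := (limAtlas a e₀ L).exists_represents limFunctor_isSheaf
  have htrans : ∀ m, ∃ t : (𝒜 (m + 1)).glued ⟶ (𝒜 m).glued, ∀ (A : Type u) [CommRing A]
      [Algebra k A] (x : specOver k A ⟶ (𝒜 (m + 1)).glued),
      τ m A (x ≫ t) = xiTrunc m (τ (m + 1) A x) := by
    intro m
    choose θ hθ using fun (A : Type u) (_ : CommRing A) (_ : Algebra k A)
      (x : specOver k A ⟶ (𝒜 (m + 1)).glued) => (hτ m A).2 (xiTrunc m (τ (m + 1) A x))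
    obtain ⟨t, ht⟩ := exists_hom_of_natural (fun A _ _ x => θ A _ _ x) (by
      intro A B _ _ _ _ φ x
      apply (hτ m B).1
      rw [hθ, hτnat, hτnat, hθ, xiTrunc_map])
    exact ⟨t, fun A _ _ x => by rw [ht, hθ]⟩
  choose t ht using htrans
  have hproj : ∀ m, ∃ p : (limAtlas a e₀ L).glued ⟶ (𝒜 m).glued, ∀ (A : Type u) [CommRing A]
      [Algebra k A] (x : specOver k A ⟶ (limAtlas a e₀ L).glued),
      τ m A (x ≫ p) = limProj m (σ A x) := by
    intro m
    choose θ hθ using fun (A : Type u) (_ : CommRing A) (_ : Algebra k A)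
      (x : specOver k A ⟶ (limAtlas a e₀ L).glued) => (hτ m A).2 (limProj m (σ A x))
    obtain ⟨t, ht⟩ := exists_hom_of_natural (fun A _ _ x => θ A _ _ x) (by
      intro A B _ _ _ _ φ x
      apply (hτ m B).1
      rw [hθ, hτnat, hσnat, hθ, limProj_map])
    exact ⟨t, fun A _ _ x => by rw [ht, hθ]⟩
  choose p hp using hproj
  have hpt : ∀ m, p (m + 1) ≫ t m = p m := fun m => over_hom_ext fun A _ _ x => (hτ m A).1 (by
    rw [← Category.assoc, ht, hp, hp, xiTrunc_limProj])
  refine ⟨fun m => (𝒜 m).glued, τ, t, AlgFunctor.seqCone t p hpt, σ, fun m => ⟨?_, ?_⟩, hτ, hτnat,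
    ht, fun m => ?_, ?_, hσ, hσnat, hp⟩
  · exact (𝒜 m).locallyOfFiniteType_glued fun c => finiteType_xiAtlas _ c
  · exact (𝒜 m).quasiCompact_glued
  -- Truncation and lifting of chart membership together make each chart upstairs the full preimage
  -- of the one downstairs, for every m.
  · refine (𝒜 (m + 1)).isAffineHom_of_chart (𝒜 m) (fun A _ _ => (hτ (m + 1) A).1)
      (hτnat (m + 1)) (hτpt (m + 1)) (fun A _ _ => (hτ m A).1) (hτnat m) (hτpt m) (t m) ?_
    intro c K _ _ x
    rw [ht]
    constructor
    · intro h
      exact Chart.Mem.trunc h (by omega) (by omega)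
    · intro h
      exact LocChart.mem_succ (τ (m + 1) K x).2 (m := e₀ + 1 + m) (by omega) h
  · refine AlgFunctor.nonempty_isLimit_seqCone t p hpt ?_ ?_
    · intro A _ _ x y h
      apply (hσ A).1
      exact limFunctor_ext fun m => by rw [← hp, ← hp, h]
    · intro A _ _ x hx
      obtain ⟨y, hy⟩ := exists_limProj_eq (fun m => τ m A (x m)) fun m => by
        rw [← ht, hx]
      obtain ⟨z, rfl⟩ := (hσ A).2 y
      exact ⟨z, fun m => (hτ m A).1 (by rw [hp, hy])⟩

end

end CurveSing

namespace CurveSing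

noncomputable section

/-! ### Growth of the Hilbert function -/

/-- A set of at most `d` monomials of degree `d` has at least as many divisors of
degree `d - 1`. -/
theorem card_le_card_of_shadow {N : ℕ} (m : ℕ) : ∀ (d : ℕ) (S B : Finset (Fin N →₀ ℕ)),
    S.card = m → m ≤ d → (∀ μ ∈ S, μ.degree = d) →
    (∀ μ i, μ + Finsupp.single i 1 ∈ S → μ ∈ B) → S.card ≤ B.card := by
  classical
  induction m using Nat.strong_induction_on with
  | _ m ih =>
  intro d S B hm hd hdeg hB
  rcases S.eq_empty_or_nonempty with rfl | ⟨μ₀, hμ₀⟩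
  · simp
  have hmpos : 0 < m := hm ▸ Finset.card_pos.mpr ⟨μ₀, hμ₀⟩
  obtain ⟨i, hi⟩ : ∃ i, μ₀ i ≠ 0 := by
    by_contra! h
    have h0 : μ₀ = 0 := Finsupp.ext h
    have := hdeg μ₀ hμ₀
    rw [h0, map_zero] at this
    omega
  let dv : (Fin N →₀ ℕ) → (Fin N →₀ ℕ) := fun μ => μ - Finsupp.single i 1
  have hdv : ∀ μ : Fin N →₀ ℕ, μ i ≠ 0 → dv μ + Finsupp.single i 1 = μ := fun μ h =>
    tsub_add_cancel_of_le (Finsupp.single_le_iff.mpr (Nat.one_le_iff_ne_zero.mpr h))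
  have hdv' : ∀ μ : Fin N →₀ ℕ, dv (μ + Finsupp.single i 1) = μ := fun μ =>
    add_tsub_cancel_right _ _
  -- S is split by divisibility by X_i, a variable dividing some member. If all members are
  -- divisible, division by X_i embeds S into B. Otherwise both parts are smaller than S, and the
  -- induction hypothesis applies to S₀ in degree d and to S₁ divided by X_i in degree d - 1; the
  -- bound d - 1 holds because S₀ is nonempty.
  let S₀ := S.filter fun μ => μ i = 0
  let S₁ := S.filter fun μ => μ i ≠ 0
  have hS : S₀.card + S₁.card = S.card := Finset.card_filter_add_card_filter_not _
  have hinj : ∀ T : Finset (Fin N →₀ ℕ), ((T.filter fun μ => μ i ≠ 0).image dv).card =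
      (T.filter fun μ => μ i ≠ 0).card := fun T => by
    refine Finset.card_image_of_injOn fun μ hμ ν hν h => ?_
    rw [← hdv μ (Finset.mem_filter.mp hμ).2, ← hdv ν (Finset.mem_filter.mp hν).2]
    exact congrArg (· + Finsupp.single i 1) h
  have hS₁ : 0 < S₁.card := Finset.card_pos.mpr ⟨μ₀, Finset.mem_filter.mpr ⟨hμ₀, hi⟩⟩
  rcases Nat.eq_zero_or_pos S₀.card with h0 | h0
  · rw [← hS, h0, zero_add, ← hinj S]
    refine Finset.card_le_card fun ν hν => ?_
    obtain ⟨μ, hμ, rfl⟩ := Finset.mem_image.mp hν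
    obtain ⟨hμS, hμi⟩ := Finset.mem_filter.mp hμ
    exact hB _ i (by rw [hdv μ hμi]; exact hμS)
  · have h₀ : S₀.card ≤ (B.filter fun μ => μ i = 0).card := by
      refine ih S₀.card (by omega) d S₀ _ rfl (by omega)
        (fun μ hμ => hdeg μ (Finset.mem_filter.mp hμ).1) fun μ j hμ => ?_
      obtain ⟨hμS, hμi⟩ := Finset.mem_filter.mp hμ
      refine Finset.mem_filter.mpr ⟨hB μ j hμS, ?_⟩
      rw [Finsupp.add_apply] at hμi
      omega
    have h₁ : (S₁.image dv).card ≤ ((B.filter fun μ => μ i ≠ 0).image dv).card := by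
      refine ih (S₁.image dv).card (by rw [hinj]; change S₁.card < m; omega) (d - 1) _ _ rfl
        (by rw [hinj]; change S₁.card ≤ d - 1; omega) (fun ν hν => ?_) fun ν j hν => ?_
      · obtain ⟨μ, hμ, rfl⟩ := Finset.mem_image.mp hν
        obtain ⟨hμS, hμi⟩ := Finset.mem_filter.mp hμ
        have := hdeg μ hμS
        rw [← hdv μ hμi, map_add, Finsupp.degree_single] at this
        omega
      · obtain ⟨μ, hμ, hμν⟩ := Finset.mem_image.mp hν
        obtain ⟨hμS, hμi⟩ := Finset.mem_filter.mp hμ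
        refine Finset.mem_image.mpr ⟨ν + Finsupp.single i 1, Finset.mem_filter.mpr ⟨?_, ?_⟩,
          hdv' ν⟩
        · refine hB _ j ?_
          rw [add_right_comm, ← hμν, hdv μ hμi]
          exact hμS
        · rw [Finsupp.add_apply, Finsupp.single_eq_same]
          omega
    rw [hinj, hinj] at h₁
    have := Finset.card_filter_add_card_filter_not (s := B) (fun μ : Fin N →₀ ℕ => μ i = 0)
    change S₁.card ≤ (B.filter fun μ => ¬ μ i = 0).card at h₁
    omega

/-- The rank of a finite family counts its members that are not combinations of earlier ones. -/
theorem finrank_span_image_eq_card {K V ι : Type*} [Field K] [AddCommGroup V] [Module K V]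
    [FiniteDimensional K V] [LinearOrder ι] (v : ι → V) (s : Finset ι) :
    open scoped Classical in
    Module.finrank K (Submodule.span K (v '' (s : Set ι))) =
      (s.filter fun i => v i ∉ Submodule.span K (v '' {j | j ∈ s ∧ j < i})).card := by
  classical
  induction s using Finset.induction_on_max with
  | empty => simp
  | insert i s hi ih =>
    have hmem : i ∉ s := fun h => lt_irrefl i (hi i h)
    have hset : ∀ x ∈ s, {j | j ∈ insert i s ∧ j < x} = {j | j ∈ s ∧ j < x} := fun x hx => by
      ext j
      simp only [Finset.mem_insert, Set.mem_ofPred_eq]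
      constructor
      · rintro ⟨rfl | h, h'⟩
        · exact absurd h' (hi x hx).asymm
        · exact ⟨h, h'⟩
      · exact fun h => ⟨Or.inr h.1, h.2⟩
    have hset' : {j | j ∈ insert i s ∧ j < i} = (s : Set ι) := by
      ext j
      simp only [Finset.mem_insert, Set.mem_ofPred_eq, Finset.mem_coe]
      constructor
      · rintro ⟨rfl | h, h'⟩
        · exact absurd h' (lt_irrefl _)
        · exact h
      · exact fun h => ⟨Or.inr h, hi j h⟩
    have hcongr : (s.filter fun x => v x ∉ Submodule.span K
        (v '' {j | j ∈ insert i s ∧ j < x})) =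
        s.filter fun x => v x ∉ Submodule.span K (v '' {j | j ∈ s ∧ j < x}) :=
      Finset.filter_congr fun x hx => by rw [hset x hx]
    rw [Finset.filter_insert, hset', hcongr, Finset.coe_insert, Set.image_insert_eq]
    split_ifs with h
    · rw [Submodule.span_insert_eq_span h, ih]
    · rw [Finset.card_insert_of_notMem fun h => hmem (Finset.mem_filter.mp h).1, ← ih,
        Submodule.span_insert]
      have h1 := Submodule.finrank_sup_add_finrank_inf_eq (Submodule.span K {v i})
        (Submodule.span K (v '' (s : Set ι)))
      have h2 : Submodule.span K {v i} ⊓ Submodule.span K (v '' (s : Set ι)) = ⊥ :=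
        (Submodule.disjoint_span_singleton_of_notMem h).symm.eq_bot
      rw [h2, finrank_bot, finrank_span_singleton (v := v i)
        fun h0 => h (by rw [h0]; exact Submodule.zero_mem _)] at h1
      omega

section

variable {N : ℕ} {K : Type u} [Field K]

/-- The degree `d` part of the associated graded ring of `K[[X]] / I`. -/
def gradePiece (I : Ideal (MvPowerSeries (Fin N) K)) (d : ℕ) :
    Submodule K (MvPowerSeries (Fin N) K ⧸ (I ⊔ varIdeal N K ^ (d + 1))) :=
  ((varIdeal N K ^ d).restrictScalars K).map (mkLin (I ⊔ varIdeal N K ^ (d + 1)))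

theorem mem_gradePiece {I : Ideal (MvPowerSeries (Fin N) K)} {d : ℕ}
    {f : MvPowerSeries (Fin N) K} (hf : f ∈ varIdeal N K ^ d) :
    mkLin (I ⊔ varIdeal N K ^ (d + 1)) f ∈ gradePiece I d :=
  Submodule.mem_map_of_mem (show f ∈ (varIdeal N K ^ d).restrictScalars K from hf)

theorem finrank_succ (I : Ideal (MvPowerSeries (Fin N) K)) (d : ℕ) :
    Module.finrank K (MvPowerSeries (Fin N) K ⧸ (I ⊔ varIdeal N K ^ (d + 1))) =
      Module.finrank K (MvPowerSeries (Fin N) K ⧸ (I ⊔ varIdeal N K ^ d)) +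
        Module.finrank K (gradePiece I d) := by
  have hn : varIdeal N K ^ (d + 1) ≤ I ⊔ varIdeal N K ^ (d + 1) := le_sup_right
  have := moduleFinite_quotient hn
  have hle : I ⊔ varIdeal N K ^ (d + 1) ≤ I ⊔ varIdeal N K ^ d :=
    sup_le_sup_left (Ideal.pow_le_pow_right d.le_succ) I
  obtain ⟨ρ, hρ⟩ := exists_lift_mkLin (J := I ⊔ varIdeal N K ^ (d + 1))
    (mkLin (I ⊔ varIdeal N K ^ d)) fun f hf => mkLin_eq_zero.mpr (hle hf)
  have hsurj : LinearMap.range ρ = ⊤ := LinearMap.range_eq_top.mpr fun x => by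
    obtain ⟨f, rfl⟩ := mkLin_surjective _ x
    exact ⟨_, hρ f⟩
  have hker : LinearMap.ker ρ = gradePiece I d := by
    ext x
    obtain ⟨f, rfl⟩ := mkLin_surjective _ x
    rw [LinearMap.mem_ker, hρ, mkLin_eq_zero]
    constructor
    · intro hf
      obtain ⟨g, hg, h, hh, rfl⟩ := Submodule.mem_sup.mp hf
      rw [map_add, mkLin_eq_zero.mpr (Ideal.mem_sup_left hg), zero_add]
      exact mem_gradePiece hh
    · rintro ⟨g, hg, hgf⟩
      rw [← sub_eq_zero, ← map_sub, mkLin_eq_zero] at hgf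
      rw [← sub_sub_cancel g f]
      exact sub_mem (Ideal.mem_sup_right (S := I) hg) (hle hgf)
  have := LinearMap.finrank_range_add_finrank_ker ρ
  rw [hsurj, hker, finrank_top] at this
  exact this.symm

/-- The monomials of degree `d`. -/
def degMon (N d : ℕ) : Finset (Lex (Fin N →₀ ℕ)) :=
  ((lowMon N (d + 1)).filter fun μ => μ.degree = d).map toLex.toEmbedding

theorem mem_degMon {d : ℕ} {μ : Lex (Fin N →₀ ℕ)} :
    μ ∈ degMon N d ↔ (ofLex μ).degree = d := by
  constructor
  · intro h
    obtain ⟨ν, hν, rfl⟩ := Finset.mem_map.mp h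
    exact (Finset.mem_filter.mp hν).2
  · intro h
    exact Finset.mem_map.mpr ⟨ofLex μ, Finset.mem_filter.mpr
      ⟨mem_lowMon.mpr (by omega), h⟩, rfl⟩

theorem span_degMon (I : Ideal (MvPowerSeries (Fin N) K)) (d : ℕ) :
    Submodule.span K ((fun μ => mkLin (I ⊔ varIdeal N K ^ (d + 1)) (mon K (ofLex μ))) ''
      (degMon N d : Set (Lex (Fin N →₀ ℕ)))) = gradePiece I d := by
  apply le_antisymm
  · rw [Submodule.span_le]
    rintro _ ⟨μ, hμ, rfl⟩
    exact mem_gradePiece (mon_mem _ (mem_degMon.mp hμ).ge)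
  · rintro _ ⟨f, hf, rfl⟩
    have h := sub_trunc_mem f (d + 1)
    have h' : mkLin (I ⊔ varIdeal N K ^ (d + 1)) f = mkLin (I ⊔ varIdeal N K ^ (d + 1))
        (∑ μ ∈ lowMon N (d + 1), MvPowerSeries.coeff μ f • mon K μ) := by
      rw [← sub_eq_zero, ← map_sub, mkLin_eq_zero]
      exact Ideal.mem_sup_right (S := I) h
    rw [h', map_sum]
    refine Submodule.sum_mem _ fun μ hμ => ?_
    rw [map_smul]
    by_cases hd : μ.degree = d
    · exact Submodule.smul_mem _ _ (Submodule.subset_span ⟨toLex μ, mem_degMon.mpr hd, rfl⟩)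
    · have hlt : μ.degree < d := by
        have := mem_lowMon.mp hμ
        omega
      rw [mem_varIdeal_pow.mp (show f ∈ varIdeal N K ^ d from hf) μ hlt, zero_smul]
      exact Submodule.zero_mem _

open scoped Classical in
/-- The standard monomials of degree `d`: those that are not combinations of smaller ones in the
associated graded ring. -/
def stdMon (I : Ideal (MvPowerSeries (Fin N) K)) (d : ℕ) : Finset (Lex (Fin N →₀ ℕ)) :=
  (degMon N d).filter fun μ => mkLin (I ⊔ varIdeal N K ^ (d + 1)) (mon K (ofLex μ)) ∉
    Submodule.span K ((fun ν => mkLin (I ⊔ varIdeal N K ^ (d + 1)) (mon K (ofLex ν))) ''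
      {ν | ν ∈ degMon N d ∧ ν < μ})

theorem card_stdMon (I : Ideal (MvPowerSeries (Fin N) K)) (d : ℕ) :
    (stdMon I d).card = Module.finrank K (gradePiece I d) := by
  have hn : varIdeal N K ^ (d + 1) ≤ I ⊔ varIdeal N K ^ (d + 1) := le_sup_right
  have := moduleFinite_quotient hn
  rw [← span_degMon, finrank_span_image_eq_card]
  rfl

/-- Standard monomials are closed under division: a relation expressing X^μ by smaller monomials of
its degree can be multiplied by X_i, and the lexicographic order is compatible with this. The count
of divisors therefore applies to them. -/
theorem mem_stdMon_of_add (I : Ideal (MvPowerSeries (Fin N) K)) (d : ℕ) (μ : Fin N →₀ ℕ)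
    (i : Fin N) (h : toLex (μ + Finsupp.single i 1) ∈ stdMon I (d + 1)) :
    toLex μ ∈ stdMon I d := by
  classical
  obtain ⟨h1, h2⟩ := Finset.mem_filter.mp h
  have hdeg : μ.degree = d := by
    have := mem_degMon.mp h1
    rw [ofLex_toLex, map_add, Finsupp.degree_single] at this
    omega
  refine Finset.mem_filter.mpr ⟨mem_degMon.mpr hdeg, fun h3 => h2 ?_⟩
  have hX : mon K (Finsupp.single i 1) ∈ varIdeal N K := by
    have := mon_mem (A := K) (Finsupp.single i 1) (n := 1) (by rw [Finsupp.degree_single])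
    rwa [pow_one] at this
  obtain ⟨ρ, hρ⟩ := exists_lift_mkLin (J := I ⊔ varIdeal N K ^ (d + 1))
    (mkLin (I ⊔ varIdeal N K ^ (d + 1 + 1)) ∘ₗ LinearMap.mulLeft K (mon K (Finsupp.single i 1)))
    fun f hf => mkLin_eq_zero.mpr (mul_mem_sup_pow hX (d + 1) hf)
  have hmul : ∀ ν : Fin N →₀ ℕ, ρ (mkLin _ (mon K ν)) =
      mkLin (I ⊔ varIdeal N K ^ (d + 1 + 1)) (mon K (ν + Finsupp.single i 1)) := fun ν => by
    rw [hρ, LinearMap.comp_apply, LinearMap.mulLeft_apply, mon_mul, add_comm ν]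
  have h4 := Submodule.mem_map_of_mem (f := ρ) h3
  rw [Submodule.map_span, ofLex_toLex, hmul] at h4
  refine Submodule.span_mono ?_ h4
  rintro _ ⟨_, ⟨ν, ⟨hν, hlt⟩, rfl⟩, rfl⟩
  refine ⟨ν + toLex (Finsupp.single i 1), ⟨mem_degMon.mpr ?_, ?_⟩, (hmul _).symm⟩
  · rw [ofLex_add, map_add, mem_degMon.mp hν, ofLex_toLex, Finsupp.degree_single]
  · rw [toLex_add]
    exact add_lt_add_left hlt _

/-- Once the Hilbert function is at most the degree, it does not grow. -/
theorem finrank_gradePiece_succ_le (I : Ideal (MvPowerSeries (Fin N) K)) {d : ℕ}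
    (h : Module.finrank K (gradePiece I d) ≤ d) :
    Module.finrank K (gradePiece I (d + 1)) ≤ Module.finrank K (gradePiece I d) := by
  classical
  rw [← card_stdMon, ← card_stdMon]
  rw [← card_stdMon] at h
  by_contra! hlt
  -- Were the function to grow, one could pick a set of standard monomials of degree d + 1 exceeding
  -- the count in degree d by one. It has at most d + 1 elements, and its divisors are standard of
  -- degree d and too few.
  obtain ⟨S, hS, hcard⟩ := Finset.exists_subset_card_eq (Nat.succ_le_of_lt hlt)
  have := card_le_card_of_shadow _ (d + 1) (S.map ofLex.toEmbedding)
    ((stdMon I d).map ofLex.toEmbedding) rfl (by rw [Finset.card_map]; omega)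
    (fun μ hμ => by
      obtain ⟨ν, hν, rfl⟩ := Finset.mem_map.mp hμ
      exact mem_degMon.mp (Finset.mem_filter.mp (hS hν)).1)
    (fun μ i hμ => by
      obtain ⟨ν, hν, hνμ⟩ := Finset.mem_map.mp hμ
      refine Finset.mem_map.mpr ⟨toLex μ, mem_stdMon_of_add I d μ i ?_, rfl⟩
      rw [← hνμ]
      exact hS hν)
  rw [Finset.card_map, Finset.card_map] at this
  omega

theorem finrank_gradePiece_le_of_le (I : Ideal (MvPowerSeries (Fin N) K)) {d t : ℕ}
    (h : Module.finrank K (gradePiece I d) ≤ d) (hdt : d ≤ t) :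
    Module.finrank K (gradePiece I t) ≤ Module.finrank K (gradePiece I d) := by
  induction t, hdt using Nat.le_induction with
  | base => exact le_rfl
  | succ t ht ih => exact (finrank_gradePiece_succ_le I (ih.trans (h.trans ht))).trans ih

/-- Multiplication by ℓ maps the truncation at t to the one at t + 1 with cokernel of dimension at
most e, so the dimension increases by at most e. -/
theorem finrank_gradePiece_le {e : ℕ} {I : Ideal (MvPowerSeries (Fin N) K)}
    {ℓ : MvPowerSeries (Fin N) K} (hℓ : ℓ ∈ varIdeal N K) (h : InU e K ℓ I) (t : ℕ) :
    Module.finrank K (gradePiece I t) ≤ e := by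
  have h1 := (finrank_mul (n := t + 1) (J := I ⊔ varIdeal N K ^ (t + 1))
    (J' := I ⊔ varIdeal N K ^ t) le_sup_right
    ((Ideal.pow_le_pow_right t.le_succ).trans le_sup_right) ℓ
    fun f hf => mul_mem_sup_pow hℓ t hf).1
  have h2 := finrank_sup_span_le h (t + 1)
  have h3 := finrank_succ I t
  omega

/-- The Hilbert function of a curve singularity is constant from degree `e₀` on. -/
theorem finrank_gradePiece_eq {e : ℕ} {I : Ideal (MvPowerSeries (Fin N) K)}
    {ℓ : MvPowerSeries (Fin N) K} (hℓ : ℓ ∈ varIdeal N K) (h : InU e K ℓ I)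
    (hlarge : ∀ᶠ t : ℕ in Filter.atTop, Module.finrank K (gradePiece I t) = e) {t : ℕ}
    (ht : e ≤ t) : Module.finrank K (gradePiece I t) = e := by
  apply le_antisymm (finrank_gradePiece_le hℓ h t)
  -- The lower bound comes from large degrees, since from degree e on the Hilbert function cannot
  -- increase.
  obtain ⟨T, hT⟩ := Filter.eventually_atTop.mp hlarge
  rw [← hT (max T t) (le_max_left _ _)]
  exact finrank_gradePiece_le_of_le I ((finrank_gradePiece_le hℓ h t).trans ht) (le_max_right _ _)

end

end

end CurveSing

namespace CurveSing

noncomputable section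

/-! ### The tangent cone and hyperplanes in general position -/

section

variable {N : ℕ} {K : Type u} [Field K]

theorem homogeneousComponent_mul_X_succ (x : MvPolynomial (Fin N) K) (i : Fin N) (d : ℕ) :
    MvPolynomial.homogeneousComponent (d + 1) (x * MvPolynomial.X i) =
      MvPolynomial.homogeneousComponent d x * MvPolynomial.X i := by
  classical
  ext μ
  rw [MvPolynomial.coeff_homogeneousComponent, MvPolynomial.coeff_mul_X',
    MvPolynomial.coeff_mul_X', MvPolynomial.coeff_homogeneousComponent]
  by_cases hi : i ∈ μ.support
  · have hμ : (μ - Finsupp.single i 1) + Finsupp.single i 1 = μ :=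
      tsub_add_cancel_of_le (Finsupp.single_le_iff.mpr
        (Nat.one_le_iff_ne_zero.mpr (Finsupp.mem_support_iff.mp hi)))
    have hdeg : (μ - Finsupp.single i 1).degree + 1 = μ.degree := by
      conv_rhs => rw [← hμ, map_add, Finsupp.degree_single]
    have : μ.degree = d + 1 ↔ (μ - Finsupp.single i 1).degree = d := by omega
    simp only [hi, if_true, this]
  · simp only [hi, if_false, ite_self]

theorem homogeneousComponent_mul_X_zero (x : MvPolynomial (Fin N) K) (i : Fin N) :
    MvPolynomial.homogeneousComponent 0 (x * MvPolynomial.X i) = 0 := by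
  rw [MvPolynomial.homogeneousComponent_zero, MvPolynomial.coeff_mul_X']
  simp

theorem coe_mem_varIdeal_pow {f : MvPolynomial (Fin N) K} {d : ℕ} (hf : f.IsHomogeneous d) :
    (f : MvPowerSeries (Fin N) K) ∈ varIdeal N K ^ d :=
  mem_varIdeal_pow.mpr fun μ hμ => by
    rw [MvPolynomial.coeff_coe]
    exact hf.coeff_eq_zero hμ.ne

/-- The polynomials whose homogeneous components of degree `d` lie in `W d`. -/
def leadIdeal (W : ℕ → Ideal (MvPowerSeries (Fin N) K))
    (hW : ∀ d f i, f ∈ W d → f * MvPowerSeries.X i ∈ W (d + 1)) :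
    Ideal (MvPolynomial (Fin N) K) where
  carrier := {x | ∀ d, (MvPolynomial.homogeneousComponent d x : MvPowerSeries (Fin N) K) ∈ W d}
  add_mem' {x y} hx hy d := by
    rw [map_add, MvPolynomial.coe_add]
    exact add_mem (hx d) (hy d)
  zero_mem' d := by
    rw [map_zero, MvPolynomial.coe_zero]
    exact zero_mem _
  smul_mem' c x hx := by
    rw [smul_eq_mul, mul_comm]
    induction c using MvPolynomial.induction_on with
    | C a =>
      intro d
      rw [mul_comm, MvPolynomial.homogeneousComponent_C_mul, MvPolynomial.coe_mul]
      exact Ideal.mul_mem_left _ _ (hx d)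
    | add p q hp hq =>
      intro d
      rw [mul_add, map_add, MvPolynomial.coe_add]
      exact add_mem (hp d) (hq d)
    | mul_X p i hp =>
      intro d
      rw [← mul_assoc]
      cases d with
      | zero =>
        rw [homogeneousComponent_mul_X_zero, MvPolynomial.coe_zero]
        exact zero_mem _
      | succ d =>
        rw [homogeneousComponent_mul_X_succ, MvPolynomial.coe_mul, MvPolynomial.coe_X]
        exact hW d _ i (hp d)

theorem mem_leadIdeal_of_isHomogeneous {W : ℕ → Ideal (MvPowerSeries (Fin N) K)}
    {hW : ∀ d f i, f ∈ W d → f * MvPowerSeries.X i ∈ W (d + 1)} {f : MvPolynomial (Fin N) K}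
    {d : ℕ} (hf : f.IsHomogeneous d) (h : (f : MvPowerSeries (Fin N) K) ∈ W d) :
    f ∈ leadIdeal W hW := fun d' => by
  rw [MvPolynomial.homogeneousComponent_of_mem ((MvPolynomial.mem_homogeneousSubmodule _ _).mpr hf)]
  split_ifs with hd
  · rw [hd]
    exact h
  · rw [MvPolynomial.coe_zero]
    exact zero_mem _

/-- Points of the tangent cone of `K[[X]] / I`. -/
def IsTangent (I : Ideal (MvPowerSeries (Fin N) K)) (x : Fin N → K) : Prop :=
  ∀ (d : ℕ) (f : MvPolynomial (Fin N) K), f.IsHomogeneous d →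
    (f : MvPowerSeries (Fin N) K) ∈ I ⊔ varIdeal N K ^ (d + 1) → MvPolynomial.eval x f = 0

/-- The compatibility that `leadIdeal` requires, for leading forms of I enlarged by ℓ times (X)^(d -
1). Truncated subtraction at d = 0 only makes the source smaller. -/
theorem pow_mul_X_mem {I : Ideal (MvPowerSeries (Fin N) K)} (ℓ : MvPowerSeries (Fin N) K)
    (d : ℕ) (f : MvPowerSeries (Fin N) K) (i : Fin N)
    (hf : f ∈ I ⊔ varIdeal N K ^ (d + 1) ⊔ Ideal.span {ℓ} * varIdeal N K ^ (d - 1)) :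
    f * MvPowerSeries.X i ∈
      I ⊔ varIdeal N K ^ (d + 1 + 1) ⊔ Ideal.span {ℓ} * varIdeal N K ^ (d + 1 - 1) := by
  have hX : (MvPowerSeries.X i : MvPowerSeries (Fin N) K) ∈ varIdeal N K :=
    Ideal.subset_span ⟨i, rfl⟩
  have h : f * MvPowerSeries.X i ∈ (I ⊔ varIdeal N K ^ (d + 1) ⊔
      Ideal.span {ℓ} * varIdeal N K ^ (d - 1)) * varIdeal N K := Ideal.mul_mem_mul hf hX
  rw [Ideal.sup_mul, Ideal.sup_mul, ← pow_succ, mul_assoc, ← pow_succ] at h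
  have hle : I * varIdeal N K ⊔ varIdeal N K ^ (d + 1 + 1) ⊔
      Ideal.span {ℓ} * varIdeal N K ^ (d - 1 + 1) ≤
      I ⊔ varIdeal N K ^ (d + 1 + 1) ⊔ Ideal.span {ℓ} * varIdeal N K ^ (d + 1 - 1) :=
    sup_le_sup (sup_le_sup_right Ideal.mul_le_left _)
      (Ideal.mul_mono_right (Ideal.pow_le_pow_right (by omega)))
  exact hle h

/-- Either the linear form `ℓ` is a parameter of the tangent cone or it vanishes at a point
of it. -/
theorem exists_pow_le_or_exists_isTangent [IsAlgClosed K] (I : Ideal (MvPowerSeries (Fin N) K))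
    (l : Fin N → K) :
    (∃ T, varIdeal N K ^ T ≤
      I ⊔ varIdeal N K ^ (T + 1) ⊔ Ideal.span {linForm l} * varIdeal N K ^ (T - 1)) ∨
    ∃ x : Fin N → K, x ≠ 0 ∧ ∑ i, l i * x i = 0 ∧ IsTangent I x := by
  classical
  let ℓ : MvPolynomial (Fin N) K := ∑ i, MvPolynomial.C (l i) * MvPolynomial.X i
  have hℓ : (ℓ : MvPowerSeries (Fin N) K) = linForm l := by
    change MvPolynomial.coeToMvPowerSeries.ringHom ℓ = _
    rw [map_sum]
    refine Finset.sum_congr rfl fun i _ => ?_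
    rw [map_mul]
    change ((MvPolynomial.C (l i) : MvPolynomial (Fin N) K) : MvPowerSeries (Fin N) K) *
      ((MvPolynomial.X i : MvPolynomial (Fin N) K) : MvPowerSeries (Fin N) K) = _
    rw [MvPolynomial.coe_C, MvPolynomial.coe_X]
  have hℓhom : ℓ.IsHomogeneous 1 := MvPolynomial.IsHomogeneous.sum _ _ _ fun i _ => by
    have := (MvPolynomial.isHomogeneous_C (Fin N) (l i)).mul (MvPolynomial.isHomogeneous_X K i)
    rwa [zero_add] at this
  -- The zeros of 𝔞 lie on the tangent cone and on the hyperplane ℓ = 0.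
  let 𝔞 := leadIdeal (fun d => I ⊔ varIdeal N K ^ (d + 1) ⊔
    Ideal.span {linForm l} * varIdeal N K ^ (d - 1)) (pow_mul_X_mem (linForm l))
  by_cases hz : ∃ x ∈ MvPolynomial.zeroLocus K 𝔞, x ≠ 0
  · obtain ⟨x, hx, hx0⟩ := hz
    have hx' : ∀ f ∈ 𝔞, MvPolynomial.eval x f = 0 := fun f hf => by
      have := MvPolynomial.mem_zeroLocus_iff.mp hx f hf
      rwa [MvPolynomial.aeval_eq_eval] at this
    refine Or.inr ⟨x, hx0, ?_, fun d f hf hfI => hx' f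
      (mem_leadIdeal_of_isHomogeneous hf (Ideal.mem_sup_left hfI))⟩
    have := hx' ℓ (mem_leadIdeal_of_isHomogeneous hℓhom (by
      rw [hℓ]
      refine Ideal.mem_sup_right ?_
      rw [Nat.sub_self, pow_zero, Ideal.one_eq_top, Ideal.mul_top]
      exact Ideal.mem_span_singleton_self _))
    rw [map_sum] at this
    simpa using this
  · left
    -- Nullstellensatz: without a nonzero zero, the variables lie in the radical of 𝔞, so some power
    -- of the ideal they generate lies in 𝔞.
    have hrad : Ideal.span (Set.range MvPolynomial.X) ≤ 𝔞.radical := by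
      rw [← MvPolynomial.vanishingIdeal_zeroLocus_eq_radical (K := K), Ideal.span_le]
      rintro _ ⟨i, rfl⟩
      refine MvPolynomial.mem_vanishingIdeal_iff.mpr fun x hx => ?_
      have : x = 0 := by
        by_contra h
        exact hz ⟨x, hx, h⟩
      rw [this, MvPolynomial.aeval_X, Pi.zero_apply]
    obtain ⟨T, hT⟩ := Ideal.exists_pow_le_of_le_radical_of_fg hrad
      ⟨Finset.univ.image MvPolynomial.X, by rw [Finset.coe_image, Finset.coe_univ, Set.image_univ]⟩
    refine ⟨T, fun f hf => ?_⟩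
    have hle : varIdeal N K ^ (T + 1) ≤ I ⊔ varIdeal N K ^ (T + 1) ⊔
      Ideal.span {linForm l} * varIdeal N K ^ (T - 1) := le_sup_right.trans le_sup_left
    rw [← sub_add_cancel f (∑ μ ∈ lowMon N (T + 1), MvPowerSeries.coeff μ f • mon K μ)]
    refine add_mem (hle (sub_trunc_mem f (T + 1))) (Ideal.sum_mem _ fun μ hμ => ?_)
    by_cases hd : μ.degree = T
    · have hhom : (MvPolynomial.monomial μ (1 : K)).IsHomogeneous T :=
        MvPolynomial.isHomogeneous_monomial _ hd
      have hmem : MvPolynomial.monomial μ (1 : K) ∈ 𝔞 := by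
        apply hT
        rw [MvPolynomial.monomial_eq, map_one, one_mul, ← hd, Finsupp.degree_eq_sum]
        rw [Finsupp.prod_fintype _ _ fun i => pow_zero _, ← Finset.prod_pow_eq_pow_sum]
        exact Ideal.prod_mem_prod fun i _ => Ideal.pow_mem_pow
          (Ideal.subset_span (Set.mem_range_self i)) _
      have := hmem T
      rw [MvPolynomial.homogeneousComponent_of_mem
        ((MvPolynomial.mem_homogeneousSubmodule _ _).mpr hhom), if_pos rfl,
        MvPolynomial.coe_monomial] at this
      exact smul_mem_ideal _ this
    · have hlt : μ.degree < T := by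
        have := mem_lowMon.mp hμ
        omega
      rw [mem_varIdeal_pow.mp hf μ hlt, zero_smul]
      exact zero_mem _

/-- Distinct points of the projectivized tangent cone give independent classes in the associated
graded ring. -/
theorem le_finrank_gradePiece_of_isTangent {I : Ideal (MvPowerSeries (Fin N) K)} {m t : ℕ}
    (x : Fin m → Fin N → K) (hx0 : ∀ b, x b ≠ 0)
    (hx : ∀ b b', b ≠ b' → ∃ i j, x b i * x b' j ≠ x b j * x b' i)
    (hI : ∀ b, IsTangent I (x b)) (ht : m ≤ t + 1) :
    m ≤ Module.finrank K (gradePiece I t) := by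
  classical
  have hsep : ∀ b b', ∃ g : MvPolynomial (Fin N) K, g.IsHomogeneous 1 ∧
      (b ≠ b' → MvPolynomial.eval (x b) g ≠ 0 ∧ MvPolynomial.eval (x b') g = 0) := by
    intro b b'
    by_cases h : b = b'
    · exact ⟨0, MvPolynomial.isHomogeneous_zero _ _ _, fun h' => absurd h h'⟩
    · obtain ⟨i, j, hij⟩ := hx b b' h
      refine ⟨MvPolynomial.C (x b' j) * MvPolynomial.X i -
        MvPolynomial.C (x b' i) * MvPolynomial.X j, ?_, fun _ => ⟨?_, ?_⟩⟩
      · refine MvPolynomial.IsHomogeneous.sub ?_ ?_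
        all_goals
          rw [← zero_add 1]
          exact (MvPolynomial.isHomogeneous_C _ _).mul (MvPolynomial.isHomogeneous_X _ _)
      · simp only [map_sub, map_mul, MvPolynomial.eval_C, MvPolynomial.eval_X]
        intro h0
        exact hij (by linear_combination h0)
      · simp only [map_sub, map_mul, MvPolynomial.eval_C, MvPolynomial.eval_X]
        ring
  choose g hg1 hg2 using hsep
  have hcoord : ∀ b, ∃ i, x b i ≠ 0 := fun b => by
    by_contra! h
    exact hx0 b (funext h)
  choose i hi using hcoord
  -- A product of m - 1 linear forms that vanish at the other points and not at x b, padded to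
  -- degree t by a power of a coordinate that is nonzero at x b. Hence the condition m ≤ t + 1.
  let f : Fin m → MvPolynomial (Fin N) K := fun b =>
    (∏ b' ∈ Finset.univ.erase b, g b b') * MvPolynomial.X (i b) ^ (t + 1 - m)
  have hf : ∀ b, (f b).IsHomogeneous t := fun b => by
    have h1 := MvPolynomial.IsHomogeneous.prod (Finset.univ.erase b) (g b) (fun _ => 1)
      fun b' _ => hg1 b b'
    have h2 := h1.mul ((MvPolynomial.isHomogeneous_X K (i b)).pow (t + 1 - m))
    rw [Finset.sum_const, Finset.card_erase_of_mem (Finset.mem_univ b), Finset.card_univ,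
      Fintype.card_fin, smul_eq_mul, mul_one, one_mul] at h2
    have hm : 0 < m := Fin.pos b
    rwa [show m - 1 + (t + 1 - m) = t by omega] at h2
  have hfb : ∀ b, MvPolynomial.eval (x b) (f b) ≠ 0 := fun b => by
    simp only [f, map_mul, map_prod, map_pow, MvPolynomial.eval_X]
    refine mul_ne_zero (Finset.prod_ne_zero_iff.mpr fun b' hb' => ?_) (pow_ne_zero _ (hi b))
    exact (hg2 b b' (Finset.ne_of_mem_erase hb').symm).1
  have hfb' : ∀ b b', b ≠ b' → MvPolynomial.eval (x b') (f b) = 0 := fun b b' h => by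
    simp only [f, map_mul, map_prod]
    rw [Finset.prod_eq_zero (Finset.mem_erase.mpr ⟨h.symm, Finset.mem_univ b'⟩) (hg2 b b' h).2,
      zero_mul]
  have hn : varIdeal N K ^ (t + 1) ≤ I ⊔ varIdeal N K ^ (t + 1) := le_sup_right
  have := moduleFinite_quotient hn
  have hli : LinearIndependent K fun b : Fin m =>
      (⟨_, mem_gradePiece (I := I) (coe_mem_varIdeal_pow (hf b))⟩ : gradePiece I t) := by
    rw [Fintype.linearIndependent_iff]
    intro c hc b
    have h1 := congrArg Subtype.val hc
    rw [AddSubmonoidClass.coe_finsetSum] at h1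
    simp only [SetLike.val_smul, ZeroMemClass.coe_zero, ← map_smul, ← map_sum] at h1
    rw [mkLin_eq_zero] at h1
    have h2 : ((∑ b, c b • f b : MvPolynomial (Fin N) K) : MvPowerSeries (Fin N) K) =
        ∑ b, c b • (f b : MvPowerSeries (Fin N) K) := by
      change MvPolynomial.coeToMvPowerSeries.ringHom _ = _
      rw [map_sum]
      refine Finset.sum_congr rfl fun b _ => ?_
      change ((c b • f b : MvPolynomial (Fin N) K) : MvPowerSeries (Fin N) K) = _
      exact MvPolynomial.coe_smul _ _
    rw [← h2] at h1
    -- Tangency of x b makes evaluation there well defined on the graded piece, and it isolates the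
    -- coefficient c b.
    have h3 := hI b t _ (MvPolynomial.IsHomogeneous.sum _ _ _ fun b _ =>
      (MvPolynomial.homogeneousSubmodule (Fin N) K t).smul_mem (c b) (hf b)) h1
    simp only [map_sum, MvPolynomial.smul_eval] at h3
    rw [Finset.sum_eq_single b (fun b' _ h => by rw [hfb' b' b h, mul_zero])
      fun h => absurd (Finset.mem_univ b) h] at h3
    exact (mul_eq_zero.mp h3).resolve_right (hfb b)
  simpa using hli.fintype_card_le_finrank

end

end

end CurveSing

namespace CurveSing

noncomputable section

/-! ### Curve singularities lie in charts -/

/-- What Nakayama's lemma and Krull's intersection theorem require below. -/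
theorem varIdeal_le_jacobson (N : ℕ) (A : Type u) [CommRing A] :
    varIdeal N A ≤ (⊥ : Ideal (MvPowerSeries (Fin N) A)).jacobson := fun f hf => by
  rw [Ideal.mem_jacobson_bot]
  intro g
  rw [MvPowerSeries.isUnit_iff_constantCoeff, map_add, map_mul, map_one]
  have : MvPowerSeries.constantCoeff f = 0 := by
    rw [← pow_one (varIdeal N A)] at hf
    exact mem_varIdeal_pow.mp hf 0 (by rw [map_zero]; exact one_pos)
  rw [this, zero_mul, zero_add]
  exact isUnit_one

section

variable {N : ℕ} {K : Type u} [Field K]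

theorem isUnit_of_notMem_varIdeal {f : MvPowerSeries (Fin N) K} (hf : f ∉ varIdeal N K) :
    IsUnit f := by
  rw [MvPowerSeries.isUnit_iff_constantCoeff, isUnit_iff_ne_zero]
  intro h0
  refine hf ?_
  rw [← pow_one (varIdeal N K), mem_varIdeal_pow]
  intro μ hμ
  have : μ = 0 := (Finsupp.degree_eq_zero_iff μ).mp (by omega)
  rw [this]
  exact h0

/-- In dimension one the regular sequence has a single member, and it cannot be a unit because the
sequence generates a proper ideal. -/
theorem exists_regular_of_isCurveSingularity {I : Ideal (MvPowerSeries (Fin N) K)}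
    (h : IsCurveSingularity K I) :
    ∃ f ∈ varIdeal N K, ∀ g, f * g ∈ I → g ∈ I := by
  obtain ⟨hdim, -, rs, hrs, hlen⟩ := h
  rw [hdim] at hlen
  have hlen' : rs.length = 1 := by exact_mod_cast hlen
  obtain ⟨x, rfl⟩ := List.length_eq_one_iff.mp hlen'
  obtain ⟨f, rfl⟩ := Ideal.Quotient.mk_surjective x
  have hreg := ((RingTheory.Sequence.isRegular_cons_iff _ _ _).mp hrs).1
  refine ⟨f, ?_, fun g hg => ?_⟩
  · by_contra hf
    refine hrs.top_ne_smul ?_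
    have : Ideal.ofList [Ideal.Quotient.mk I f] = ⊤ := by
      rw [Ideal.ofList_singleton, Ideal.span_singleton_eq_top]
      exact (isUnit_of_notMem_varIdeal hf).map _
    rw [this, Submodule.top_smul]
  · rw [← Ideal.Quotient.eq_zero_iff_mem]
    refine hreg ?_
    change Ideal.Quotient.mk I f * Ideal.Quotient.mk I g = Ideal.Quotient.mk I f * 0
    rw [mul_zero, ← map_mul, Ideal.Quotient.eq_zero_iff_mem]
    exact hg

theorem eventually_finrank_gradePiece {I : Ideal (MvPowerSeries (Fin N) K)} {e₀ : ℕ} {e₁ : ℤ}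
    (h : HasHilbertPolynomial K I e₀ e₁) :
    ∀ᶠ t : ℕ in Filter.atTop, Module.finrank K (gradePiece I t) = e₀ := by
  obtain ⟨T, hT⟩ := Filter.eventually_atTop.mp h
  refine Filter.eventually_atTop.mpr ⟨T + 1, fun t ht => ?_⟩
  obtain ⟨t, rfl⟩ := Nat.exists_eq_add_of_le' ht
  have h1 := hT (t + T) (by omega)
  have h2 := hT (t + T + 1) (by omega)
  have h3 := finrank_succ I (t + T + 1)
  rw [h3] at h2
  push_cast [h1, hilbPoly] at h2
  have : (Module.finrank K (gradePiece I (t + T + 1)) : ℤ) = e₀ := by linarith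
  exact_mod_cast this

/-- If `ℓ` is a parameter of the tangent cone then it is a superficial element. -/
theorem inU_of_pow_le {I : Ideal (MvPowerSeries (Fin N) K)} {e₀ : ℕ} {e₁ : ℤ}
    (hC : IsCurveSingularity K I) (hH : HasHilbertPolynomial K I e₀ e₁)
    {ℓ : MvPowerSeries (Fin N) K} (hℓ : ℓ ∈ varIdeal N K) {T : ℕ}
    (hT : varIdeal N K ^ T ≤
      I ⊔ varIdeal N K ^ (T + 1) ⊔ Ideal.span {ℓ} * varIdeal N K ^ (T - 1)) :
    InU e₀ K ℓ I := by
  -- Nakayama's lemma removes the term (X)^(T+1).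
  have hNak : varIdeal N K ^ T ≤ I ⊔ Ideal.span {ℓ} * varIdeal N K ^ (T - 1) := by
    refine Submodule.le_of_le_smul_of_le_jacobson_bot (IsNoetherian.noetherian _)
      (varIdeal_le_jacobson N K) ?_
    rw [smul_eq_mul, ← pow_succ', sup_right_comm]
    exact hT
  have hNak' : ∀ t, T ≤ t → varIdeal N K ^ t ≤ I ⊔ Ideal.span {ℓ} * varIdeal N K ^ (t - 1) := by
    intro t ht
    have h1 : varIdeal N K ^ T * varIdeal N K ^ (t - T) ≤
        (I ⊔ Ideal.span {ℓ} * varIdeal N K ^ (T - 1)) * varIdeal N K ^ (t - T) :=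
      Ideal.mul_mono_left hNak
    rw [← pow_add, Nat.add_sub_cancel' ht, Ideal.sup_mul, mul_assoc, ← pow_add] at h1
    exact h1.trans (sup_le_sup Ideal.mul_le_left
      (Ideal.mul_mono_right (Ideal.pow_le_pow_right (by omega))))
  obtain ⟨f, hf, hreg⟩ := exists_regular_of_isCurveSingularity hC
  have hregpow : ∀ n g, f ^ n * g ∈ I → g ∈ I := fun n => by
    induction n with
    | zero => exact fun g hg => by rwa [pow_zero, one_mul] at hg
    | succ n ih => exact fun g hg => ih g (hreg _ (by rwa [← mul_assoc, ← pow_succ']))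
  -- A power of the nonzerodivisor f lies in I + (ℓ), so ℓ g ∈ I forces f^T g ∈ I and then g ∈ I.
  have hℓreg : ∀ g, ℓ * g ∈ I → g ∈ I := fun g hg => by
    refine hregpow T g ?_
    obtain ⟨a, ha, b, hb, hab⟩ := Submodule.mem_sup.mp (hNak (Ideal.pow_mem_pow hf T))
    obtain ⟨c, hc⟩ := Ideal.mem_span_singleton'.mp (Ideal.mul_le_left hb)
    rw [← hab, ← hc, add_mul, mul_assoc]
    exact add_mem (Ideal.mul_mem_right _ _ ha) (Ideal.mul_mem_left _ _ hg)
  obtain ⟨T', hT'⟩ := Filter.eventually_atTop.mp (eventually_finrank_gradePiece hH)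
  -- Large enough for the inclusion from Nakayama's lemma, for the stable value e₀ of the Hilbert
  -- function, and for comparison with order e₀ + 1. With ℓ injective at this order, its cokernel
  -- has dimension exactly e₀.
  let t := T + T' + e₀
  have hinj : ∀ g, ℓ * g ∈ I ⊔ varIdeal N K ^ (t + 1) → g ∈ I ⊔ varIdeal N K ^ t := by
    intro g hg
    have hg' : ℓ * g ∈ I ⊔ Ideal.span {ℓ} * varIdeal N K ^ t :=
      sup_le le_sup_left (hNak' (t + 1) (by omega)) hg
    obtain ⟨a, ha, b, hb, hab⟩ := Submodule.mem_sup.mp hg'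
    obtain ⟨c, hc, rfl⟩ := Ideal.mem_span_singleton_mul.mp hb
    have : ℓ * (g - c) ∈ I := by
      rw [mul_sub, ← hab, add_sub_cancel_right]
      exact ha
    rw [← sub_add_cancel g c]
    exact Submodule.add_mem_sup (hℓreg _ this) hc
  have h1 := (finrank_mul (n := t + 1) (J := I ⊔ varIdeal N K ^ (t + 1))
    (J' := I ⊔ varIdeal N K ^ t) le_sup_right
    ((Ideal.pow_le_pow_right t.le_succ).trans le_sup_right) ℓ
    fun f hf => mul_mem_sup_pow hℓ t hf).2.mpr hinj
  have h2 := finrank_succ I t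
  have h3 := hT' t (by omega)
  have h4 : Module.finrank K (MvPowerSeries (Fin N) K ⧸
      (I ⊔ Ideal.span {ℓ} ⊔ varIdeal N K ^ (e₀ + 1))) ≤
      Module.finrank K (MvPowerSeries (Fin N) K ⧸
        (I ⊔ varIdeal N K ^ (t + 1) ⊔ Ideal.span {ℓ})) :=
    finrank_le_of_le (n := t + 1) (le_sup_right.trans le_sup_left) (by
      rw [sup_right_comm]
      exact sup_le_sup_left (Ideal.pow_le_pow_right (by omega)) _)
  unfold InU
  omega

variable {k : Type u} [Field k] [Algebra k K] {e₀ : ℕ}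
  {L : Fin (e₀ * (N - 1) + 1) → Fin N → k}

/-- N independent linear forms over k stay independent over K, by their determinant, and so have no
common nonzero zero. -/
theorem card_le_of_inGeneralPosition (hL : InGeneralPosition L) {x : Fin N → K} (hx : x ≠ 0)
    (S : Finset (Fin (e₀ * (N - 1) + 1)))
    (hS : ∀ q ∈ S, ∑ i, algebraMap k K (L q i) * x i = 0) : S.card < N := by
  by_contra! h
  obtain ⟨S', hS', hcard⟩ := Finset.exists_subset_card_eq h
  have hli := hL S' hcard
  let e : Fin N ≃ S' := (finCongr hcard.symm).trans S'.equivFin.symm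
  let B : Matrix (Fin N) (Fin N) k := Matrix.of fun r => L (e r)
  have hB : LinearIndependent k B.row := hli.comp e e.injective
  have hdet : IsUnit B.det :=
    (Matrix.isUnit_iff_isUnit_det _).mp (Matrix.linearIndependent_rows_iff_isUnit.mp hB)
  have hdet' : (B.map (algebraMap k K)).det ≠ 0 := by
    have := hdet.map (algebraMap k K)
    rw [RingHom.map_det] at this
    exact this.ne_zero
  refine hx (Matrix.eq_zero_of_mulVec_eq_zero hdet' (funext fun r => ?_))
  exact hS _ (hS' (e r).2)

/-- If every form failed, each would vanish at a nonzero tangent point. A point of projective space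
serves at most N - 1 of the e₀(N - 1) + 1 forms, so there would be at least e₀ + 1 tangent
directions, against the value e₀ of the Hilbert function in large degrees. -/
theorem exists_inU [IsAlgClosed K] (hL : InGeneralPosition L)
    {I : Ideal (MvPowerSeries (Fin N) K)} {e₁ : ℤ}
    (hC : IsCurveSingularity K I) (hH : HasHilbertPolynomial K I e₀ e₁) :
    ∃ q, InU e₀ K (base K (linForm (L q))) I := by
  classical
  by_contra! hno
  have hpt : ∀ q, ∃ x : Fin N → K, x ≠ 0 ∧ ∑ i, algebraMap k K (L q i) * x i = 0 ∧
      IsTangent I x := fun q => by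
    refine (exists_pow_le_or_exists_isTangent I fun i => algebraMap k K (L q i)).resolve_left ?_
    rintro ⟨T, hT⟩
    refine hno q ?_
    rw [Chart.base_linForm]
    exact inU_of_pow_le hC hH (linForm_mem _) hT
  choose x hx0 hx hxI using hpt
  let F : Fin (e₀ * (N - 1) + 1) → Projectivization K (Fin N → K) := fun q =>
    Projectivization.mk K (x q) (hx0 q)
  have hcard : e₀ + 1 ≤ (Finset.univ.image F).card := by
    by_contra! hlt
    obtain ⟨y, hy, hy'⟩ := Finset.exists_lt_card_fiber_of_mul_lt_card_of_maps_to
      (s := Finset.univ) (t := Finset.univ.image F) (f := F) (n := N - 1)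
      (fun q hq => Finset.mem_image_of_mem F hq) (by
        rw [Finset.card_univ, Fintype.card_fin]
        exact Nat.lt_succ_of_le (Nat.mul_le_mul_right _ (by omega)))
    obtain ⟨q₀, -, rfl⟩ := Finset.mem_image.mp hy
    have := card_le_of_inGeneralPosition hL (hx0 q₀)
        (Finset.univ.filter fun q => F q = F q₀) fun q hq => by
      obtain ⟨c, hc⟩ := (Projectivization.mk_eq_mk_iff' K _ _ (hx0 q₀) (hx0 q)).mp
        (Finset.mem_filter.mp hq).2.symm
      have h0 : ∑ i, algebraMap k K (L q i) * x q₀ i =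
          c * ∑ i, algebraMap k K (L q i) * x q i := by
        rw [Finset.mul_sum, ← hc]
        refine Finset.sum_congr rfl fun i _ => ?_
        rw [Pi.smul_apply, smul_eq_mul]
        ring
      rw [h0, hx q, mul_zero]
    omega
  obtain ⟨S, hS, hScard⟩ := Finset.exists_subset_card_eq hcard
  let y : Fin (e₀ + 1) → S := fun b => S.equivFin.symm (finCongr hScard.symm b)
  have hy : ∀ b, ∃ q, F q = y b := fun b => by
    obtain ⟨q, -, hq⟩ := Finset.mem_image.mp (hS (y b).2)
    exact ⟨q, hq⟩
  choose q hq using hy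
  have hyinj : Function.Injective y :=
    S.equivFin.symm.injective.comp (finCongr hScard.symm).injective
  obtain ⟨T, hT⟩ := Filter.eventually_atTop.mp (eventually_finrank_gradePiece hH)
  have h1 := hT (T + e₀) (by omega)
  have h2 := le_finrank_gradePiece_of_isTangent (I := I) (t := T + e₀) (fun b => x (q b))
    (fun b => hx0 _) (fun b b' hbb' => by
      by_contra! hall
      obtain ⟨j, hj⟩ : ∃ j, x (q b') j ≠ 0 := by
        by_contra! h0
        exact hx0 (q b') (funext h0)
      refine hbb' (hyinj (Subtype.ext ?_))
      rw [← hq b, ← hq b']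
      refine (Projectivization.mk_eq_mk_iff' K _ _ _ _).mpr ⟨x (q b) j / x (q b') j,
        funext fun i => ?_⟩
      rw [Pi.smul_apply, smul_eq_mul, div_mul_eq_mul_div, div_eq_iff hj]
      exact (hall i j).symm) (fun b => hxI _) (by omega)
  omega

/-- The increments equal e₀ from degree e₀ on, so agreement with the polynomial for large t
propagates down to t = e₀. -/
theorem finrank_eq_hilbPoly {I : Ideal (MvPowerSeries (Fin N) K)} {e₁ : ℤ}
    (hH : HasHilbertPolynomial K I e₀ e₁) {ℓ : MvPowerSeries (Fin N) K} (hℓ : ℓ ∈ varIdeal N K)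
    (hU : InU e₀ K ℓ I) {t : ℕ} (ht : e₀ ≤ t) :
    (Module.finrank K (MvPowerSeries (Fin N) K ⧸ (I ⊔ varIdeal N K ^ t)) : ℤ) =
      hilbPoly e₀ e₁ ((t : ℤ) - 1) := by
  obtain ⟨T, hT⟩ := Filter.eventually_atTop.mp hH
  have key : ∀ s, (Module.finrank K (MvPowerSeries (Fin N) K ⧸ (I ⊔ varIdeal N K ^ (t + s))) : ℤ) =
      Module.finrank K (MvPowerSeries (Fin N) K ⧸ (I ⊔ varIdeal N K ^ t)) + e₀ * s := fun s => by
    induction s with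
    | zero => simp
    | succ s ih =>
      have h1 := finrank_succ I (t + s)
      rw [finrank_gradePiece_eq hℓ hU (eventually_finrank_gradePiece hH) (by omega)] at h1
      rw [← add_assoc, h1]
      push_cast
      rw [ih]
      ring
  have h1 := key (T + 1)
  have h2 := hT (t + T) (by omega)
  rw [← add_assoc, h2] at h1
  unfold hilbPoly at h1 ⊢
  push_cast at h1
  linarith

/-- The low monomials lift a basis modulo (X)^e₀ and the top ones a basis of the graded piece of
degree e₀; at order e₀ + 1 only the power r = 0 of ℓ occurs. -/
theorem exists_chart_mem {a s : ℕ} {L : Fin s → Fin N → k} {I : Ideal (MvPowerSeries (Fin N) K)}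
    (q : Fin s) (hU : InU e₀ K (base K (linForm (L q))) I)
    (hd : ∀ t, e₀ ≤ t →
      Module.finrank K (MvPowerSeries (Fin N) K ⧸ (I ⊔ varIdeal N K ^ t)) = a + e₀ * (t - e₀)) :
    ∃ c : Chart N a e₀ s, c.Mem L (e₀ + 1) K (I ⊔ varIdeal N K ^ (e₀ + 1)) := by
  have hn : varIdeal N K ^ e₀ ≤ I ⊔ varIdeal N K ^ e₀ := le_sup_right
  have hn' : varIdeal N K ^ (e₀ + 1) ≤ I ⊔ varIdeal N K ^ (e₀ + 1) := le_sup_right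
  have := moduleFinite_quotient hn
  have := moduleFinite_quotient hn'
  have hgr : Submodule.span K (Set.range fun μ : {μ : lowMon N (e₀ + 1) //
      (μ : Fin N →₀ ℕ).degree = e₀} => mkLin (I ⊔ varIdeal N K ^ (e₀ + 1))
        (mon K ((μ : lowMon N (e₀ + 1)) : Fin N →₀ ℕ))) = gradePiece I e₀ := by
    rw [← span_degMon]
    congr 1
    ext x
    constructor
    · rintro ⟨μ, rfl⟩
      exact ⟨toLex _, mem_degMon.mpr μ.2, rfl⟩
    · rintro ⟨μ, hμ, rfl⟩
      exact ⟨⟨⟨ofLex μ, mem_lowMon.mpr ((mem_degMon.mp hμ).trans_lt e₀.lt_succ_self)⟩,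
        mem_degMon.mp hμ⟩, rfl⟩
  obtain ⟨low, hlow⟩ := exists_fin_span_eq (m := a)
    (fun μ : lowMon N e₀ => mkLin (I ⊔ varIdeal N K ^ e₀) (mon K (μ : Fin N →₀ ℕ))) (by
      rw [span_mon_eq_top hn, finrank_top, hd e₀ le_rfl, Nat.sub_self, mul_zero, add_zero])
  obtain ⟨top, htop⟩ := exists_fin_span_eq (m := e₀) _ (by
    rw [hgr]
    have h1 := finrank_succ I e₀
    rw [hd e₀ le_rfl, hd (e₀ + 1) e₀.le_succ] at h1
    simp only [Nat.sub_self, mul_zero, add_zero, Nat.add_sub_cancel_left, mul_one] at h1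
    omega)
  rw [hgr] at htop
  rw [span_mon_eq_top hn] at hlow
  let c : Chart N a e₀ s := ⟨low, top, fun y => (top y).1, q⟩
  refine Chart.exists_mem_of_isSpanMod c le_rfl hn' (fun t ht htn => ?_) (fun t ht htn => ?_)
    ((inU_sup_pow_iff le_rfl).mpr hU)
  · obtain rfl : t = e₀ + 1 := by omega
    rw [sup_pow_sup_pow _ le_rfl, isSpanMod_iff_mem_span]
    intro f
    have h1 : mkLin (I ⊔ varIdeal N K ^ e₀) f ∈ Submodule.span K
        (Set.range ((fun μ : lowMon N e₀ => mkLin (I ⊔ varIdeal N K ^ e₀)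
          (mon K (μ : Fin N →₀ ℕ))) ∘ low)) := hlow ▸ Submodule.mem_top
    obtain ⟨d, hd⟩ := (Submodule.mem_span_range_iff_exists_fun K).mp h1
    have hd' : mkLin (I ⊔ varIdeal N K ^ e₀) (f - ∑ x, d x • mon K (low x : Fin N →₀ ℕ)) = 0 := by
      rw [map_sub, map_sum, ← hd, sub_eq_zero]
      exact Finset.sum_congr rfl fun x _ => (map_smul _ _ _).symm
    rw [mkLin_eq_zero] at hd'
    obtain ⟨g, hg, h, hh, hgh⟩ := Submodule.mem_sup.mp hd'
    have hf : f = ∑ x, d x • mon K (low x : Fin N →₀ ℕ) + g + h := by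
      rw [add_assoc, hgh, add_sub_cancel]
    rw [hf, map_add, map_add, map_sum, mkLin_eq_zero.mpr (Ideal.mem_sup_left hg), add_zero]
    refine add_mem (Submodule.sum_mem _ fun x _ => ?_) ?_
    · rw [map_smul]
      refine Submodule.smul_mem _ _ (Submodule.subset_span ⟨.inl x, ?_⟩)
      exact congrArg _ (Chart.base_vec_inl x)
    · have h2 := mem_gradePiece (I := I) hh
      rw [← htop] at h2
      refine Submodule.span_mono ?_ h2
      rintro _ ⟨y, rfl⟩
      refine ⟨.inr (y, ⟨0, by omega⟩), congrArg _ ((Chart.base_vec_inr y _).trans ?_)⟩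
      rw [pow_zero, one_mul]
  · rw [sup_pow_sup_pow _ htn]
    exact hd t (by omega)

/-- Chart membership lifts one order at a time, so the chart found at order e₀ + 1 serves all
orders. -/
theorem exists_chart_forall_mem {a s : ℕ} {L : Fin s → Fin N → k}
    {I : Ideal (MvPowerSeries (Fin N) K)}
    (q : Fin s) (hU : InU e₀ K (base K (linForm (L q))) I)
    (hd : ∀ t, e₀ ≤ t →
      Module.finrank K (MvPowerSeries (Fin N) K ⧸ (I ⊔ varIdeal N K ^ t)) = a + e₀ * (t - e₀)) :
    ∃ c : Chart N a e₀ s, ∀ n, e₀ + 1 ≤ n → c.Mem L n K (I ⊔ varIdeal N K ^ n) := by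
  obtain ⟨c, hc⟩ := exists_chart_mem q hU hd
  refine ⟨c, fun n hn => ?_⟩
  induction n, hn using Nat.le_induction with
  | base => exact hc
  | succ n hn ih =>
    refine Chart.mem_succ_of_mem_trunc hn le_sup_right (fun t ht htn => ?_) ?_
    · rw [sup_pow_sup_pow _ htn]
      exact hd t (by omega)
    · rw [sup_pow_sup_pow _ n.le_succ]
      exact ih

end

end

end CurveSing

namespace CurveSing

noncomputable section

/-! ### Ideals of power series and their truncations -/

section

variable {N : ℕ} {A : Type u} [CommRing A]

/-- Krull's intersection theorem for the cyclic module A[[X]]/J. -/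
theorem mem_of_forall_mem_sup_pow [IsNoetherianRing A] {J : Ideal (MvPowerSeries (Fin N) A)}
    {f : MvPowerSeries (Fin N) A} {n₀ : ℕ} (h : ∀ n, n₀ ≤ n → f ∈ J ⊔ varIdeal N A ^ n) :
    f ∈ J := by
  rw [← Ideal.Quotient.eq_zero_iff_mem, ← Submodule.mem_bot (MvPowerSeries (Fin N) A),
    ← Ideal.iInf_pow_smul_eq_bot_of_le_jacobson (M := MvPowerSeries (Fin N) A ⧸ J) _
      (varIdeal_le_jacobson N A), Submodule.mem_iInf]
  intro n
  obtain ⟨g, hg, h, hh, hgh⟩ := Submodule.mem_sup.mp (h (n₀ + n) (by omega))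
  rw [← hgh, map_add, Ideal.Quotient.eq_zero_iff_mem.mpr hg, zero_add]
  have := Submodule.smul_mem_smul (I := varIdeal N A ^ n)
    (Ideal.pow_le_pow_right (Nat.le_add_left n n₀) hh)
    (Submodule.mem_top (x := (1 : MvPowerSeries (Fin N) A ⧸ J)))
  have e : Ideal.Quotient.mk J h = h • (1 : MvPowerSeries (Fin N) A ⧸ J) := by
    change _ = Ideal.Quotient.mk J (h * 1)
    rw [mul_one]
  rw [e]
  exact this

/-- A compatible sequence of truncations is induced by the intersection. -/
theorem iInf_sup_pow_eq {n₀ : ℕ} {J : ℕ → Ideal (MvPowerSeries (Fin N) A)}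
    (hJ : ∀ m, varIdeal N A ^ (n₀ + m) ≤ J m)
    (h : ∀ m, J (m + 1) ⊔ varIdeal N A ^ (n₀ + m) = J m) (m : ℕ) :
    (⨅ j, J j) ⊔ varIdeal N A ^ (n₀ + m) = J m := by
  have hanti : Antitone J := antitone_nat_of_succ_le fun j => by
    rw [← h j]
    exact le_sup_left
  apply le_antisymm (sup_le (iInf_le _ _) (hJ m))
  intro f hf
  have hstep : ∀ j (x : J j), ∃ y : J (j + 1), (x : MvPowerSeries (Fin N) A) - y ∈
      varIdeal N A ^ (n₀ + j) := fun j x => by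
    obtain ⟨y, hy, z, hz, hyz⟩ := Submodule.mem_sup.mp ((h j).symm ▸ x.2 :
      (x : MvPowerSeries (Fin N) A) ∈ J (j + 1) ⊔ varIdeal N A ^ (n₀ + j))
    refine ⟨⟨y, hy⟩, ?_⟩
    rw [← hyz, add_sub_cancel_left]
    exact hz
  choose next hnext using hstep
  -- Successive lifts of f along the sequence form an (X)-adic Cauchy sequence; its limit y lies in
  -- every J j.
  let X : ∀ j, J (m + j) := fun j => Nat.rec ⟨f, hf⟩ (fun j y => next (m + j) y) j
  let x : ℕ → MvPowerSeries (Fin N) A := fun j => (X j).1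
  have hx : ∀ j, x j - x (j + 1) ∈ varIdeal N A ^ (n₀ + (m + j)) := fun j => hnext (m + j) (X j)
  have hx' : ∀ i j, x i - x (i + j) ∈ varIdeal N A ^ (n₀ + (m + i)) := fun i j => by
    induction j with
    | zero =>
      rw [add_zero, sub_self]
      exact zero_mem _
    | succ j ih =>
      rw [← sub_add_sub_cancel _ (x (i + j))]
      exact add_mem ih (Ideal.pow_le_pow_right (by omega) (hx (i + j)))
  -- The coefficient at μ no longer changes from index deg μ + 1 on, so it is read there.
  let y : MvPowerSeries (Fin N) A := fun μ => MvPowerSeries.coeff μ (x (μ.degree + 1))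
  have hy : ∀ i, x i - y ∈ varIdeal N A ^ (n₀ + (m + i)) := fun i => by
    rw [mem_varIdeal_pow]
    intro μ hμ
    rw [map_sub, sub_eq_zero]
    change _ = MvPowerSeries.coeff μ (x (μ.degree + 1))
    rcases le_total i (μ.degree + 1) with hle | hle
    · obtain ⟨j, hj⟩ := Nat.exists_eq_add_of_le hle
      have := mem_varIdeal_pow.mp (hx' i j) μ hμ
      rw [map_sub, sub_eq_zero, ← hj] at this
      exact this
    · obtain ⟨j, hj⟩ := Nat.exists_eq_add_of_le hle
      have := mem_varIdeal_pow.mp (hx' (μ.degree + 1) j) μ (by omega)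
      rw [map_sub, sub_eq_zero, ← hj] at this
      exact this.symm
  have hyJ : y ∈ ⨅ j, J j := by
    rw [Submodule.mem_iInf]
    intro i
    refine hanti (Nat.le_add_left i m) ?_
    rw [← sub_sub_cancel (x i) y]
    exact sub_mem (X i).2 (hJ _ (hy i))
  rw [← add_sub_cancel y f]
  exact Submodule.add_mem_sup hyJ (hy 0)

/-- A quotient of `A[[X]]` is flat if all its truncations of high order are. -/
theorem flat_of_flat_trunc [IsNoetherianRing A] {J : Ideal (MvPowerSeries (Fin N) A)} {n₀ : ℕ}
    (h : ∀ n, n₀ ≤ n → Module.Flat A (MvPowerSeries (Fin N) A ⧸ (J ⊔ varIdeal N A ^ n))) :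
    Module.Flat A (MvPowerSeries (Fin N) A ⧸ J) := by
  rw [Module.Flat.iff_lTensor_injective']
  intro 𝔞
  rw [injective_iff_map_eq_zero]
  intro z hz
  let Q := MvPowerSeries (Fin N) A ⧸ J
  let 𝔪 : Ideal Q := (varIdeal N A).map (Ideal.Quotient.mk J)
  have h𝔪 : 𝔪 ≤ (⊥ : Ideal Q).jacobson := by
    rw [Ideal.map_le_iff_le_comap]
    intro f hf
    rw [Ideal.mem_comap, Ideal.mem_jacobson_bot]
    intro y
    obtain ⟨g, rfl⟩ := Ideal.Quotient.mk_surjective y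
    rw [← map_mul, ← map_one (Ideal.Quotient.mk J), ← map_add]
    exact (Ideal.mem_jacobson_bot.mp (varIdeal_le_jacobson N A hf) g).map _
  -- By flatness of the truncation the image of z in A[[X]]/(J + (X)^n) ⊗ 𝔞 vanishes, and right
  -- exactness puts z into 𝔪^n (Q ⊗ 𝔞).
  have hz' : ∀ n, n₀ ≤ n → z ∈ (𝔪 ^ n • ⊤ : Submodule Q (Q ⊗[A] 𝔞)) := by
    intro n hn
    have := h n hn
    let ρ : Q →ₗ[A] MvPowerSeries (Fin N) A ⧸ (J ⊔ varIdeal N A ^ n) :=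
      (Ideal.Quotient.factorₐ A (le_sup_left : J ≤ J ⊔ varIdeal N A ^ n)).toLinearMap
    have h0 : LinearMap.rTensor 𝔞 ρ z = 0 := by
      refine (Module.Flat.iff_lTensor_injective'.mp this 𝔞) ?_
      rw [map_zero, ← LinearMap.comp_apply, LinearMap.lTensor_comp_rTensor,
        ← LinearMap.rTensor_comp_lTensor, LinearMap.comp_apply, hz, map_zero]
    have hex := rTensor_exact 𝔞 (f := (LinearMap.ker ρ).subtype) (g := ρ)
      (LinearMap.exact_subtype_ker_map ρ) (Ideal.Quotient.factor_surjective (le_sup_left : J ≤ J ⊔ varIdeal N A ^ n))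
    obtain ⟨w, rfl⟩ := (hex z).mp h0
    clear h0 hz
    induction w using TensorProduct.induction_on with
    | zero =>
      rw [map_zero]
      exact zero_mem _
    | tmul x y =>
      have hx : (x : Q) ∈ 𝔪 ^ n := by
        obtain ⟨f, hf⟩ := Ideal.Quotient.mk_surjective (x : Q)
        have hker : ρ x = 0 := x.2
        rw [← hf] at hker ⊢
        obtain ⟨g, hg, h, hh, rfl⟩ := Submodule.mem_sup.mp (Ideal.Quotient.eq_zero_iff_mem.mp hker)
        rw [map_add, Ideal.Quotient.eq_zero_iff_mem.mpr hg, zero_add, ← Ideal.map_pow]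
        exact Ideal.mem_map_of_mem _ hh
      have h1 := Submodule.smul_mem_smul hx
        (Submodule.mem_top (x := (1 : Q) ⊗ₜ[A] y))
      rw [TensorProduct.smul_tmul', smul_eq_mul, mul_one] at h1
      exact h1
    | add x y hx hy =>
      rw [map_add]
      exact add_mem hx hy
  -- Q ⊗ 𝔞 is finite over the noetherian ring Q, so Krull's theorem gives z = 0.
  rw [← Submodule.mem_bot Q, ← Ideal.iInf_pow_smul_eq_bot_of_le_jacobson (M := Q ⊗[A] 𝔞) _ h𝔪,
    Submodule.mem_iInf]
  intro n
  exact Submodule.smul_mono_left (Ideal.pow_le_pow_right (Nat.le_add_left n n₀))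
    (hz' (n₀ + n) (by omega))

end

end

end CurveSing

namespace CurveSing

noncomputable section

/-! ### Families of curve singularities -/

section

variable {N : ℕ} {K : Type u} [Field K] {I : Ideal (MvPowerSeries (Fin N) K)}
  {ℓ : MvPowerSeries (Fin N) K}

/-- Modulo the nonzerodivisor ℓ the ring is nonzero and finite over K, hence of dimension zero. So
the dimension is one, and ℓ alone is a regular sequence of that length. -/
theorem isCurveSingularity_of_regular (hℓ : ℓ ∈ varIdeal N K) (hI : I ≠ ⊤)
    (hreg : ∀ f, ℓ * f ∈ I → f ∈ I) {e : ℕ} (he : varIdeal N K ^ e ≤ I ⊔ Ideal.span {ℓ}) :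
    IsCurveSingularity K I := by
  have : Nontrivial (MvPowerSeries (Fin N) K ⧸ I) := Ideal.Quotient.nontrivial_iff.mpr hI
  have hloc : IsLocalRing (MvPowerSeries (Fin N) K ⧸ I) :=
    IsLocalRing.of_surjective' (Ideal.Quotient.mk I) Ideal.Quotient.mk_surjective
  have hnu : I ⊔ Ideal.span {ℓ} ≠ ⊤ := fun h => hI (by
    rw [Ideal.eq_top_iff_one] at h
    obtain ⟨x, hx, y, hy, hxy⟩ := Submodule.mem_sup.mp h
    obtain ⟨g, rfl⟩ := Ideal.mem_span_singleton'.mp hy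
    refine Ideal.eq_top_of_isUnit_mem I hx ?_
    have := Ideal.mem_jacobson_bot.mp (varIdeal_le_jacobson N K hℓ) (-g)
    rwa [show ℓ * -g + 1 = x by rw [← hxy]; ring] at this)
  have hmem : Ideal.Quotient.mk I ℓ ∈ IsLocalRing.maximalIdeal (MvPowerSeries (Fin N) K ⧸ I) := by
    rw [IsLocalRing.mem_maximalIdeal, mem_nonunits_iff]
    intro hu
    apply hnu
    rw [Ideal.eq_top_iff_one]
    obtain ⟨y, hy⟩ := hu.exists_right_inv
    obtain ⟨g, rfl⟩ := Ideal.Quotient.mk_surjective y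
    rw [← map_mul, ← map_one (Ideal.Quotient.mk I), Ideal.Quotient.eq] at hy
    rw [← sub_sub_cancel (ℓ * g) 1]
    exact sub_mem (Ideal.mem_sup_right (S := I)
      (Ideal.mul_mem_right _ _ (Ideal.mem_span_singleton_self ℓ))) (Ideal.mem_sup_left hy)
  have hsreg : IsSMulRegular (MvPowerSeries (Fin N) K ⧸ I) (Ideal.Quotient.mk I ℓ) := by
    rw [isSMulRegular_iff_right_eq_zero_of_smul]
    intro x hx
    obtain ⟨g, rfl⟩ := Ideal.Quotient.mk_surjective x
    rw [smul_eq_mul, ← map_mul, Ideal.Quotient.eq_zero_iff_mem] at hx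
    exact Ideal.Quotient.eq_zero_iff_mem.mpr (hreg g hx)
  have hdim0 : ringKrullDim ((MvPowerSeries (Fin N) K ⧸ I) ⧸
      Ideal.span {Ideal.Quotient.mk I ℓ}) = 0 := by
    have h1 : Ideal.span {Ideal.Quotient.mk I ℓ} =
        (Ideal.span {ℓ}).map (Ideal.Quotient.mk I) := by
      rw [Ideal.map_span, Set.image_singleton]
    rw [h1, ringKrullDim_eq_of_ringEquiv (DoubleQuot.quotQuotEquivQuotSup I (Ideal.span {ℓ}))]
    have := moduleFinite_quotient he
    have : IsArtinianRing (MvPowerSeries (Fin N) K ⧸ (I ⊔ Ideal.span {ℓ})) :=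
      IsArtinianRing.of_finite K _
    have : Nontrivial (MvPowerSeries (Fin N) K ⧸ (I ⊔ Ideal.span {ℓ})) :=
      Ideal.Quotient.nontrivial_iff.mpr hnu
    exact le_antisymm (Ring.krullDimLE_iff.mp inferInstance) ringKrullDim_nonneg_of_nontrivial
  have hdim := ringKrullDim_quotient_span_singleton_succ_eq_ringKrullDim hsreg hmem
  rw [hdim0, zero_add] at hdim
  refine ⟨hdim.symm, hloc, [Ideal.Quotient.mk I ℓ], ?_, ?_⟩
  · refine ⟨(RingTheory.Sequence.isWeaklyRegular_singleton_iff _ _).mpr hsreg, ?_⟩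
    rw [Ideal.ofList_singleton, smul_eq_mul, Ideal.mul_top]
    intro h
    exact (IsLocalRing.mem_maximalIdeal _).mp hmem (Ideal.span_singleton_eq_top.mp h.symm)
  · rw [← hdim]
    rfl

/-- Injectivity of ℓ between successive truncations passes to the limit by Krull's theorem; e₀ > 0
excludes the unit ideal. -/
theorem isCurveSingularity_of_inU {a e₀ : ℕ} (he : 0 < e₀) (hℓ : ℓ ∈ varIdeal N K)
    (hU : InU e₀ K ℓ I) (hd : ∀ t, e₀ + 1 ≤ t →
      Module.finrank K (MvPowerSeries (Fin N) K ⧸ (I ⊔ varIdeal N K ^ t)) = a + e₀ * (t - e₀)) :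
    IsCurveSingularity K I := by
  refine isCurveSingularity_of_regular hℓ ?_ (fun f hf => ?_) (e := e₀) fun f hf => ?_
  · rintro rfl
    have h1 := hd (e₀ + 1) le_rfl
    rw [top_sup_eq, Nat.add_sub_cancel_left, mul_one] at h1
    have : Subsingleton (MvPowerSeries (Fin N) K ⧸ (⊤ : Ideal (MvPowerSeries (Fin N) K))) :=
      Ideal.Quotient.subsingleton_iff.mpr rfl
    rw [Module.finrank_zero_of_subsingleton] at h1
    omega
  · refine mem_of_forall_mem_sup_pow (n₀ := e₀ + 1) fun n hn => ?_
    refine mem_of_mul_mem hℓ hU ?_ (Ideal.mem_sup_left hf)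
    rw [hd n hn, hd (n + 1) (by omega), Nat.sub_add_comm (by omega)]
    ring
  · exact mem_of_forall_mem_sup_pow (n₀ := 0) fun n _ => pow_le_sup_span hU n hf

theorem hasHilbertPolynomial_of_finrank {a e₀ : ℕ} {e₁ : ℤ}
    (ha : (a : ℤ) = hilbPoly e₀ e₁ ((e₀ : ℤ) - 1)) (hd : ∀ t, e₀ + 1 ≤ t →
      Module.finrank K (MvPowerSeries (Fin N) K ⧸ (I ⊔ varIdeal N K ^ t)) = a + e₀ * (t - e₀)) :
    HasHilbertPolynomial K I e₀ e₁ := by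
  refine Filter.eventually_atTop.mpr ⟨e₀, fun t ht => ?_⟩
  have h1 := hilbPoly_eq_card ha (t := t + 1) (by omega)
  rw [CellIdx.card, ← hd (t + 1) (by omega)] at h1
  rw [← h1]
  congr 1
  push_cast
  ring

end

section

variable {k : Type u} [Field k] {A : Type u} [CommRing A] [Algebra k A]

/-- Families are tested on A/m, charts on the residue field of a prime; these maps pass from one to
the other. -/
theorem exists_residue_quotient (P : PrimeSpectrum A) [P.asIdeal.IsMaximal] :
    ∃ (φ : A ⧸ P.asIdeal →ₐ[k] P.asIdeal.ResidueField)
      (ψ : P.asIdeal.ResidueField →ₐ[k] A ⧸ P.asIdeal),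
      φ.comp (Ideal.Quotient.mkₐ k P.asIdeal) = residueMap k P ∧
      ψ.comp (residueMap k P) = Ideal.Quotient.mkₐ k P.asIdeal := by
  let φ : A ⧸ P.asIdeal →ₐ[k] P.asIdeal.ResidueField :=
    Ideal.Quotient.liftₐ P.asIdeal (residueMap k P) fun a ha =>
      Ideal.algebraMap_residueField_eq_zero.mpr ha
  have hφ : φ.comp (Ideal.Quotient.mkₐ k P.asIdeal) = residueMap k P := rfl
  have hbij : Function.Bijective φ := by
    constructor
    · rw [injective_iff_map_eq_zero]
      intro x hx
      obtain ⟨a, rfl⟩ := Ideal.Quotient.mk_surjective x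
      exact Ideal.Quotient.eq_zero_iff_mem.mpr (Ideal.algebraMap_residueField_eq_zero.mp hx)
    · intro x
      obtain ⟨a, rfl⟩ := P.asIdeal.algebraMap_residueField_surjective x
      exact ⟨Ideal.Quotient.mk _ a, rfl⟩
  let e := AlgEquiv.ofBijective φ hbij
  refine ⟨φ, e.symm.toAlgHom, hφ, AlgHom.ext fun a => ?_⟩
  exact e.symm_apply_eq.mpr rfl

/-- The residue fields at closed points of a scheme of finite type over `k`. -/
theorem isAlgClosed_quotient [IsAlgClosed k] [Algebra.FiniteType k A] (m : Ideal A) [m.IsMaximal] :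
    letI : Field (A ⧸ m) := Ideal.Quotient.field m
    IsAlgClosed (A ⧸ m) := by
  let _ : Field (A ⧸ m) := Ideal.Quotient.field m
  have : Module.Finite k (A ⧸ m) := finite_of_finite_type_of_isJacobsonRing k (A ⧸ m)
  exact IsAlgClosed.of_ringEquiv k (A ⧸ m) (RingEquiv.ofBijective (algebraMap k (A ⧸ m))
    IsAlgClosed.algebraMap_bijective_of_isIntegral)

variable {N a e₀ : ℕ} {e₁ : ℤ} {J : Ideal (MvPowerSeries (Fin N) A)}

/-- Locally free truncations make the limit flat, and on a closed fibre the chart supplies the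
dimensions and the condition `InU`. -/
theorem isFamily_of_locChart {s : ℕ} {L : Fin s → Fin N → k} [IsNoetherianRing A]
    (ha : (a : ℤ) = hilbPoly e₀ e₁ ((e₀ : ℤ) - 1)) (he : 0 < e₀)
    (h : ∀ n, e₀ + 1 ≤ n → LocChart a L e₀ n A (J ⊔ varIdeal N A ^ n)) :
    IsFamily N e₀ e₁ A J := by
  have hfree : ∀ n, e₀ + 1 ≤ n → IsLocallyFreeOfRank A
      (MvPowerSeries (Fin N) A ⧸ (J ⊔ varIdeal N A ^ n)) (Fintype.card (CellIdx a e₀ n)) :=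
    fun n hn => by
      have := (h n hn).isLocallyFreeOfRank hn le_rfl
      rwa [sup_pow_sup_pow _ le_rfl] at this
  have hflat : ∀ n, e₀ + 1 ≤ n →
      Module.Flat A (MvPowerSeries (Fin N) A ⧸ (J ⊔ varIdeal N A ^ n)) := fun n hn => by
    have := (hfree n hn).2.1
    infer_instance
  refine ⟨flat_of_flat_trunc hflat, hflat, fun n hn P => ?_, fun m hm => ?_⟩
  · have := hflat n hn
    have := (hfree n hn).1
    rw [hilbPoly_eq_card ha (by omega), ← (hfree n hn).2.2 P, Module.rankAtStalk_eq]
  · let _ : Field (A ⧸ m) := Ideal.Quotient.field m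
    let P : PrimeSpectrum A := ⟨m, hm.isPrime⟩
    have : P.asIdeal.IsMaximal := hm
    obtain ⟨-, ψ, -, hψ⟩ := exists_residue_quotient (k := k) P
    have hmem : ∀ n, e₀ + 1 ≤ n → ∃ c : Chart N a e₀ s, c.Mem L n (A ⧸ m)
        (extendIdeal (Ideal.Quotient.mk m) J ⊔ varIdeal N (A ⧸ m) ^ n) := fun n hn => by
      obtain ⟨c, hc⟩ := (h n hn).exists_mem_residue P
      have := hc.extend ψ
      rw [← extendIdeal_algHom_comp, hψ] at this
      rw [← extendIdeal_sup_pow]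
      exact ⟨c, this⟩
    have hd : ∀ t, e₀ + 1 ≤ t → Module.finrank (A ⧸ m) (MvPowerSeries (Fin N) (A ⧸ m) ⧸
        (extendIdeal (Ideal.Quotient.mk m) J ⊔ varIdeal N (A ⧸ m) ^ t)) = a + e₀ * (t - e₀) :=
      fun t ht => by
        obtain ⟨c, hc⟩ := hmem t ht
        have := hc.hasDims t ht le_rfl
        rwa [sup_pow_sup_pow _ le_rfl] at this
    obtain ⟨c, hc⟩ := hmem (e₀ + 1) le_rfl
    exact ⟨isCurveSingularity_of_inU he Chart.base_ell_mem
      ((inU_sup_pow_iff le_rfl).mp hc.inU) hd, hasHilbertPolynomial_of_finrank ha hd⟩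

/-- P is contained in a maximal ideal m, whose residue field is algebraically closed, so the fibre
there lies in a chart. The chart spreads to a neighbourhood of m, and that neighbourhood contains P.
-/
theorem locChart_of_isFamily [IsAlgClosed k] [Algebra.FiniteType k A]
    {L : Fin (e₀ * (N - 1) + 1) → Fin N → k} (hL : InGeneralPosition L)
    (ha : (a : ℤ) = hilbPoly e₀ e₁ ((e₀ : ℤ) - 1)) (h : IsFamily N e₀ e₁ A J) {n : ℕ}
    (hn : e₀ + 1 ≤ n) : LocChart a L e₀ n A (J ⊔ varIdeal N A ^ n) := by
  have : IsNoetherianRing A := Algebra.FiniteType.isNoetherianRing k A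
  have hfree : ∀ n, e₀ + 1 ≤ n → IsLocallyFreeOfRank A
      (MvPowerSeries (Fin N) A ⧸ (J ⊔ varIdeal N A ^ n)) (Fintype.card (CellIdx a e₀ n)) :=
    fun n hn => by
      have := h.flat_trunc n hn
      have hfin := moduleFinite_quotient (le_sup_right : varIdeal N A ^ n ≤ J ⊔ varIdeal N A ^ n)
      have := Module.finitePresentation_of_finite A
        (MvPowerSeries (Fin N) A ⧸ (J ⊔ varIdeal N A ^ n))
      refine ⟨hfin, Module.Flat.projective_of_finitePresentation, fun P => ?_⟩
      rw [← hilbPoly_eq_card ha (by omega), ← h.length_trunc n hn P, Module.rankAtStalk_eq]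
  refine ⟨le_sup_right, fun P => ?_⟩
  obtain ⟨m, hm, hPm⟩ := Ideal.exists_le_maximal P.asIdeal P.2.ne_top
  let _ : Field (A ⧸ m) := Ideal.Quotient.field m
  let P' : PrimeSpectrum A := ⟨m, hm.isPrime⟩
  have : P'.asIdeal.IsMaximal := hm
  obtain ⟨φ, -, hφ, -⟩ := exists_residue_quotient (k := k) P'
  have : IsAlgClosed (A ⧸ m) := isAlgClosed_quotient (k := k) m
  obtain ⟨hC, hH⟩ := h.closed_fibre m
  obtain ⟨q, hq⟩ := exists_inU hL hC hH
  have hd : ∀ t, e₀ ≤ t → Module.finrank (A ⧸ m) (MvPowerSeries (Fin N) (A ⧸ m) ⧸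
      (extendIdeal (Ideal.Quotient.mk m) J ⊔ varIdeal N (A ⧸ m) ^ t)) = a + e₀ * (t - e₀) :=
    fun t ht => by
      have h1 := finrank_eq_hilbPoly hH (by rw [Chart.base_linForm]; exact linForm_mem _) hq ht
      rw [hilbPoly_eq_card ha ht, CellIdx.card] at h1
      exact_mod_cast h1
  obtain ⟨c, hc⟩ := exists_chart_forall_mem q hq hd
  have hc' := (hc n hn).extend φ
  have hext : extendIdeal φ.toRingHom
      (extendIdeal (Ideal.Quotient.mk m) J ⊔ varIdeal N (A ⧸ m) ^ n) =
      extendIdeal (residueMap k P').toRingHom (J ⊔ varIdeal N A ^ n) := by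
    rw [← hφ, extendIdeal_algHom_comp]
    exact congrArg (extendIdeal φ.toRingHom) (extendIdeal_sup_pow _ J n).symm
  rw [hext] at hc'
  obtain ⟨f, hf, hmem⟩ := exists_away_mem (P := P') hn le_sup_right (fun t ht htn => by
    rw [sup_pow_sup_pow _ htn]
    exact hfree t ht) hc'
  exact ⟨f, fun hfP => hf (hPm hfP), c, hmem⟩

end

end

end CurveSing

namespace CurveSing

noncomputable section

/-! ### Assembling the representing system -/

/-- Forms whose coefficients are the powers of distinct scalars: their minors are Vandermonde
determinants. -/
theorem exists_inGeneralPosition (k : Type u) [Field k] [Infinite k] (N e₀ : ℕ) :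
    ∃ L : Fin (e₀ * (N - 1) + 1) → Fin N → k, InGeneralPosition L := by
  let x : Fin (e₀ * (N - 1) + 1) → k := fun q => Infinite.natEmbedding k q
  have hx : Function.Injective x := (Infinite.natEmbedding k).injective.comp Fin.val_injective
  refine ⟨fun q i => x q ^ (i : ℕ), fun S hS => ?_⟩
  let e : Fin N ≃ S := (finCongr hS.symm).trans S.equivFin.symm
  have hdet : (Matrix.vandermonde fun r => x (e r)).det ≠ 0 :=
    Matrix.det_vandermonde_ne_zero_iff.mpr
      (hx.comp (Subtype.val_injective.comp e.injective))
  have hli : LinearIndependent k (Matrix.vandermonde fun r => x (e r)).row :=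
    Matrix.linearIndependent_rows_iff_isUnit.mpr
      ((Matrix.isUnit_iff_isUnit_det _).mpr (isUnit_iff_ne_zero.mpr hdet))
  exact (linearIndependent_equiv e).mp hli

/-- For e₀ = 0 the condition would put 1 into I + (X). Then I contains a unit, and the zero ring is
not one-dimensional. -/
theorem pos_of_inU {N e₀ : ℕ} {K : Type u} [Field K] {I : Ideal (MvPowerSeries (Fin N) K)}
    {ℓ : MvPowerSeries (Fin N) K} (hC : IsCurveSingularity K I) (hℓ : ℓ ∈ varIdeal N K)
    (hU : InU e₀ K ℓ I) : 0 < e₀ := by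
  rw [Nat.pos_iff_ne_zero]
  rintro rfl
  have h1 : (1 : MvPowerSeries (Fin N) K) ∈ I ⊔ varIdeal N K := by
    have h2 := pow_le_sup_span hU 1
    rw [pow_zero, Ideal.one_eq_top, pow_one] at h2
    exact sup_le (sup_le_sup_left ((Ideal.span_singleton_le_iff_mem _).mpr hℓ) I) le_sup_right
      (h2 Submodule.mem_top)
  obtain ⟨x, hx, y, hy, hxy⟩ := Submodule.mem_sup.mp h1
  have hu := Ideal.mem_jacobson_bot.mp (varIdeal_le_jacobson N K hy) (-1)
  rw [show y * -1 + 1 = x by linear_combination -hxy] at hu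
  obtain rfl := Ideal.eq_top_of_isUnit_mem I hx hu
  have : Subsingleton (MvPowerSeries (Fin N) K ⧸ (⊤ : Ideal (MvPowerSeries (Fin N) K))) :=
    Ideal.Quotient.subsingleton_iff.mpr rfl
  have h3 := hC.1
  rw [ringKrullDim_eq_bot_of_subsingleton] at h3
  exact absurd h3 (by simp)

section

variable {k : Type u} [Field k] {N s a e₀ : ℕ} {L : Fin s → Fin N → k}

/-- The ideal of `A[[X]]` defined by a compatible sequence of truncations. -/
def limIdeal {A : Type u} [CommRing A] [Algebra k A] (x : (limFunctor a e₀ L).obj A) :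
    Ideal (MvPowerSeries (Fin N) A) :=
  ⨅ m, x.1 m

variable {A : Type u} [CommRing A] [Algebra k A]

theorem limIdeal_sup_pow (x : (limFunctor a e₀ L).obj A) (m : ℕ) :
    limIdeal x ⊔ varIdeal N A ^ (e₀ + 1 + m) = x.1 m :=
  iInf_sup_pow_eq (fun m => (x.2 m).1.1) (fun m => (x.2 m).2) m

theorem limIdeal_injective :
    Function.Injective (limIdeal : (limFunctor a e₀ L).obj A → Ideal _) := fun x y h =>
  Subtype.ext (funext fun m => by rw [← limIdeal_sup_pow, ← limIdeal_sup_pow, h])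

/-- Over a noetherian ring J is closed in the (X)-adic topology, hence recovered from its
truncations. -/
theorem eq_limIdeal [IsNoetherianRing A] {J : Ideal (MvPowerSeries (Fin N) A)}
    {x : (limFunctor a e₀ L).obj A} (h : ∀ m, J ⊔ varIdeal N A ^ (e₀ + 1 + m) = x.1 m) :
    limIdeal x = J := by
  apply le_antisymm
  · intro f hf
    refine mem_of_forall_mem_sup_pow (n₀ := e₀ + 1) fun n hn => ?_
    obtain ⟨m, rfl⟩ := Nat.exists_eq_add_of_le hn
    rw [h]
    exact (Submodule.mem_iInf _).mp hf m
  · refine le_iInf fun m => ?_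
    rw [← h]
    exact le_sup_left

/-- Extension of ideals need not commute with infinite intersections, but both sides have the same
truncations, which decide equality over a noetherian target. -/
theorem limIdeal_map {B : Type u} [CommRing B] [Algebra k B] [IsNoetherianRing B] (φ : A →ₐ[k] B)
    (x : (limFunctor a e₀ L).obj A) :
    limIdeal ((limFunctor a e₀ L).map φ x) = extendIdeal φ.toRingHom (limIdeal x) :=
  eq_limIdeal fun m => by
    rw [← extendIdeal_sup_pow, limIdeal_sup_pow]
    rfl

theorem isFamily_limIdeal [IsNoetherianRing A] {e₁ : ℤ}
    (ha : (a : ℤ) = hilbPoly e₀ e₁ ((e₀ : ℤ) - 1)) (he : 0 < e₀)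
    (x : (limFunctor a e₀ L).obj A) : IsFamily N e₀ e₁ A (limIdeal x) :=
  isFamily_of_locChart ha he fun n hn => by
    obtain ⟨m, rfl⟩ := Nat.exists_eq_add_of_le hn
    rw [limIdeal_sup_pow]
    exact (x.2 m).1

theorem exists_limIdeal_eq [IsAlgClosed k] [Algebra.FiniteType k A] {e₁ : ℤ}
    {L : Fin (e₀ * (N - 1) + 1) → Fin N → k} (hL : InGeneralPosition L)
    (ha : (a : ℤ) = hilbPoly e₀ e₁ ((e₀ : ℤ) - 1)) {J : Ideal (MvPowerSeries (Fin N) A)}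
    (h : IsFamily N e₀ e₁ A J) : ∃ x : (limFunctor a e₀ L).obj A, limIdeal x = J := by
  have : IsNoetherianRing A := Algebra.FiniteType.isNoetherianRing k A
  refine ⟨⟨fun m => J ⊔ varIdeal N A ^ (e₀ + 1 + m), fun m =>
    ⟨locChart_of_isFamily hL ha h (by omega), ?_⟩⟩, eq_limIdeal fun m => rfl⟩
  exact sup_pow_sup_pow J (by omega)

end

end

end CurveSing

/-! ### The main theorem -/

theorem mainTheorem1 {k : Type u} [Field k] [IsAlgClosed k] (N e₀ : ℕ) (e₁ : ℤ)
    (hp : ∃ I : Ideal (MvPowerSeries (Fin N) k),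
      CurveSing.IsCurveSingularity k I ∧ CurveSing.HasHilbertPolynomial k I e₀ e₁) :
    (∃ L : Fin (e₀ * (N - 1) + 1) → Fin N → k, CurveSing.InGeneralPosition L) ∧
    ∀ L : Fin (e₀ * (N - 1) + 1) → Fin N → k, CurveSing.InGeneralPosition L →
      -- `Ξ m` is the scheme `Ξ_n` and `a m` is the map `a_{n+1} : Ξ_{n+1} → Ξ_n`, `n = e₀ + 1 + m`
      ∃ (Ξ : ℕ → Over (Spec (CommRingCat.of k)))
        (τ : ∀ m, CurveSing.PointIdeals N k (Ξ m))
        (a : ∀ m, Ξ (m + 1) ⟶ Ξ m)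
        (H : Cone (Functor.ofOpSequence a))
        (σ : CurveSing.PointIdeals N k H.pt),
        (∀ m, LocallyOfFiniteType (Ξ m).hom ∧ QuasiCompact (Ξ m).hom) ∧
        (∀ m, CurveSing.Represents (τ m) (fun _ _ _ => True)
          (fun A _ _ J => CurveSing.IsPointXi e₁ L (e₀ + 1 + m) A J)) ∧
        (∀ (m : ℕ) (A : Type u) [CommRing A] [Algebra k A]
          (g : CurveSing.specOver k A ⟶ Ξ (m + 1)),
          τ m A (g ≫ a m) = τ (m + 1) A g ⊔ CurveSing.varIdeal N A ^ (e₀ + 1 + m)) ∧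
        (∀ m, e₀ + 4 ≤ e₀ + 1 + (m + 1) → IsAffineHom (a m).left) ∧
        Nonempty (IsLimit H) ∧
        CurveSing.Represents σ (fun A _ _ => Algebra.FiniteType k A)
          (fun A _ _ J => CurveSing.IsFamily N e₀ e₁ A J) ∧
        (∀ (m : ℕ) (A : Type u) [CommRing A] [Algebra k A], Algebra.FiniteType k A →
          ∀ g : CurveSing.specOver k A ⟶ H.pt,
            τ m A (g ≫ H.π.app (op m)) = σ A g ⊔ CurveSing.varIdeal N A ^ (e₀ + 1 + m)) := by
  refine ⟨CurveSing.exists_inGeneralPosition k N e₀, fun L hL => ?_⟩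
  obtain ⟨I, hC, hH⟩ := hp
  obtain ⟨q, hq⟩ := CurveSing.exists_inU hL hC hH
  have hℓ : CurveSing.base k (CurveSing.linForm (L q)) ∈ CurveSing.varIdeal N k := by
    rw [CurveSing.Chart.base_linForm]
    exact CurveSing.linForm_mem _
  have he := CurveSing.pos_of_inU hC hℓ hq
  -- The given singularity shows that p(e₀ - 1) is a natural number: its dimension at order e₀,
  -- which serves as the number a of low monomials.
  have ha := CurveSing.finrank_eq_hilbPoly hH hℓ hq le_rfl
  obtain ⟨Ξ, τ, t, H, σ, hft, hτ, hτnat, ht, haff, hlim, hσ, hσnat, hproj⟩ :=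
    CurveSing.exists_xi_system (k := k) (e₀ := e₀) (L := L)
      (a := Module.finrank k (MvPowerSeries (Fin N) k ⧸ (I ⊔ CurveSing.varIdeal N k ^ e₀)))
  refine ⟨Ξ, fun m A _ _ g => (τ m A g).1, t, H, fun A _ _ g => CurveSing.limIdeal (σ A g), hft,
    fun m => ⟨fun A _ _ _ => ⟨fun g _ => ?_, ?_, fun J hJ => ?_⟩, ?_⟩, ?_, fun m _ => haff m, hlim,
    ⟨fun A _ _ hA => ⟨fun g _ => ?_, ?_, fun J hJ => ?_⟩, ?_⟩, ?_⟩
  · exact (CurveSing.isPointXi_iff ha (by omega) L).mpr (τ m A g).2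
  · exact fun g _ g' _ h => (hτ m A).1 (Subtype.ext h)
  · obtain ⟨g, hg⟩ := (hτ m A).2 ⟨J, (CurveSing.isPointXi_iff ha (by omega) L).mp hJ⟩
    exact ⟨g, trivial, congrArg Subtype.val hg⟩
  · exact fun A B _ _ _ _ _ _ φ g => congrArg Subtype.val (hτnat m A B φ g)
  · exact fun m A _ _ g => congrArg Subtype.val (ht m A g)
  · have : IsNoetherianRing A := Algebra.FiniteType.isNoetherianRing k A
    exact CurveSing.isFamily_limIdeal ha he _
  · exact fun g _ g' _ h => (hσ A).1 (CurveSing.limIdeal_injective h)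
  · obtain ⟨x, hx⟩ := CurveSing.exists_limIdeal_eq hL ha hJ
    obtain ⟨g, hg⟩ := (hσ A).2 x
    exact ⟨g, trivial, (congrArg CurveSing.limIdeal hg).trans hx⟩
  · intro A B _ _ _ _ hA hB φ g
    have : IsNoetherianRing B := Algebra.FiniteType.isNoetherianRing k B
    exact (congrArg CurveSing.limIdeal (hσnat A B φ g)).trans (CurveSing.limIdeal_map φ _)
  · intro m A _ _ _ g
    exact (congrArg Subtype.val (hproj m A g)).trans (CurveSing.limIdeal_sup_pow _ m).symm
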